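/- **Setting.** Let $M$ be a smooth (Hausdorff, second countable) manifold of dimension $m\ge 1$. A divergence-free $n$-web $\mathcal W_\Omega=(M,\mathcal F_1,\dots,\mathcal F_n,\Omega)$ consists of smooth foliations $\mathcal F_i$ of $M$ of codimension $c_i$ in general position, i.e. $\operatorname{codim}\bigcap_i T_p\mathcal F_i=\sum_i\operatorname{codim}T_p\mathcal F_i$ for every $p\in M$, and a smooth nowhere-vanishing $m$-form $\Omega$; it is assumed that $\sum_i c_i=m$. Put $m_i=c_1+\dots+c_{i-1}$, $\pi_i=\{m_i+1,\dots,m_i+c_i\}$, and write $j\sim k$ if $j,k$ lie in the same block $\pi_i$. *Local triviality.* The standard divergence-free web of codimension $(c_1,\dots,c_n)$ is $\mathbb R^m$ with the foliations by the level sets of $(x_k)_{k\in\pi_i}$, $i=1,\dots,n$, and the form $dx_1\wedge\dots\wedge dx_m$. $\mathcal W_\Omega$ is locally trivial if for each $p\in M$ there is a diffeomorphism from a neighbourhood of $p$ onto a neighbourhood of $0\in\mathbb R^m$, sending $p$ to $0$, which carries the leaves of the (restricted) foliations of $\mathcal W_\Omega$ onto those of the standard web, up to a permutation of the foliations, and which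 pulls $dx_1\wedge\dots\wedge dx_m$ back to $\Omega$. *$\mathcal W_\Omega$-connections.* A local coframe $(\xi^1,\dots,\xi^m)$ with dual frame $(e_1,\dots,e_m)$ is adapted if $T\mathcal F_i=\bigcap_{k\in\pi_i}\ker\xi^k$ for all $i$ and $\Omega=\xi^1\wedge\dots\wedge\xi^m$. A $\mathcal W_\Omega$-connection is a smooth torsionless affine connection $\Theta$ on $M$ whose connection forms $\theta^j_k=\xi^j(\nabla e_k)$ in every adapted coframe satisfy $\theta^j_k=0$ for $j\not\sim k$ and $\sum_k\theta^k_k=0$. *Determinant bundles.* Let $T\mathcal F_i^c=\bigcap_{j\ne i}T\mathcal F_j$ (of rank $c_i$) and let $\det T\mathcal F_i^c\subseteq\bigwedge^{c_i}TM$ be its top exterior power. A linear connection $\omega$ on $\bigoplus_{i=1}^n\det T\mathcal F_i^c$ is induced by $\Theta$ if, for all $i$ and all smooth vector fields $Y_1,\dots,Y_{c_i}$ tangent to $T\mathcal F_i^c$, $\omega_X(Y_1\wedge\dots\wedge Y_{c_i})=\sum_k Y_1\wedge\dots\wedge\Theta_XY_k\wedge\dots\wedge Y_{c_i}$ in the $i$-th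 summand. **Theorem.** Let $\mathcal W_\Omega$ be a divergence-free $n$-web as above. $\mathcal W_\Omega$-connections exist. Every $\mathcal W_\Omega$-connection $\Theta$ induces exactly one linear connection $\omega$ on $\bigoplus_{i=1}^n\det T\mathcal F_i^c$, and $\omega$ does not depend on the choice of $\Theta$ (it is called the natural connection of $\mathcal W_\Omega$). Moreover, $\mathcal W_\Omega$ is locally trivial if and only if its natural connection $\omega$ is flat, i.e. has vanishing curvature. -/

import Mathlib

open scoped Manifold ContDiff

noncomputable section

namespace WebGeometry

/-! ### Vector fields, forms, foliations -/

/-- The model space `ℝ^m`. -/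
abbrev Model (m : ℕ) : Type := EuclideanSpace ℝ (Fin m)

/-- The vector field `X` is smooth on `U`. -/
def SmoothFieldOn {m : ℕ} {M : Type*} [TopologicalSpace M] [ChartedSpace (Model m) M]
    [IsManifold (𝓡 m) ∞ M] (X : ∀ p : M, TangentSpace (𝓡 m) p) (U : Set M) : Prop :=
  ContMDiffOn (𝓡 m) (𝓡 m).tangent ∞ (fun p => (⟨p, X p⟩ : TangentBundle (𝓡 m) M)) U

/-- The differential `k`-form `β` is smooth on the open set `U`: it sends smooth vector fields
on `U` to smooth functions on `U`. -/
def SmoothFormOn {m : ℕ} {M : Type*} [TopologicalSpace M] [ChartedSpace (Model m) M]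
    [IsManifold (𝓡 m) ∞ M] {k : ℕ} (β : ∀ p : M, (TangentSpace (𝓡 m) p) [⋀^Fin k]→ₗ[ℝ] ℝ)
    (U : Set M) : Prop :=
  ∀ X : Fin k → ∀ p : M, TangentSpace (𝓡 m) p, (∀ j, SmoothFieldOn (X j) U) →
    ContMDiffOn (𝓡 m) 𝓘(ℝ, ℝ) ∞ (fun p => β p (fun j => X j p)) U

/-- A smooth foliation of codimension `c` on an `m`-dimensional manifold, recorded by its tangent
distribution. It is locally given by flat charts of the smooth atlas in which the plaques are the
level sets of `c` of the coordinates. -/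
structure Foliation (m : ℕ) (M : Type*) [TopologicalSpace M] [ChartedSpace (Model m) M]
    (c : ℕ) where
  /-- The tangent spaces `T_p 𝓕`. -/
  tangent : ∀ p : M, Submodule ℝ (TangentSpace (𝓡 m) p)
  exists_flat_chart : ∀ p : M, ∃ e ∈ IsManifold.maximalAtlas (𝓡 m) ∞ M, p ∈ e.source ∧
    ∃ S : Finset (Fin m), S.card = c ∧ ∀ q ∈ e.source, ∀ v : TangentSpace (𝓡 m) q,
      v ∈ tangent q ↔ ∀ k ∈ S, EuclideanSpace.proj (𝕜 := ℝ) k (mfderiv (𝓡 m) (𝓡 m) e q v) = 0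

/-- `p` and `q` lie on a smooth curve inside `U` which is everywhere tangent to the foliation. -/
def Foliation.Joined {m : ℕ} {M : Type*} [TopologicalSpace M] [ChartedSpace (Model m) M] {c : ℕ}
    (F : Foliation m M c) (U : Set M) (p q : M) : Prop :=
  ∃ γ : ℝ → M, ContMDiff 𝓘(ℝ, ℝ) (𝓡 m) ∞ γ ∧ γ 0 = p ∧ γ 1 = q ∧
    ∀ t : ℝ, γ t ∈ U ∧ mfderiv 𝓘(ℝ, ℝ) (𝓡 m) γ t (1 : ℝ) ∈ F.tangent (γ t)

/-- The leaf through `p ∈ U` of the restriction of the foliation to the open set `U`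
(for small `U` this is a plaque; for `U = univ` it is the leaf through `p`): the set of points
which can be reached from `p` within `U` along curves tangent to the foliation. -/
def Foliation.leafIn {m : ℕ} {M : Type*} [TopologicalSpace M] [ChartedSpace (Model m) M] {c : ℕ}
    (F : Foliation m M c) (U : Set M) (p : M) : Set M :=
  {q | Relation.ReflTransGen (F.Joined U) p q}

/-! ### Divergence-free webs -/

/-- The block `π_i = {m_i + 1, …, m_i + c_i}`, `m_i = c_1 + ⋯ + c_{i-1}`, of indices belonging to
the `i`-th foliation (here the indices start at `0`). -/
def block {m n : ℕ} (c : Fin n → ℕ) (i : Fin n) : Finset (Fin m) :=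
  {k : Fin m | ∑ j ∈ Finset.univ.filter (· < i), c j ≤ (k : ℕ) ∧
    (k : ℕ) < ∑ j ∈ Finset.univ.filter (· < i), c j + c i}

/-- A divergence-free `n`-web on `M`: `n` foliations of codimensions `c_1, …, c_n` in general
position, with `c_1 + ⋯ + c_n = m = dim M`, and a smooth nowhere-vanishing volume form. -/
structure DivFreeWeb (m : ℕ) (M : Type*) [TopologicalSpace M] [ChartedSpace (Model m) M]
    [IsManifold (𝓡 m) ∞ M] {n : ℕ} (c : Fin n → ℕ) where
  /-- The foliations of the web. -/
  fol : ∀ i : Fin n, Foliation m M (c i)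
  general_position : ∀ p : M,
    Module.finrank ℝ (TangentSpace (𝓡 m) p ⧸ ⨅ i, (fol i).tangent p) =
      ∑ i, Module.finrank ℝ (TangentSpace (𝓡 m) p ⧸ (fol i).tangent p)
  sum_codim : ∑ i, c i = m
  /-- The volume form. -/
  vol : ∀ p : M, (TangentSpace (𝓡 m) p) [⋀^Fin m]→ₗ[ℝ] ℝ
  vol_smooth : SmoothFormOn vol Set.univ
  vol_ne_zero : ∀ p : M, vol p ≠ 0

/-- `W` at `p` and `W'` at `p'` are locally equivalent: some diffeomorphism `φ` from a
neighbourhood of `p` to a neighbourhood of `p'` maps `p` to `p'`, carries the leaves of the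
foliations of `W` onto those of `W'` up to a permutation of the foliations, and pulls the volume
form of `W'` back to that of `W`. -/
def LocallyEquivalentAt {m n : ℕ} {c : Fin n → ℕ}
    {M : Type*} [TopologicalSpace M] [ChartedSpace (Model m) M] [IsManifold (𝓡 m) ∞ M]
    {N : Type*} [TopologicalSpace N] [ChartedSpace (Model m) N] [IsManifold (𝓡 m) ∞ N]
    (W : DivFreeWeb m M c) (p : M) (W' : DivFreeWeb m N c) (p' : N) : Prop :=
  ∃ φ : OpenPartialHomeomorph M N,
    ContMDiffOn (𝓡 m) (𝓡 m) ∞ φ φ.source ∧ ContMDiffOn (𝓡 m) (𝓡 m) ∞ φ.symm φ.target ∧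
    p ∈ φ.source ∧ φ p = p' ∧
    (∃ σ : Equiv.Perm (Fin n), ∀ i, ∀ q ∈ φ.source,
      φ '' ((W.fol i).leafIn φ.source q) = (W'.fol (σ i)).leafIn φ.target (φ q)) ∧
    ∀ q ∈ φ.source, ∀ v : Fin m → TangentSpace (𝓡 m) q,
      W.vol q v = W'.vol (φ q) (fun j => mfderiv (𝓡 m) (𝓡 m) φ q (v j))

/-! ### The standard divergence-free web -/

lemma card_block {m n : ℕ} (c : Fin n → ℕ) (hc : ∑ i, c i = m) (i : Fin n) :
    (block (m := m) c i).card = c i := by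
  set a := ∑ j ∈ Finset.univ.filter (· < i), c j with ha
  have hle : a + c i ≤ m := by
    rw [← hc, ha, add_comm, ← Finset.sum_insert (s := Finset.univ.filter (· < i)) (by simp)]
    exact Finset.sum_le_sum_of_subset (Finset.subset_univ _)
  have h : (block (m := m) c i).map Fin.valEmbedding = Finset.Ico a (a + c i) := by
    ext k
    simp only [block, Finset.mem_map, Finset.mem_filter, Finset.mem_univ, true_and,
      Fin.valEmbedding_apply, Finset.mem_Ico]
    constructor
    · rintro ⟨x, hx, rfl⟩
      exact hx
    · intro hk
      exact ⟨⟨k, by omega⟩, hk, rfl⟩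
  have := congrArg Finset.card h
  simpa using this

lemma exists_mem_block {m n : ℕ} (c : Fin n → ℕ) (hc : ∑ i, c i = m) (k : Fin m) :
    ∃ i, k ∈ block c i := by
  have hne : (Finset.univ.filter fun i : Fin n =>
      ∑ j ∈ Finset.univ.filter (· < i), c j ≤ (k : ℕ)).Nonempty := by
    have hn : 0 < n := by
      rcases Nat.eq_zero_or_pos n with h | h
      · subst h
        simp only [Finset.univ_eq_empty, Finset.sum_empty] at hc
        exact absurd k.2 (by omega)
      · exact h
    refine ⟨⟨0, hn⟩, ?_⟩
    simp only [Finset.mem_filter, Finset.mem_univ, true_and]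
    rw [Finset.sum_eq_zero]
    · exact Nat.zero_le _
    · intro j hj
      simp [Fin.lt_def] at hj
  set i := Finset.max' _ hne with hi
  have hmem := Finset.max'_mem _ hne
  rw [← hi] at hmem
  simp only [Finset.mem_filter, Finset.mem_univ, true_and] at hmem
  refine ⟨i, ?_⟩
  simp only [block, Finset.mem_filter, Finset.mem_univ, true_and]
  refine ⟨hmem, ?_⟩
  by_contra hlt
  rw [not_lt, add_comm, ← Finset.sum_insert (s := Finset.univ.filter (· < i)) (by simp)] at hlt
  by_cases hl : (i : ℕ) + 1 < n
  · have h1 : (⟨i + 1, hl⟩ : Fin n) ∈ (Finset.univ.filter fun i : Fin n =>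
        ∑ j ∈ Finset.univ.filter (· < i), c j ≤ (k : ℕ)) := by
      simp only [Finset.mem_filter, Finset.mem_univ, true_and]
      refine le_trans (le_of_eq (Finset.sum_congr ?_ fun _ _ => rfl)) hlt
      ext j
      simp only [Finset.mem_filter, Finset.mem_univ, true_and, Finset.mem_insert, Fin.lt_def,
        Fin.ext_iff]
      omega
    have h2 := Finset.le_max' _ _ h1
    rw [← hi] at h2
    simp only [Fin.le_def] at h2
    omega
  · have h1 : insert i (Finset.univ.filter (· < i)) = Finset.univ := by
      ext j
      simp only [Finset.mem_filter, Finset.mem_univ, true_and, Finset.mem_insert, Fin.lt_def,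
        Fin.ext_iff, iff_true]
      omega
    rw [h1, hc] at hlt
    omega

/-- The subspace of `ℝ^m` on which the coordinates with index in `S` vanish. -/
def coordSubspace {m : ℕ} (S : Finset (Fin m)) : Submodule ℝ (Model m) :=
  ⨅ k ∈ S, LinearMap.ker (EuclideanSpace.projₗ k : Model m →ₗ[ℝ] ℝ)

lemma mem_coordSubspace {m : ℕ} (S : Finset (Fin m)) (v : Model m) :
    v ∈ coordSubspace S ↔ ∀ k ∈ S, v k = 0 := by
  simp [coordSubspace, Submodule.mem_iInf]

lemma finrank_quotient_coordSubspace {m : ℕ} (S : Finset (Fin m)) :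
    Module.finrank ℝ (Model m ⧸ coordSubspace S) = S.card := by
  let f : Model m →ₗ[ℝ] (S → ℝ) :=
    LinearMap.pi fun k => (EuclideanSpace.projₗ (k : Fin m) : Model m →ₗ[ℝ] ℝ)
  have hker : LinearMap.ker f = coordSubspace S := by
    ext v
    rw [mem_coordSubspace, LinearMap.mem_ker]
    constructor
    · intro h k hk
      exact congrFun h ⟨k, hk⟩
    · intro h
      funext k
      exact h k k.2
  have hsurj : Function.Surjective f := by
    intro w
    refine ⟨WithLp.toLp 2 fun k => if h : k ∈ S then w ⟨k, h⟩ else 0, ?_⟩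
    funext k
    simp [f]
  rw [← hker, (f.quotKerEquivOfSurjective hsurj).finrank_eq]
  simp

/-- The foliation of `ℝ^m` by the level sets of the coordinates with index in `S`. -/
def coordFoliation {m c : ℕ} (S : Finset (Fin m)) (hS : S.card = c) :
    Foliation m (Model m) c where
  tangent _ := coordSubspace S
  exists_flat_chart p := by
    refine ⟨OpenPartialHomeomorph.refl (Model m), ?_, by simp, S, hS, fun q _ v => ?_⟩
    · have := IsManifold.chart_mem_maximalAtlas (I := 𝓡 m) (n := ∞) p
      rwa [chartAt_self_eq] at this
    · have : mfderiv (𝓡 m) (𝓡 m) (OpenPartialHomeomorph.refl (Model m)) q =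
          ContinuousLinearMap.id ℝ (TangentSpace (𝓡 m) q) := mfderiv_id
      rw [this]
      exact mem_coordSubspace S v

/-- The Lebesgue volume form `dx_1 ∧ ⋯ ∧ dx_m` on `ℝ^m`. -/
def lebesgueForm (m : ℕ) (p : Model m) : (TangentSpace (𝓡 m) p) [⋀^Fin m]→ₗ[ℝ] ℝ :=
  (EuclideanSpace.basisFun (Fin m) ℝ).toBasis.det

lemma lebesgueForm_smooth (m : ℕ) : SmoothFormOn (lebesgueForm m) Set.univ := by
  intro X hX
  have hX' : ∀ j, ContDiff ℝ ∞ (fun p : Model m => (X j p : Model m)) := fun j =>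
    contDiffOn_univ.1 (contMDiffOn_vectorSpace_iff_contDiffOn.1 (hX j))
  rw [contMDiffOn_univ, contMDiff_iff_contDiff]
  have h : (fun p => lebesgueForm m p fun j => X j p) = fun p : Model m =>
      ∑ σ : Equiv.Perm (Fin m), ((Equiv.Perm.sign σ : ℤ) : ℝ) *
        ∏ j, EuclideanSpace.proj (𝕜 := ℝ) (σ j) (X j p : Model m) := by
    funext p
    have key : ∀ u : Fin m → Model m, (EuclideanSpace.basisFun (Fin m) ℝ).toBasis.det u =
        ∑ σ : Equiv.Perm (Fin m), ((Equiv.Perm.sign σ : ℤ) : ℝ) *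
          ∏ j, EuclideanSpace.proj (𝕜 := ℝ) (σ j) (u j) := by
      intro u
      rw [Module.Basis.det_apply, Matrix.det_apply']
      rfl
    exact key fun j => X j p
  rw [h]
  exact ContDiff.sum fun σ _ => contDiff_const.mul
    (contDiff_prod fun j _ => (ContinuousLinearMap.contDiff _).comp (hX' j))

/-- The standard divergence-free web of codimension `(c_1, …, c_n)` on `ℝ^m`: the `i`-th foliation
consists of the level sets of the `i`-th block of coordinates. -/
def standardWeb {m n : ℕ} (c : Fin n → ℕ) (hc : ∑ i, c i = m) : DivFreeWeb m (Model m) c where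
  fol i := coordFoliation (block c i) (card_block c hc i)
  general_position p := by
    have h0 : (⨅ i, coordSubspace (block c i) : Submodule ℝ (Model m)) = ⊥ := by
      rw [eq_bot_iff]
      intro v hv
      rw [Submodule.mem_iInf] at hv
      rw [Submodule.mem_bot]
      ext k
      obtain ⟨i, hi⟩ := exists_mem_block c hc k
      exact (mem_coordSubspace _ _).1 (hv i) k hi
    change Module.finrank ℝ (Model m ⧸ ⨅ i, coordSubspace (block c i)) =
      ∑ i, Module.finrank ℝ (Model m ⧸ coordSubspace (block c i))
    rw [h0, (Submodule.quotEquivOfEqBot _ rfl).finrank_eq]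
    simp only [finrank_quotient_coordSubspace, card_block c hc, hc, finrank_euclideanSpace,
      Fintype.card_fin]
  sum_codim := hc
  vol := lebesgueForm m
  vol_smooth := lebesgueForm_smooth m
  vol_ne_zero _ := (EuclideanSpace.basisFun (Fin m) ℝ).toBasis.det_ne_zero

namespace DivFreeWeb

variable {m n : ℕ} {c : Fin n → ℕ} {M : Type*} [TopologicalSpace M] [ChartedSpace (Model m) M]
  [IsManifold (𝓡 m) ∞ M] (W : DivFreeWeb m M c)

/-- The web is locally equivalent, at each point, to the standard divergence-free web. -/
def LocallyTrivial : Prop :=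
  ∀ p : M, LocallyEquivalentAt W p (standardWeb c W.sum_codim) 0

/-! ### Connections adapted to the web -/

/-- `ξ` is a coframe on `U` adapted to the web, with dual frame `e`: the `i`-th foliation is the
common kernel of the `i`-th block of `ξ`, and the volume form is `ξ^1 ∧ ⋯ ∧ ξ^m`. (A coframe is
smooth iff its dual frame is.) -/
structure IsAdaptedCoframe (U : Set M) (ξ : Fin m → ∀ p : M, TangentSpace (𝓡 m) p →ₗ[ℝ] ℝ)
    (e : Fin m → ∀ p : M, TangentSpace (𝓡 m) p) : Prop where
  smooth : ∀ k, SmoothFieldOn (e k) U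
  dual : ∀ p ∈ U, ∀ j k, ξ j p (e k p) = if j = k then 1 else 0
  tangent : ∀ p ∈ U, ∀ i, (W.fol i).tangent p = ⨅ k ∈ block c i, LinearMap.ker (ξ k p)
  vol : ∀ p ∈ U, ∀ v : Fin m → TangentSpace (𝓡 m) p,
    W.vol p v = Matrix.det (Matrix.of fun j k => ξ j p (v k))

/-- A smooth torsionless affine connection `Θ` is a `W`-connection if its connection forms
`θ^j_k = ξ^j(∇ e_k)` in each adapted coframe satisfy `θ^j_k = 0` for `j`, `k` in different blocks
and `∑_k θ^k_k = 0`. -/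
structure IsWebConnection
    (Θ : CovariantDerivative (𝓡 m) (Model m) (TangentSpace (𝓡 m) : M → Type _)) : Prop where
  smooth : CovariantDerivative.ContMDiffCovariantDerivative Θ ∞
  torsion : Θ.torsion = 0
  offdiag : ∀ (U : Set M) (ξ : Fin m → ∀ p : M, TangentSpace (𝓡 m) p →ₗ[ℝ] ℝ)
    (e : Fin m → ∀ p : M, TangentSpace (𝓡 m) p), IsOpen U → W.IsAdaptedCoframe U ξ e →
    ∀ p ∈ U, ∀ j k, (¬ ∃ i, j ∈ block c i ∧ k ∈ block c i) →
      ∀ v : TangentSpace (𝓡 m) p, ξ j p (Θ (e k) p v) = 0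
  trace : ∀ (U : Set M) (ξ : Fin m → ∀ p : M, TangentSpace (𝓡 m) p →ₗ[ℝ] ℝ)
    (e : Fin m → ∀ p : M, TangentSpace (𝓡 m) p), IsOpen U → W.IsAdaptedCoframe U ξ e →
    ∀ p ∈ U, ∀ v : TangentSpace (𝓡 m) p, ∑ k, ξ k p (Θ (e k) p v) = 0

/-! ### The Whitney sum of the determinant bundles -/

/-- The tangent space `T_p 𝓕_i^c = ⋂_{j ≠ i} T_p 𝓕_j` of the complementary foliation. -/
def complTangent (i : Fin n) (p : M) : Submodule ℝ (TangentSpace (𝓡 m) p) :=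
  ⨅ j, ⨅ (_ : j ≠ i), (W.fol j).tangent p

/-- The fibre at `p` of the determinant bundle `det T𝓕_i^c`: the multivectors in `⋀^{c_i} T_p M`
that come from `⋀^{c_i} T_p 𝓕_i^c`, where `c_i = dim T_p 𝓕_i^c`. -/
def detFiber (i : Fin n) (p : M) : Submodule ℝ (⋀[ℝ]^(c i) (TangentSpace (𝓡 m) p)) :=
  LinearMap.range (exteriorPower.map (c i) (W.complTangent i p).subtype)

/-- The space of smooth sections of the Whitney sum `⊕_i det T𝓕_i^c`. A multivector field is
smooth iff its pairing with each smooth differential form (on each open set) is smooth. -/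
def detSections : Submodule ℝ (∀ p : M, ∀ i : Fin n, ⋀[ℝ]^(c i) (TangentSpace (𝓡 m) p)) where
  carrier := {η | (∀ p i, η p i ∈ W.detFiber i p) ∧
    ∀ (i : Fin n) (U : Set M) (β : ∀ p : M, (TangentSpace (𝓡 m) p) [⋀^Fin (c i)]→ₗ[ℝ] ℝ),
      IsOpen U → SmoothFormOn β U →
      ContMDiffOn (𝓡 m) 𝓘(ℝ, ℝ) ∞
        (fun p => exteriorPower.alternatingMapLinearEquiv (β p) (η p i)) U}
  add_mem' := by
    rintro η η' ⟨h1, h2⟩ ⟨h1', h2'⟩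
    refine ⟨fun p i => Submodule.add_mem _ (h1 p i) (h1' p i), fun i U β hU hβ => ?_⟩
    simp only [Pi.add_apply, map_add]
    exact (h2 i U β hU hβ).add (h2' i U β hU hβ)
  zero_mem' := by
    refine ⟨fun p i => Submodule.zero_mem _, fun i U β hU hβ => ?_⟩
    simp only [Pi.zero_apply, map_zero]
    exact contMDiffOn_const
  smul_mem' := by
    rintro a η ⟨h1, h2⟩
    refine ⟨fun p i => Submodule.smul_mem _ a (h1 p i), fun i U β hU hβ => ?_⟩
    simp only [Pi.smul_apply, map_smul, smul_eq_mul]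
    exact contMDiffOn_const.mul (h2 i U β hU hβ)

/-- The product `f η` of a smooth function and a smooth section. -/
def smulSection (f : M → ℝ) (hf : ContMDiff (𝓡 m) 𝓘(ℝ, ℝ) ∞ f) (η : W.detSections) :
    W.detSections :=
  ⟨fun p i => f p • η.1 p i, by
    refine ⟨fun p i => Submodule.smul_mem _ (f p) (η.2.1 p i), fun i U β hU hβ => ?_⟩
    simp only [map_smul, smul_eq_mul]
    exact hf.contMDiffOn.mul (η.2.2 i U β hU hβ)⟩

/-- The section `Y_1 ∧ ⋯ ∧ Y_{c_i}` of the `i`-th summand, for smooth vector fields `Y_j` tangent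
to the complementary foliation `𝓕_i^c`. -/
def wedgeSection (i : Fin n) (Y : Fin (c i) → ∀ p : M, TangentSpace (𝓡 m) p)
    (hY : ∀ j, SmoothFieldOn (Y j) Set.univ) (hYt : ∀ j p, Y j p ∈ W.complTangent i p) :
    W.detSections :=
  ⟨fun p => Pi.single i (exteriorPower.ιMulti ℝ (c i) (fun j => Y j p)), by
    constructor
    · intro p i'
      by_cases h : i' = i
      · subst h
        beta_reduce
        rw [Pi.single_eq_same]
        exact ⟨exteriorPower.ιMulti ℝ (c i') (fun j => ⟨Y j p, hYt j p⟩),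
          exteriorPower.map_apply_ιMulti _ _⟩
      · beta_reduce
        rw [Pi.single_eq_of_ne h]
        exact Submodule.zero_mem _
    · intro i' U β hU hβ
      by_cases h : i' = i
      · subst h
        simp only [Pi.single_eq_same, exteriorPower.alternatingMapLinearEquiv_apply_ιMulti]
        exact hβ Y (fun j => (hY j).mono (Set.subset_univ _))
      · simp only [Pi.single_eq_of_ne h, map_zero]
        exact contMDiffOn_const⟩

/-- A (smooth) linear connection on the vector bundle `⊕_i det T𝓕_i^c`:
`toFun η p v` is the covariant derivative `(∇_v η)(p)` of the section `η` along `v ∈ T_p M`. -/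
@[ext]
structure DetConnection where
  /-- The covariant derivative. -/
  toFun : W.detSections → ∀ p : M,
    TangentSpace (𝓡 m) p →ₗ[ℝ] (∀ i : Fin n, ⋀[ℝ]^(c i) (TangentSpace (𝓡 m) p))
  smooth : ∀ (X : ∀ p : M, TangentSpace (𝓡 m) p), SmoothFieldOn X Set.univ →
    ∀ η, (fun p => toFun η p (X p)) ∈ W.detSections
  add : ∀ η η' p, toFun (η + η') p = toFun η p + toFun η' p
  leibniz : ∀ (f : M → ℝ) (hf : ContMDiff (𝓡 m) 𝓘(ℝ, ℝ) ∞ f) (η : W.detSections) (p : M)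
    (v : TangentSpace (𝓡 m) p), toFun (W.smulSection f hf η) p v =
      (mvfderiv (𝓡 m) f p v) • η.1 p + f p • toFun η p v

variable {W}

/-- The section `∇_X η`. -/
def DetConnection.deriv (D : W.DetConnection) (X : ∀ p : M, TangentSpace (𝓡 m) p)
    (hX : SmoothFieldOn X Set.univ) (η : W.detSections) : W.detSections :=
  ⟨fun p => D.toFun η p (X p), D.smooth X hX η⟩

/-- The curvature `∇_X ∇_Y η - ∇_Y ∇_X η - ∇_{[X, Y]} η` vanishes identically. -/
def DetConnection.Flat (D : W.DetConnection) : Prop :=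
  ∀ (X Y : ∀ p : M, TangentSpace (𝓡 m) p) (hX : SmoothFieldOn X Set.univ)
    (hY : SmoothFieldOn Y Set.univ) (η : W.detSections) (p : M),
    D.toFun (D.deriv Y hY η) p (X p) - D.toFun (D.deriv X hX η) p (Y p)
      - D.toFun η p (VectorField.mlieBracket (𝓡 m) X Y p) = 0

/-- `D` is the connection on `⊕_i det T𝓕_i^c` induced by the action of the affine connection `Θ`
on vector fields: `∇_v (Y_1 ∧ ⋯ ∧ Y_{c_i}) = ∑_k Y_1 ∧ ⋯ ∧ Θ_v Y_k ∧ ⋯ ∧ Y_{c_i}`. -/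
def DetConnection.IsInducedBy (D : W.DetConnection)
    (Θ : CovariantDerivative (𝓡 m) (Model m) (TangentSpace (𝓡 m) : M → Type _)) : Prop :=
  ∀ (i : Fin n) (Y : Fin (c i) → ∀ p : M, TangentSpace (𝓡 m) p)
    (hY : ∀ j, SmoothFieldOn (Y j) Set.univ) (hYt : ∀ j p, Y j p ∈ W.complTangent i p)
    (p : M) (v : TangentSpace (𝓡 m) p),
    D.toFun (W.wedgeSection i Y hY hYt) p v =
      Pi.single (M := fun i => ⋀[ℝ]^(c i) (TangentSpace (𝓡 m) p)) i (∑ k, exteriorPower.ιMulti ℝ (c i)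
        (Function.update (fun j => Y j p) k (Θ (Y k) p v)))

end DivFreeWeb

end WebGeometry

end

/-! The whole theorem is read off from one function in each web chart. The functions defining the
foliations jointly have injective differential, because the tangent spaces meet in 0; so they form
coordinates (`exists_webChart`) in which the web is the decomposition of ℝ^m into blocks, with
projections P_i. The volume form becomes ρ dx_1 ∧ ⋯ ∧ dx_m, and f denotes log |ρ|.

Let Γ be the Christoffel symbols of a web connection. The off-diagonal condition says that Γ(a, ·)
preserves blocks. With the symmetry of Γ it follows that Γ(a, b) = 0 for a and b in different
blocks, since the value lies in both. Hence the trace of Γ(a) over block i is the full trace of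
Γ(P_i a), and the trace condition makes that df(P_i a) (`IsWebConnection.exists_christoffel`). This
block trace is exactly the connection form induced on the i-th determinant bundle in the coordinate
frame. The induced connection is therefore d + df∘P_i, whichever web connection is used
(`IsWebConnection.chartDet_wedgeSection`), and the Leibniz rule shows that it is determined by
decomposable sections (`IsPointDerivation.eq_of_wedgeSection`).

Web connections exist in a chart by the explicit symbols `blockSym`, normalised to have trace df.
The conditions are affine, so a partition of unity glues the local solutions
(`exists_isWebConnection`). Existence also yields the chart independence of d + df∘P_i without a
change of coordinates: every chart computes what one fixed web connection induces (`chartDet_eq`).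

The curvature on the i-th summand is the 2-form d(df∘P_i) (`curvature_naturalConnection`). Flatness
thus says that the second derivatives of f mixing two blocks vanish, so near 0 the function f is a
sum of functions of single blocks (`eq_sum_blockProj`) and ρ is a product of such functions.
Integrating each factor in one coordinate of its block gives a block-preserving map with Jacobian
determinant ρ (`exists_triangular_map`), and composing with it turns the volume form into the
standard one (`exists_unimodular_webChart`).

Conversely, a local equivalence with the standard web gives a web chart of constant density, where
the Hessian of f is zero. Since equivalence is stated through leaves, tangent spaces are first
recovered by differentiating curves inside leaves, and a dimension count shows that the permutation
of the foliations respects codimensions (`mem_tangent_iff_of_leafIn`). -/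

open scoped Manifold ContDiff Topology

noncomputable section

namespace WebGeometry

/-! ### Vector fields, derivatives and Lie brackets in a smooth chart. -/

section ChartCalculus

variable {m : ℕ} {M : Type*} [TopologicalSpace M] [ChartedSpace (Model m) M]

/-- An open partial homeomorphism to the model space, smooth in both directions. -/
structure IsSmoothChart (e : OpenPartialHomeomorph M (Model m)) : Prop where
  contMDiffOn : ContMDiffOn (𝓡 m) (𝓡 m) ∞ e e.source
  contMDiffOn_symm : ContMDiffOn (𝓡 m) (𝓡 m) ∞ e.symm e.target

/-- The differential of a chart. -/
def chartD (e : OpenPartialHomeomorph M (Model m)) (q : M) :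
    TangentSpace (𝓡 m) q →L[ℝ] Model m :=
  mfderiv (𝓡 m) (𝓡 m) e q

/-- The inverse of the differential of a chart. -/
def chartDInv (e : OpenPartialHomeomorph M (Model m)) (q : M) :
    Model m →L[ℝ] TangentSpace (𝓡 m) q :=
  (chartD e q).inverse

/-- The coordinate expression of a vector field. -/
def push (e : OpenPartialHomeomorph M (Model m)) (X : ∀ p : M, TangentSpace (𝓡 m) p)
    (x : Model m) : Model m :=
  chartD e (e.symm x) (X (e.symm x))

/-- The vector field with a given coordinate expression. -/
def pull (e : OpenPartialHomeomorph M (Model m)) (V : Model m → Model m) (q : M) :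
    TangentSpace (𝓡 m) q :=
  chartDInv e q (V (e q))

namespace IsSmoothChart

variable {e : OpenPartialHomeomorph M (Model m)} (he : IsSmoothChart e)
include he

lemma mdifferentiable : e.MDifferentiable (𝓡 m) (𝓡 m) :=
  ⟨he.contMDiffOn.mdifferentiableOn (by simp), he.contMDiffOn_symm.mdifferentiableOn (by simp)⟩

lemma contMDiffAt {p : M} (hp : p ∈ e.source) : ContMDiffAt (𝓡 m) (𝓡 m) ∞ e p :=
  he.contMDiffOn.contMDiffAt (e.open_source.mem_nhds hp)

lemma contMDiffAt_symm {x : Model m} (hx : x ∈ e.target) :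
    ContMDiffAt (𝓡 m) (𝓡 m) ∞ e.symm x :=
  he.contMDiffOn_symm.contMDiffAt (e.open_target.mem_nhds hx)

/-- The differential of a chart as an equivalence. -/
def derivEquiv {p : M} (hp : p ∈ e.source) : TangentSpace (𝓡 m) p ≃L[ℝ] Model m :=
  he.mdifferentiable.mfderiv hp

lemma coe_derivEquiv {p : M} (hp : p ∈ e.source) :
    (he.derivEquiv hp : TangentSpace (𝓡 m) p →L[ℝ] Model m) = chartD e p :=
  rfl

lemma derivEquiv_apply {p : M} (hp : p ∈ e.source) (v : TangentSpace (𝓡 m) p) :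
    he.derivEquiv hp v = chartD e p v :=
  rfl

lemma chartDInv_eq {p : M} (hp : p ∈ e.source) :
    chartDInv e p = ((he.derivEquiv hp).symm : Model m →L[ℝ] TangentSpace (𝓡 m) p) := by
  rw [chartDInv, ← he.coe_derivEquiv hp, ContinuousLinearMap.inverse_equiv]

@[simp]
lemma chartD_chartDInv {p : M} (hp : p ∈ e.source) (w : Model m) :
    chartD e p (chartDInv e p w) = w := by
  rw [he.chartDInv_eq hp, ← he.derivEquiv_apply hp]
  exact (he.derivEquiv hp).apply_symm_apply w

@[simp]
lemma chartDInv_chartD {p : M} (hp : p ∈ e.source) (v : TangentSpace (𝓡 m) p) :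
    chartDInv e p (chartD e p v) = v := by
  rw [he.chartDInv_eq hp, ← he.derivEquiv_apply hp]
  exact (he.derivEquiv hp).symm_apply_apply v

lemma chartD_injective {p : M} (hp : p ∈ e.source) : Function.Injective (chartD e p) :=
  (he.derivEquiv hp).injective

lemma isInvertible_mfderiv {p : M} (hp : p ∈ e.source) :
    (mfderiv (𝓡 m) (𝓡 m) e p).IsInvertible :=
  ⟨he.derivEquiv hp, rfl⟩

lemma chartDInv_eq_mfderiv_symm {x : Model m} (hx : x ∈ e.target) :
    chartDInv e (e.symm x) = mfderiv (𝓡 m) (𝓡 m) e.symm x := by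
  ext1 w
  apply he.chartD_injective (e.map_target hx)
  rw [he.chartD_chartDInv (e.map_target hx)]
  exact congrArg (fun L : Model m →L[ℝ] Model m => L w) (he.mdifferentiable.comp_symm_deriv hx).symm

lemma isInvertible_mfderiv_symm {x : Model m} (hx : x ∈ e.target) :
    (mfderiv (𝓡 m) (𝓡 m) e.symm x).IsInvertible := by
  rw [← he.chartDInv_eq_mfderiv_symm hx, he.chartDInv_eq (e.map_target hx)]
  exact ⟨(he.derivEquiv (e.map_target hx)).symm, rfl⟩

/-- Bridge to `VectorField.mpullback`, through which smoothness and bracket naturality are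
inherited. -/
lemma push_eq_mpullback (X : ∀ p : M, TangentSpace (𝓡 m) p) {x : Model m} (hx : x ∈ e.target) :
    push e X x = VectorField.mpullback (𝓡 m) (𝓡 m) e.symm X x := by
  have h : (mfderiv (𝓡 m) (𝓡 m) e.symm x).inverse = chartD e (e.symm x) := by
    rw [← he.chartDInv_eq_mfderiv_symm hx, he.chartDInv_eq (e.map_target hx)]
    exact ContinuousLinearMap.inverse_equiv (he.derivEquiv (e.map_target hx)).symm
  exact congrArg (fun L : TangentSpace (𝓡 m) (e.symm x) →L[ℝ] Model m => L (X (e.symm x))) h.symm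

lemma push_eventuallyEq (X : ∀ p : M, TangentSpace (𝓡 m) p) {x : Model m} (hx : x ∈ e.target) :
    push e X =ᶠ[𝓝 x] VectorField.mpullback (𝓡 m) (𝓡 m) e.symm X := by
  filter_upwards [e.open_target.mem_nhds hx] with y hy using he.push_eq_mpullback X hy

omit he in
lemma push_apply {p : M} (hp : p ∈ e.source) (X : ∀ p : M, TangentSpace (𝓡 m) p) :
    push e X (e p) = chartD e p (X p) := by
  rw [push, e.left_inv hp]

lemma push_pull (V : Model m → Model m) {x : Model m} (hx : x ∈ e.target) :
    push e (pull e V) x = V x := by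
  rw [push, pull, he.chartD_chartDInv (e.map_target hx), e.right_inv hx]

lemma push_pull_eventuallyEq (V : Model m → Model m) {p : M} (hp : p ∈ e.source) :
    push e (pull e V) =ᶠ[𝓝 (e p)] V := by
  filter_upwards [e.open_target.mem_nhds (e.map_source hp)] with y hy using he.push_pull V hy

omit he [ChartedSpace (Model m) M] in
lemma tendsto_symm {p : M} (hp : p ∈ e.source) : Filter.Tendsto e.symm (𝓝 (e p)) (𝓝 p) := by
  have := e.continuousAt_symm (e.map_source hp)
  rwa [ContinuousAt, e.left_inv hp] at this

lemma mdifferentiableAt_comp_symm {F : Type*} [NormedAddCommGroup F] [NormedSpace ℝ F]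
    {f : M → F} {p : M} (hp : p ∈ e.source) (hf : MDifferentiableAt (𝓡 m) 𝓘(ℝ, F) f p) :
    DifferentiableAt ℝ (f ∘ e.symm) (e p) := by
  rw [← mdifferentiableAt_iff_differentiableAt]
  refine MDifferentiableAt.comp (I' := 𝓡 m) (e p) ?_
    ((he.contMDiffAt_symm (e.map_source hp)).mdifferentiableAt (by simp))
  rwa [e.left_inv hp]

lemma contDiffAt_comp_symm {F : Type*} [NormedAddCommGroup F] [NormedSpace ℝ F]
    {f : M → F} {p : M} (hp : p ∈ e.source) (hf : ContMDiffAt (𝓡 m) 𝓘(ℝ, F) ∞ f p) :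
    ContDiffAt ℝ ∞ (f ∘ e.symm) (e p) := by
  rw [← contMDiffAt_iff_contDiffAt]
  refine ContMDiffAt.comp (I' := 𝓡 m) (e p) ?_ (he.contMDiffAt_symm (e.map_source hp))
  rwa [e.left_inv hp]

lemma contMDiffAt_comp {F : Type*} [NormedAddCommGroup F] [NormedSpace ℝ F]
    {f : Model m → F} {p : M} (hp : p ∈ e.source) (hf : ContDiffAt ℝ ∞ f (e p)) :
    ContMDiffAt (𝓡 m) 𝓘(ℝ, F) ∞ (fun q => f (e q)) p :=
  ContMDiffAt.comp (I' := 𝓡 m) p hf.contMDiffAt (he.contMDiffAt hp)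

lemma mvfderiv_eq {F : Type*} [NormedAddCommGroup F] [NormedSpace ℝ F]
    {f : M → F} {p : M} (hp : p ∈ e.source) (hf : MDifferentiableAt (𝓡 m) 𝓘(ℝ, F) f p)
    (v : TangentSpace (𝓡 m) p) :
    mvfderiv (𝓡 m) f p v = fderiv ℝ (f ∘ e.symm) (e p) (chartD e p v) := by
  have h1 : f =ᶠ[𝓝 p] (f ∘ e.symm) ∘ e := by
    filter_upwards [e.open_source.mem_nhds hp] with q hq
    simp [e.left_inv hq]
  have h2 := mfderiv_comp (I := 𝓡 m) (I' := 𝓡 m) (I'' := 𝓘(ℝ, F)) p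
    (g := f ∘ e.symm) (f := e) (he.mdifferentiableAt_comp_symm hp hf).mdifferentiableAt
    ((he.contMDiffAt hp).mdifferentiableAt (by simp))
  have h3 : mfderiv (𝓡 m) 𝓘(ℝ, F) f p v = mfderiv (𝓡 m) 𝓘(ℝ, F) ((f ∘ e.symm) ∘ e) p v := by
    rw [h1.mfderiv_eq]
    rfl
  change mfderiv (𝓡 m) 𝓘(ℝ, F) f p v = _
  rw [h3, h2, mfderiv_eq_fderiv]
  rfl

variable [IsManifold (𝓡 m) ∞ M]

lemma contDiffAt_push {X : ∀ p : M, TangentSpace (𝓡 m) p} {p : M} (hp : p ∈ e.source)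
    (hX : ContMDiffAt (𝓡 m) (𝓡 m).tangent ∞ (fun p => (⟨p, X p⟩ : TangentBundle (𝓡 m) M)) p) :
    ContDiffAt ℝ ∞ (push e X) (e p) := by
  have hx := e.map_source hp
  have h : ContMDiffAt (𝓡 m) (𝓡 m).tangent ∞
      (fun x => (⟨x, VectorField.mpullback (𝓡 m) (𝓡 m) e.symm X x⟩ : TangentBundle (𝓡 m) (Model m)))
      (e p) := by
    refine ContMDiffAt.mpullback_vectorField_preimage (n := ∞) ?_ (he.contMDiffAt_symm hx)
      (he.isInvertible_mfderiv_symm hx) (by simp)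
    rwa [e.left_inv hp]
  have h' := contMDiffAt_vectorSpace_iff_contDiffAt.1 h
  exact h'.congr_of_eventuallyEq (he.push_eventuallyEq X hx)

lemma contMDiffAt_pull {V : Model m → Model m} {p : M} (hp : p ∈ e.source)
    (hV : ContDiffAt ℝ ∞ V (e p)) :
    ContMDiffAt (𝓡 m) (𝓡 m).tangent ∞
      (fun p => (⟨p, pull e V p⟩ : TangentBundle (𝓡 m) M)) p := by
  refine ContMDiffAt.mpullback_vectorField_preimage (n := ∞) ?_ (he.contMDiffAt hp)
      (he.isInvertible_mfderiv hp) (by simp)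
  exact contMDiffAt_vectorSpace_iff_contDiffAt.2 hV

/-- Needed besides the smooth version, because the axioms of a covariant derivative and the torsion
criterion quantify over fields that are only differentiable at the point. -/
lemma differentiableAt_push {X : ∀ p : M, TangentSpace (𝓡 m) p} {p : M} (hp : p ∈ e.source)
    (hX : MDifferentiableAt (𝓡 m) (𝓡 m).tangent
      (fun p => (⟨p, X p⟩ : TangentBundle (𝓡 m) M)) p) :
    DifferentiableAt ℝ (push e X) (e p) := by
  have hx := e.map_source hp
  have h : MDifferentiableAt (𝓡 m) (𝓡 m).tangent
      (fun x => (⟨x, VectorField.mpullback (𝓡 m) (𝓡 m) e.symm X x⟩ : TangentBundle (𝓡 m) (Model m)))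
      (e p) := by
    refine MDifferentiableAt.mpullback_vectorField (n := ∞) ?_ (he.contMDiffAt_symm hx)
      (he.isInvertible_mfderiv_symm hx) ENat.LEInfty.out
    rwa [e.left_inv hp]
  have h' : DifferentiableAt ℝ (VectorField.mpullback (𝓡 m) (𝓡 m) e.symm X) (e p) := by
    have h2 : MDifferentiableAt (𝓡 m).tangent 𝓘(ℝ, Model m)
        (fun p : TangentBundle (𝓡 m) (Model m) => p.2)
        ⟨e p, VectorField.mpullback (𝓡 m) (𝓡 m) e.symm X (e p)⟩ :=
      (contMDiff_snd_tangentBundle_modelSpace (Model m) (𝓡 m) (n := 1)).mdifferentiableAt (by simp)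
    exact (MDifferentiableAt.comp (I' := (𝓡 m).tangent) (e p) h2 h).differentiableAt
  exact h'.congr_of_eventuallyEq (he.push_eventuallyEq X hx)

omit he in
lemma isManifold_two : IsManifold (𝓡 m) (minSmoothness ℝ 2) M := by
  rw [minSmoothness_of_isRCLikeNormedField]
  exact IsManifold.of_le (n := ∞) ENat.LEInfty.out

/-- The bracket commutes with pullback along `e.symm`, and on the model space it is the difference
of directional derivatives. -/
lemma mlieBracket_eq {X Y : ∀ p : M, TangentSpace (𝓡 m) p} {p : M} (hp : p ∈ e.source)
    (hX : MDifferentiableAt (𝓡 m) (𝓡 m).tangent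
      (fun p => (⟨p, X p⟩ : TangentBundle (𝓡 m) M)) p)
    (hY : MDifferentiableAt (𝓡 m) (𝓡 m).tangent
      (fun p => (⟨p, Y p⟩ : TangentBundle (𝓡 m) M)) p) :
    chartD e p (VectorField.mlieBracket (𝓡 m) X Y p) =
      fderiv ℝ (push e Y) (e p) (chartD e p (X p)) -
        fderiv ℝ (push e X) (e p) (chartD e p (Y p)) := by
  have hx := e.map_source hp
  have := isManifold_two (m := m) (M := M)
  have h := VectorField.mpullback_mlieBracket (I := 𝓡 m) (I' := 𝓡 m) (f := e.symm) (V := X)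
    (W := Y) (x₀ := e p) (n := ∞) (by rwa [e.left_inv hp]) (by rwa [e.left_inv hp])
    (he.contMDiffAt_symm hx) (by simp only [minSmoothness_of_isRCLikeNormedField]; exact ENat.LEInfty.out)
  rw [← he.push_eq_mpullback _ hx, push_apply hp] at h
  have h1 : VectorField.mlieBracket (𝓡 m) (VectorField.mpullback (𝓡 m) (𝓡 m) e.symm X)
      (VectorField.mpullback (𝓡 m) (𝓡 m) e.symm Y) (e p) =
      VectorField.lieBracket ℝ (E := Model m) (VectorField.mpullback (𝓡 m) (𝓡 m) e.symm X)
      (VectorField.mpullback (𝓡 m) (𝓡 m) e.symm Y) (e p) := by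
    rw [← VectorField.mlieBracketWithin_univ, VectorField.mlieBracketWithin_eq_lieBracketWithin]
    exact congrFun (VectorField.lieBracketWithin_univ (𝕜 := ℝ) (E := Model m)) (e p)
  have h2 := Filter.EventuallyEq.lieBracket_vectorField_eq (𝕜 := ℝ)
    (he.push_eventuallyEq X hx) (he.push_eventuallyEq Y hx)
  rw [h, h1, ← push_apply hp, ← push_apply hp]
  exact h2.symm

end IsSmoothChart

end ChartCalculus

end WebGeometry

end

noncomputable section

namespace WebGeometry

/-! ### Determinants, their derivatives, and alternating maps. -/

section LinearAlgebra

open Matrix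

/-- By Cramer's rule the k-th summand is the (k, k) entry of adj(M) A M, and the trace is cyclic; M
need not be invertible. This is how an endomorphism acts on a top exterior power by its trace. -/
lemma sum_det_updateCol {ι R : Type*} [Fintype ι] [DecidableEq ι] [CommRing R]
    (M A : Matrix ι ι R) :
    ∑ k, (M.updateCol k (A *ᵥ fun j => M j k)).det = A.trace * M.det := by
  have h : ∀ k, (M.updateCol k (A *ᵥ fun j => M j k)).det = (M.adjugate * (A * M)) k k := by
    intro k
    rw [← cramer_apply, cramer_eq_adjugate_mulVec]
    rfl
  simp_rw [h]
  change (M.adjugate * (A * M)).trace = _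
  rw [trace_mul_comm, Matrix.mul_assoc, mul_adjugate, Matrix.mul_smul, Matrix.mul_one, trace_smul,
    smul_eq_mul, mul_comm]

lemma det_one_updateCol {ι R : Type*} [Fintype ι] [DecidableEq ι] [CommRing R] (k : ι)
    (w : ι → R) : ((1 : Matrix ι ι R).updateCol k w).det = w k := by
  rw [← cramer_apply, cramer_one]
  rfl

/-- Jacobi's formula in column form, obtained from the Leibniz expansion: one column is
differentiated at a time. -/
lemma hasFDerivAt_det {ι E : Type*} [Fintype ι] [DecidableEq ι] [NormedAddCommGroup E]
    [NormedSpace ℝ E] {u : E → Matrix ι ι ℝ} {u' : ι → ι → E →L[ℝ] ℝ} {x : E}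
    (hu : ∀ j k, HasFDerivAt (fun y => u y j k) (u' j k) x) :
    ∃ L : E →L[ℝ] ℝ, HasFDerivAt (fun y => (u y).det) L x ∧
      ∀ v, L v = ∑ k, ((u x).updateCol k fun j => u' j k v).det := by
  have h1 : HasFDerivAt (fun y => (u y).det)
      (∑ σ : Equiv.Perm ι, ((Equiv.Perm.sign σ : ℤ) : ℝ) •
        ∑ k, (∏ j ∈ Finset.univ.erase k, u x (σ j) j) • u' (σ k) k) x := by
    simp_rw [det_apply']
    refine HasFDerivAt.fun_sum fun σ _ => ?_
    exact (HasFDerivAt.finsetProd fun i _ => hu (σ i) i).const_mul _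
  refine ⟨_, h1, fun v => ?_⟩
  simp_rw [det_apply']
  rw [Finset.sum_comm]
  simp only [_root_.sum_apply, _root_.smul_apply, smul_eq_mul]
  refine Finset.sum_congr rfl fun σ _ => ?_
  rw [← Finset.mul_sum]
  congr 1
  refine Finset.sum_congr rfl fun k _ => ?_
  rw [← Finset.prod_erase_mul _ _ (Finset.mem_univ k)]
  congr 1
  · refine Finset.prod_congr rfl fun j hj => ?_
    rw [updateCol_ne (Finset.ne_of_mem_erase hj)]
  · rw [updateCol_self]

/-- Both sides are alternating in the columns of A, so they agree once they agree on permutations of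
the standard basis of ℝ^r. The family b is arbitrary and the target is a module, so the formula
serves for the volume form and for wedge products alike. -/
lemma alternatingMap_sum_smul {r : ℕ} {V N : Type*} [AddCommGroup V] [Module ℝ V] [AddCommGroup N]
    [Module ℝ N] (f : V [⋀^Fin r]→ₗ[ℝ] N) (b : Fin r → V) (A : Matrix (Fin r) (Fin r) ℝ) :
    f (fun k => ∑ a, A a k • b a) = A.det • f b := by
  let g : (Fin r → ℝ) [⋀^Fin r]→ₗ[ℝ] N := f.compLinearMap (Fintype.linearCombination ℝ b)
  let g' : (Fin r → ℝ) [⋀^Fin r]→ₗ[ℝ] N :=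
    (LinearMap.toSpanSingleton ℝ N (f b)).compAlternatingMap (Pi.basisFun ℝ (Fin r)).det
  have h : g = g' := by
    refine Module.Basis.ext_alternating (Pi.basisFun ℝ (Fin r)) fun v hv => ?_
    let σ : Equiv.Perm (Fin r) := Equiv.ofBijective v (Finite.injective_iff_bijective.1 hv)
    have h1 : g (fun i => Pi.basisFun ℝ (Fin r) (σ i)) = Equiv.Perm.sign σ • f b := by
      rw [← AlternatingMap.map_perm]
      change f _ = f _
      congr 1
      funext i
      simp [Fintype.linearCombination_apply, Pi.single_apply]
    have h2 : (Pi.basisFun ℝ (Fin r)).det (fun i => Pi.basisFun ℝ (Fin r) (σ i)) =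
        Equiv.Perm.sign σ • (1 : ℝ) := by
      rw [← (Pi.basisFun ℝ (Fin r)).det_self, ← AlternatingMap.map_perm]
      rfl
    change g (fun i => Pi.basisFun ℝ (Fin r) (σ i)) =
      (Pi.basisFun ℝ (Fin r)).det (fun i => Pi.basisFun ℝ (Fin r) (σ i)) • f b
    rw [h1, h2]
    rw [Units.smul_def, Units.smul_def, smul_assoc, one_smul]
  have h3 := congrArg (fun F : (Fin r → ℝ) [⋀^Fin r]→ₗ[ℝ] N => F (fun k a => A a k)) h
  have h4 : (Pi.basisFun ℝ (Fin r)).det (fun k a => A a k) = A.det := by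
    rw [Module.Basis.det_apply]
    rfl
  change f (fun k => Fintype.linearCombination ℝ b (fun a => A a k)) =
    (Pi.basisFun ℝ (Fin r)).det (fun k a => A a k) • f b at h3
  rw [h4] at h3
  simpa only [Fintype.linearCombination_apply] using h3

end LinearAlgebra

/-! ### Blocks of coordinates and the projections onto them. -/

section Blocks

variable {m n : ℕ} (c : Fin n → ℕ) (hc : ∑ i, c i = m)

/-- The index of the block containing a given coordinate index. -/
def blockIndex (k : Fin m) : Fin n := (exists_mem_block c hc k).choose

lemma mem_block_blockIndex (k : Fin m) : k ∈ block c (blockIndex c hc k) :=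
  (exists_mem_block c hc k).choose_spec

omit hc in
lemma block_le {i i' : Fin n} (h : i < i') :
    ∑ j ∈ Finset.univ.filter (· < i), c j + c i ≤ ∑ j ∈ Finset.univ.filter (· < i'), c j := by
  rw [add_comm, ← Finset.sum_insert (s := Finset.univ.filter (· < i)) (by simp)]
  refine Finset.sum_le_sum_of_subset fun j hj => ?_
  simp only [Finset.mem_insert, Finset.mem_filter, Finset.mem_univ, true_and] at hj ⊢
  rcases hj with rfl | hj
  · exact h
  · exact hj.trans h

omit hc in
lemma block_unique {i i' : Fin n} {k : Fin m} (h : k ∈ block c i) (h' : k ∈ block c i') :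
    i = i' := by
  simp only [block, Finset.mem_filter, Finset.mem_univ, true_and] at h h'
  rcases lt_trichotomy i i' with hlt | heq | hlt
  · have := block_le c hlt
    omega
  · exact heq
  · have := block_le c hlt
    omega

lemma mem_block_iff {k : Fin m} {i : Fin n} : k ∈ block c i ↔ blockIndex c hc k = i := by
  constructor
  · exact fun h => block_unique c (mem_block_blockIndex c hc k) h
  · rintro rfl
    exact mem_block_blockIndex c hc k

/-- The increasing enumeration of the `i`-th block. -/
def blockEmb (i : Fin n) : Fin (c i) ↪o Fin m :=
  (block (m := m) c i).orderEmbOfFin (card_block c hc i)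

lemma blockEmb_mem (i : Fin n) (a : Fin (c i)) : blockEmb c hc i a ∈ block c i :=
  Finset.orderEmbOfFin_mem _ _ a

@[simp]
lemma blockIndex_blockEmb (i : Fin n) (a : Fin (c i)) : blockIndex c hc (blockEmb c hc i a) = i :=
  (mem_block_iff c hc).1 (blockEmb_mem c hc i a)

lemma exists_blockEmb {i : Fin n} {k : Fin m} (hk : blockIndex c hc k = i) :
    ∃ a, blockEmb c hc i a = k := by
  have : k ∈ Set.range (blockEmb c hc i) := by
    rw [blockEmb, Finset.range_orderEmbOfFin]
    exact (mem_block_iff c hc).2 hk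
  exact this

lemma sum_blockEmb {N : Type*} [AddCommMonoid N] (i : Fin n) (f : Fin m → N) :
    ∑ a, f (blockEmb c hc i a) = ∑ k, if blockIndex c hc k = i then f k else 0 := by
  rw [← Finset.sum_filter]
  refine Finset.sum_bij (fun a _ => blockEmb c hc i a) (fun a _ => by simp)
    (fun a _ b _ h => (blockEmb c hc i).injective h) (fun k hk => ?_) (fun _ _ => rfl)
  obtain ⟨a, ha⟩ := exists_blockEmb c hc (Finset.mem_filter.1 hk).2
  exact ⟨a, Finset.mem_univ _, ha⟩

/-- The projection of `ℝ^m` onto the coordinates of the `i`-th block. -/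
def blockProj (i : Fin n) : Model m →L[ℝ] Model m :=
  LinearMap.toContinuousLinearMap
    { toFun := fun x => WithLp.toLp 2 fun k => if blockIndex c hc k = i then x k else 0
      map_add' := by
        intro x y
        ext k
        by_cases h : blockIndex c hc k = i <;> simp [h]
      map_smul' := by
        intro a x
        ext k
        by_cases h : blockIndex c hc k = i <;> simp [h] }

@[simp]
lemma blockProj_apply (i : Fin n) (x : Model m) (k : Fin m) :
    blockProj c hc i x k = if blockIndex c hc k = i then x k else 0 :=
  rfl

lemma sum_blockProj (x : Model m) : ∑ i, blockProj c hc i x = x := by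
  ext k
  simp

lemma blockProj_blockProj (i j : Fin n) (x : Model m) :
    blockProj c hc i (blockProj c hc j x) = if i = j then blockProj c hc i x else 0 := by
  ext k
  by_cases h : i = j
  · subst h
    simp only [blockProj_apply, if_true]
    split_ifs <;> rfl
  · rw [if_neg h]
    simp only [blockProj_apply]
    split_ifs with h1 h2
    · exact absurd (h1.symm.trans h2) h
    · rfl
    · rfl

lemma blockProj_single (i : Fin n) (k : Fin m) (a : ℝ) :
    blockProj c hc i (EuclideanSpace.single k a) =
      if blockIndex c hc k = i then EuclideanSpace.single k a else 0 := by
  ext j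
  rw [blockProj_apply]
  by_cases hj : j = k
  · subst hj
    split_ifs <;> rfl
  · split_ifs <;> simp [hj]

end Blocks

end WebGeometry

end

noncomputable section

namespace WebGeometry

/-! ### The inverse function theorem on the manifold. -/

section InverseFunction

variable {m : ℕ} {M : Type*} [TopologicalSpace M] [ChartedSpace (Model m) M]
  [IsManifold (𝓡 m) ∞ M]

omit [IsManifold (𝓡 m) ∞ M] in
lemma isSmoothChart_of_mem_maximalAtlas {e : OpenPartialHomeomorph M (Model m)}
    (he : e ∈ IsManifold.maximalAtlas (𝓡 m) ∞ M) : IsSmoothChart e :=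
  ⟨contMDiffOn_of_mem_maximalAtlas he, contMDiffOn_symm_of_mem_maximalAtlas he⟩

/-- The inverse function theorem on manifolds. -/
theorem exists_smoothChart {F : M → Model m} {U : Set M} (hU : IsOpen U) {p : M} (hp : p ∈ U)
    (hF : ContMDiffOn (𝓡 m) (𝓡 m) ∞ F U)
    (hinj : ∀ v : TangentSpace (𝓡 m) p, mvfderiv (𝓡 m) F p v = 0 → v = 0) :
    ∃ e : OpenPartialHomeomorph M (Model m), IsSmoothChart e ∧ p ∈ e.source ∧ e.source ⊆ U ∧
      Set.EqOn e F e.source := by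
  let c := chartAt (Model m) p
  have hc : IsSmoothChart c :=
    isSmoothChart_of_mem_maximalAtlas (IsManifold.chart_mem_maximalAtlas p)
  have hpc : p ∈ c.source := mem_chart_source _ p
  let G : Model m → Model m := F ∘ c.symm
  let V : Set (Model m) := c.target ∩ c.symm ⁻¹' U
  have hV : IsOpen V := c.isOpen_inter_preimage_symm hU
  have hFat : ∀ q ∈ U, ContMDiffAt (𝓡 m) (𝓡 m) ∞ F q := fun q hq =>
    hF.contMDiffAt (hU.mem_nhds hq)
  have hG : ∀ y ∈ V, ContDiffAt ℝ ∞ G y := by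
    intro y hy
    have h := hc.contDiffAt_comp_symm (c.map_target hy.1) (hFat _ hy.2)
    rwa [c.right_inv hy.1] at h
  have hpV : c p ∈ V := ⟨c.map_source hpc, by simpa [c.left_inv hpc] using hp⟩
  have hGc : ContinuousOn (fderiv ℝ G) V := fun y hy =>
    (((hG y hy).fderiv_right (m := 0) (by simp)).continuousAt).continuousWithinAt
  let R : Set (Model m →L[ℝ] Model m) :=
    Set.range ((↑) : (Model m ≃L[ℝ] Model m) → Model m →L[ℝ] Model m)
  -- Restricting to the open set where the derivative is invertible makes the inverse smooth on the
  -- whole target, not only at the image of p.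
  let V' : Set (Model m) := V ∩ fderiv ℝ G ⁻¹' R
  have hV' : IsOpen V' := hGc.isOpen_inter_preimage hV ContinuousLinearEquiv.isOpen
  have hker : LinearMap.ker (fderiv ℝ G (c p)).toLinearMap = ⊥ := by
    rw [LinearMap.ker_eq_bot']
    intro w hw
    have h1 := hc.mvfderiv_eq hpc ((hFat p hp).mdifferentiableAt (by simp)) (chartDInv c p w)
    rw [hc.chartD_chartDInv hpc] at h1
    have h2 := hinj _ (h1.trans hw)
    rw [← hc.chartD_chartDInv hpc w, h2, map_zero]
  let f' : Model m ≃L[ℝ] Model m :=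
    (LinearEquiv.ofInjectiveEndo _ (LinearMap.ker_eq_bot.1 hker)).toContinuousLinearEquiv
  have hf' : (f' : Model m →L[ℝ] Model m) = fderiv ℝ G (c p) := by
    ext1 w
    rfl
  have hpV' : c p ∈ V' := ⟨hpV, f', hf'⟩
  have hder : HasFDerivAt G (f' : Model m →L[ℝ] Model m) (c p) := by
    rw [hf']
    exact ((hG _ hpV).differentiableAt (by simp)).hasFDerivAt
  let e0 := (hG _ hpV).toOpenPartialHomeomorph G hder (by simp)
  have he0 : ∀ y, e0 y = G y := fun _ => rfl
  let e1 := e0.restrOpen V' hV'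
  have he1s : e1.source = e0.source ∩ V' := e0.restrOpen_source V' hV'
  have he1 : IsSmoothChart e1 := by
    constructor
    · intro y hy
      rw [he1s] at hy
      exact (hG y hy.2.1).contMDiffAt.contMDiffWithinAt
    · intro y hy
      have hy' := e1.map_target hy
      rw [he1s] at hy'
      obtain ⟨f'', hf''⟩ := hy'.2.2
      refine ContMDiffAt.contMDiffWithinAt (ContDiffAt.contMDiffAt ?_)
      refine e1.contDiffAt_symm hy (f₀' := f'') ?_ (hG _ hy'.2.1)
      rw [hf'']
      exact ((hG _ hy'.2.1).differentiableAt (by simp)).hasFDerivAt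
  have hs : (c.trans e1).source = c.source ∩ c ⁻¹' e1.source := c.trans_source e1
  have hsU : (c.trans e1).source ⊆ U := by
    intro q hq
    rw [hs, he1s] at hq
    have := hq.2.2.1.2
    rwa [Set.mem_preimage, c.left_inv hq.1] at this
  have heq : Set.EqOn (c.trans e1) F (c.trans e1).source := by
    intro q hq
    rw [hs] at hq
    change F (c.symm (c q)) = F q
    rw [c.left_inv hq.1]
  refine ⟨c.trans e1, ⟨(hF.mono hsU).congr heq, ?_⟩, ?_, hsU, heq⟩
  · rw [c.trans_target, c.coe_trans_symm]
    exact hc.contMDiffOn_symm.comp (he1.contMDiffOn_symm.mono Set.inter_subset_left)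
      (fun y hy => hy.2)
  · rw [hs, he1s]
    exact ⟨hpc, (hG _ hpV).mem_toOpenPartialHomeomorph_source hder (by simp), hpV'⟩

end InverseFunction

/-! ### Bump functions and extension of local objects. -/

section Bump

variable {m : ℕ} {M : Type*} [TopologicalSpace M] [ChartedSpace (Model m) M]
  [IsManifold (𝓡 m) ∞ M]

lemma exists_bump [T2Space M] {p : M} {U : Set M} (hU : U ∈ 𝓝 p) :
    ∃ χ : M → ℝ, ContMDiff (𝓡 m) 𝓘(ℝ, ℝ) ∞ χ ∧ (∀ᶠ q in 𝓝 p, χ q = 1) ∧ tsupport χ ⊆ U := by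
  obtain ⟨f, -, hf⟩ := (SmoothBumpFunction.nhds_basis_tsupport (I := 𝓡 m) p).mem_iff.1 hU
  exact ⟨f, f.contMDiff, f.eventuallyEq_one, hf⟩

lemma smoothFieldOn_univ_iff {X : ∀ p : M, TangentSpace (𝓡 m) p} :
    SmoothFieldOn X Set.univ ↔ ∀ p : M, ContMDiffAt (𝓡 m) (𝓡 m).tangent ∞
      (fun p => (⟨p, X p⟩ : TangentBundle (𝓡 m) M)) p := by
  rw [SmoothFieldOn, contMDiffOn_univ]
  rfl

lemma smoothFieldOn_iff {X : ∀ p : M, TangentSpace (𝓡 m) p} {U : Set M} (hU : IsOpen U) :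
    SmoothFieldOn X U ↔ ∀ p ∈ U, ContMDiffAt (𝓡 m) (𝓡 m).tangent ∞
      (fun p => (⟨p, X p⟩ : TangentBundle (𝓡 m) M)) p :=
  ⟨fun h _ hp => h.contMDiffAt (hU.mem_nhds hp), fun h p hp => (h p hp).contMDiffWithinAt⟩

lemma smoothFieldOn_bump_smul {U : Set M} (hU : IsOpen U) {χ : M → ℝ}
    (hχ : ContMDiff (𝓡 m) 𝓘(ℝ, ℝ) ∞ χ) (hs : tsupport χ ⊆ U)
    {X : ∀ p : M, TangentSpace (𝓡 m) p} (hX : SmoothFieldOn X U) :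
    SmoothFieldOn (fun q => χ q • X q) Set.univ := by
  rw [smoothFieldOn_univ_iff]
  intro p
  by_cases hp : p ∈ tsupport χ
  · exact (hχ p).smul_section ((smoothFieldOn_iff hU).1 hX p (hs hp))
  · have h0 : ∀ᶠ q in 𝓝 p, χ q = 0 := notMem_tsupport_iff_eventuallyEq.1 hp
    have hz : ContMDiffAt (𝓡 m) (𝓡 m).tangent ∞
        (fun q => (⟨q, 0⟩ : TangentBundle (𝓡 m) M)) p :=
      (Bundle.contMDiff_zeroSection ℝ (TangentSpace (𝓡 m) : M → Type _)).contMDiffAt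
    refine hz.congr_of_eventuallyEq ?_
    filter_upwards [h0] with q hq
    rw [hq, zero_smul]

omit [IsManifold (𝓡 m) ∞ M] in
lemma contMDiff_bump_mul {U : Set M} {χ : M → ℝ}
    (hχ : ContMDiff (𝓡 m) 𝓘(ℝ, ℝ) ∞ χ) (hs : tsupport χ ⊆ U)
    {f : M → ℝ} (hf : ∀ q ∈ U, ContMDiffAt (𝓡 m) 𝓘(ℝ, ℝ) ∞ f q) :
    ContMDiff (𝓡 m) 𝓘(ℝ, ℝ) ∞ (fun q => χ q * f q) := by
  intro p
  by_cases hp : p ∈ tsupport χ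
  · exact (hχ p).mul (hf p (hs hp))
  · have h0 : ∀ᶠ q in 𝓝 p, χ q = 0 := notMem_tsupport_iff_eventuallyEq.1 hp
    refine (contMDiffAt_const (c := (0 : ℝ))).congr_of_eventuallyEq ?_
    filter_upwards [h0] with q hq
    rw [hq, zero_mul]

lemma smoothFieldOn_pull {e : OpenPartialHomeomorph M (Model m)} (he : IsSmoothChart e)
    {V : Model m → Model m} (hV : ∀ x ∈ e.target, ContDiffAt ℝ ∞ V x) :
    SmoothFieldOn (pull e V) e.source :=
  (smoothFieldOn_iff e.open_source).2 fun _ hp => he.contMDiffAt_pull hp (hV _ (e.map_source hp))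

end Bump

/-! ### Charts adapted to all foliations at once. -/

section WebCharts

variable {m n : ℕ} {c : Fin n → ℕ} {M : Type*} [TopologicalSpace M] [ChartedSpace (Model m) M]

lemma Foliation.finrank_quotient_tangent [IsManifold (𝓡 m) ∞ M] {r : ℕ} (F : Foliation m M r)
    (p : M) : Module.finrank ℝ (TangentSpace (𝓡 m) p ⧸ F.tangent p) = r := by
  obtain ⟨e, he, hp, S, hS, h⟩ := F.exists_flat_chart p
  have he' := isSmoothChart_of_mem_maximalAtlas he
  let L : TangentSpace (𝓡 m) p ≃ₗ[ℝ] Model m := (he'.derivEquiv hp).toLinearEquiv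
  have hmap : (F.tangent p).map (L : TangentSpace (𝓡 m) p →ₗ[ℝ] Model m) = coordSubspace S := by
    rw [Submodule.map_equiv_eq_comap_symm]
    ext w
    rw [Submodule.mem_comap, mem_coordSubspace]
    refine (h p hp _).trans (forall₂_congr fun k _ => ?_)
    have : chartD e p (L.symm w) = w := L.apply_symm_apply w
    exact Eq.congr_left (congrArg (fun x : Model m => x k) this)
  have := (Submodule.Quotient.equiv (F.tangent p) (coordSubspace S) L hmap).finrank_eq
  rw [this, finrank_quotient_coordSubspace, hS]

namespace DivFreeWeb

variable [IsManifold (𝓡 m) ∞ M] (W : DivFreeWeb m M c)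

/-- General position makes the codimension of the intersection equal to the sum of the c_i, which is
m. -/
lemma iInf_tangent_eq_bot (p : M) : ⨅ i, (W.fol i).tangent p = ⊥ := by
  have h := W.general_position p
  simp only [Foliation.finrank_quotient_tangent, W.sum_codim] at h
  have h3 : Module.finrank ℝ (TangentSpace (𝓡 m) p) = m :=
    finrank_euclideanSpace_fin (𝕜 := ℝ)
  have : FiniteDimensional ℝ (TangentSpace (𝓡 m) p) :=
    inferInstanceAs (FiniteDimensional ℝ (Model m))
  have h2 := (⨅ i, (W.fol i).tangent p).finrank_quotient_add_finrank
  rw [h, h3] at h2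
  exact Submodule.finrank_eq_zero.1 (by omega)

/-- A smooth chart in which the `i`-th foliation of the web consists of the level sets of the
`i`-th block of coordinates. -/
structure IsWebChart (e : OpenPartialHomeomorph M (Model m)) : Prop extends IsSmoothChart e where
  mem_tangent_iff : ∀ q ∈ e.source, ∀ (i : Fin n) (v : TangentSpace (𝓡 m) q),
    v ∈ (W.fol i).tangent q ↔ ∀ k ∈ block c i, chartD e q v k = 0

/-- The block index of a coordinate. -/
abbrev idx (k : Fin m) : Fin n := blockIndex c W.sum_codim k

lemma mem_block {k : Fin m} {i : Fin n} : k ∈ block c i ↔ W.idx k = i :=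
  mem_block_iff c W.sum_codim

/-- The projection onto a block of coordinates. -/
abbrev proj (i : Fin n) : Model m →L[ℝ] Model m := blockProj c W.sum_codim i

/-- The enumeration of a block of coordinates. -/
abbrev emb (i : Fin n) : Fin (c i) ↪o Fin m := blockEmb c W.sum_codim i

/-- The chosen components are collected into one map; a vector killed by its differential at p is
tangent to every foliation, hence zero, and the inverse function theorem applies. The map τ says
which component of `F i` plays the role of each coordinate. It is used both to combine the flat
charts of the foliations and to undo the permutation in a local equivalence. -/
theorem exists_webChart_of_functions {U : Set M} (hU : IsOpen U) {p : M} (hp : p ∈ U)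
    (F : Fin n → M → Model m) (hF : ∀ i, ContMDiffOn (𝓡 m) (𝓡 m) ∞ (F i) U) (τ : Fin m → Fin m)
    (h : ∀ q ∈ U, ∀ i, ∀ v : TangentSpace (𝓡 m) q,
      v ∈ (W.fol i).tangent q ↔ ∀ k ∈ block c i, mvfderiv (𝓡 m) (F i) q v (τ k) = 0) :
    ∃ e : OpenPartialHomeomorph M (Model m), W.IsWebChart e ∧ p ∈ e.source ∧ e.source ⊆ U ∧
      e p = 0 ∧ ∀ q ∈ e.source, ∀ (v : TangentSpace (𝓡 m) q) (k : Fin m),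
        chartD e q v k = mvfderiv (𝓡 m) (F (W.idx k)) q v (τ k) := by
  let G : M → Model m := fun q =>
    WithLp.toLp 2 fun k => F (W.idx k) q (τ k) - F (W.idx k) p (τ k)
  have hFc : ∀ i k, ContMDiffOn (𝓡 m) 𝓘(ℝ, ℝ) ∞ (fun q => F i q k) U := fun i k =>
    (EuclideanSpace.proj (𝕜 := ℝ) k : Model m →L[ℝ] ℝ).contMDiff.comp_contMDiffOn (hF i)
  have hG : ContMDiffOn (𝓡 m) (𝓡 m) ∞ G U := by
    have h1 : ContMDiffOn (𝓡 m) 𝓘(ℝ, Fin m → ℝ) ∞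
        (fun q => fun k => F (W.idx k) q (τ k) - F (W.idx k) p (τ k)) U :=
      contMDiffOn_pi_space.2 fun k => (hFc _ _).sub contMDiffOn_const
    exact (EuclideanSpace.equiv (Fin m) ℝ).symm.contDiff.contMDiff.comp_contMDiffOn h1
  have hder : ∀ q ∈ U, ∀ (v : TangentSpace (𝓡 m) q) (k : Fin m),
      mvfderiv (𝓡 m) G q v k = mvfderiv (𝓡 m) (F (W.idx k)) q v (τ k) := by
    intro q hq v k
    have hGd : MDifferentiableAt (𝓡 m) 𝓘(ℝ, Model m) G q :=
      (hG.contMDiffAt (hU.mem_nhds hq)).mdifferentiableAt (by simp)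
    have hFd : MDifferentiableAt (𝓡 m) 𝓘(ℝ, Model m) (F (W.idx k)) q :=
      ((hF _).contMDiffAt (hU.mem_nhds hq)).mdifferentiableAt (by simp)
    have h1 := mvfderiv_comp_apply (I := 𝓡 m) (I' := 𝓘(ℝ, Model m)) q
      (g := EuclideanSpace.proj (𝕜 := ℝ) k) (f := G)
      ((EuclideanSpace.proj (𝕜 := ℝ) k : Model m →L[ℝ] ℝ).differentiableAt.mdifferentiableAt)
      hGd v
    have h2 := mvfderiv_comp_apply (I := 𝓡 m) (I' := 𝓘(ℝ, Model m)) q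
      (g := EuclideanSpace.proj (𝕜 := ℝ) (τ k)) (f := F (W.idx k))
      ((EuclideanSpace.proj (𝕜 := ℝ) (τ k) : Model m →L[ℝ] ℝ).differentiableAt.mdifferentiableAt)
      hFd v
    have h3 : (EuclideanSpace.proj (𝕜 := ℝ) k : Model m →L[ℝ] ℝ) ∘ G =
        (fun q => ((EuclideanSpace.proj (𝕜 := ℝ) (τ k) : Model m →L[ℝ] ℝ) ∘ F (W.idx k)) q) -
          (fun _ => F (W.idx k) p (τ k)) := by
      funext q
      rfl
    have h4 : ∀ (x : Model m) (j : Fin m) (w : Model m),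
        mvfderiv 𝓘(ℝ, Model m) (EuclideanSpace.proj (𝕜 := ℝ) j : Model m →L[ℝ] ℝ) x w = w j := by
      intro x j w
      change mfderiv 𝓘(ℝ, Model m) 𝓘(ℝ, ℝ) (EuclideanSpace.proj (𝕜 := ℝ) j : Model m →L[ℝ] ℝ) x w = _
      rw [mfderiv_eq_fderiv, ContinuousLinearMap.fderiv]
      rfl
    rw [h3, mvfderiv_sub (((EuclideanSpace.proj (𝕜 := ℝ) (τ k) :
      Model m →L[ℝ] ℝ).differentiableAt).comp_mdifferentiableAt hFd) mdifferentiableAt_const,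
      mvfderiv_const, sub_zero] at h1
    exact ((h4 _ _ _).symm.trans h1.symm).trans (h2.trans (h4 _ _ _))
  obtain ⟨e, he, hpe, heU, heq⟩ := exists_smoothChart hU hp hG (fun v hv => by
    have : v ∈ ⨅ i, (W.fol i).tangent p := by
      rw [Submodule.mem_iInf]
      intro i
      rw [h p hp]
      intro k hk
      rw [W.mem_block] at hk
      have := hder p hp v k
      rw [hk] at this
      rw [← this, hv]
      rfl
    rw [W.iInf_tangent_eq_bot] at this
    exact (Submodule.mem_bot ℝ).1 this)
  have hD : ∀ q ∈ e.source, ∀ (v : TangentSpace (𝓡 m) q) (k : Fin m),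
      chartD e q v k = mvfderiv (𝓡 m) (F (W.idx k)) q v (τ k) := by
    intro q hq v k
    rw [← hder q (heU hq) v k]
    have h1 : e =ᶠ[𝓝 q] G := by
      filter_upwards [e.open_source.mem_nhds hq] with y hy using heq hy
    have h2 : mfderiv (𝓡 m) (𝓡 m) e q v = mfderiv (𝓡 m) (𝓡 m) G q v := by
      rw [h1.mfderiv_eq]
      rfl
    exact congrArg (fun x : Model m => x k) h2
  refine ⟨e, ⟨he, fun q hq i v => ?_⟩, hpe, heU, ?_, hD⟩
  · rw [h q (heU hq)]
    refine forall₂_congr fun k hk => ?_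
    rw [hD q hq]
    rw [W.mem_block] at hk
    rw [hk]
  · rw [heq hpe]
    ext k
    exact sub_self _

theorem exists_webChart (p : M) : ∃ e : OpenPartialHomeomorph M (Model m),
    W.IsWebChart e ∧ p ∈ e.source ∧ e p = 0 := by
  choose e he hpe S hS h using fun i => (W.fol i).exists_flat_chart p
  -- The coordinates defining the i-th foliation in its own flat chart are relabelled by the i-th
  -- block.
  let E : ∀ i, {x // x ∈ block (m := m) c i} ≃ {x // x ∈ S i} := fun i =>
    Finset.equivOfCardEq ((card_block c W.sum_codim i).trans (hS i).symm)
  let τ : Fin m → Fin m := fun k => E (W.idx k) ⟨k, mem_block_blockIndex c W.sum_codim k⟩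
  have hτ : ∀ i k (hk : k ∈ block c i), τ k = E i ⟨k, hk⟩ := by
    intro i k hk
    have := W.mem_block.1 hk
    subst this
    rfl
  have hsm := fun i => isSmoothChart_of_mem_maximalAtlas (he i)
  obtain ⟨e', he', hp', -, h0, -⟩ := W.exists_webChart_of_functions
    (U := ⋂ i, (e i).source) (isOpen_iInter_of_finite fun i => (e i).open_source)
    (Set.mem_iInter.2 hpe) (fun i => e i)
    (fun i => (hsm i).contMDiffOn.mono (Set.iInter_subset _ i)) τ (fun q hq i v => by
      rw [h i q (Set.mem_iInter.1 hq i)]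
      constructor
      · intro hv k hk
        rw [hτ i k hk]
        exact hv _ (E i ⟨k, hk⟩).2
      · intro hv s hs
        have := hv ((E i).symm ⟨s, hs⟩) ((E i).symm ⟨s, hs⟩).2
        rw [hτ i _ ((E i).symm ⟨s, hs⟩).2] at this
        simp only [Subtype.coe_eta, Equiv.apply_symm_apply] at this
        exact this)
  exact ⟨e', he', hp', h0⟩

end DivFreeWeb

end WebCharts

end WebGeometry

end

noncomputable section

namespace WebGeometry

/-! ### The density of the volume form and the divergence of adapted frames. -/

section Density

variable {m n : ℕ} {c : Fin n → ℕ} {M : Type*} [TopologicalSpace M] [ChartedSpace (Model m) M]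
  [IsManifold (𝓡 m) ∞ M]

lemma sum_smul_single {m : ℕ} (w : Model m) : ∑ j, w j • EuclideanSpace.single j (1 : ℝ) = w := by
  ext k
  simp [Pi.single_apply]

namespace DivFreeWeb

variable (W : DivFreeWeb m M c)

/-- The coefficient of the volume form of the web in a chart. -/
def density (e : OpenPartialHomeomorph M (Model m)) (x : Model m) : ℝ :=
  W.vol (e.symm x) fun k => chartDInv e (e.symm x) (EuclideanSpace.single k 1)

/-- The logarithm of the absolute value of the coefficient of the volume form. -/
def logDensity (e : OpenPartialHomeomorph M (Model m)) (x : Model m) : ℝ :=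
  Real.log (W.density e x)

variable {e : OpenPartialHomeomorph M (Model m)}

lemma vol_eq (he : IsSmoothChart e) {q : M} (hq : q ∈ e.source)
    (v : Fin m → TangentSpace (𝓡 m) q) :
    W.vol q v = W.density e (e q) * (Matrix.of fun j k => chartD e q (v k) j).det := by
  have h1 : v = fun k => ∑ j, chartD e q (v k) j • chartDInv e q (EuclideanSpace.single j 1) := by
    funext k
    apply he.chartD_injective hq
    simp only [map_sum, map_smul, he.chartD_chartDInv hq]
    exact (sum_smul_single _).symm
  have h2 := alternatingMap_sum_smul (W.vol q)
    (fun j => chartDInv e q (EuclideanSpace.single j 1))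
    (Matrix.of fun j k => chartD e q (v k) j)
  rw [density, e.left_inv hq, mul_comm, ← smul_eq_mul, ← h2]
  exact congrArg (W.vol q) h1

lemma density_ne_zero (he : IsSmoothChart e) {x : Model m} (hx : x ∈ e.target) :
    W.density e x ≠ 0 := by
  intro h
  apply W.vol_ne_zero (e.symm x)
  ext v
  rw [W.vol_eq he (e.map_target hx), e.right_inv hx, h, zero_mul]
  rfl

variable [T2Space M]

/-- Smoothness of the volume form is tested on globally smooth fields only, so the coordinate fields
are cut off by a bump function equal to 1 near the point. -/
lemma contDiffAt_density (he : IsSmoothChart e) {x : Model m} (hx : x ∈ e.target) :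
    ContDiffAt ℝ ∞ (W.density e) x := by
  have hp := e.map_target hx
  obtain ⟨χ, hχ, h1, hs⟩ := exists_bump (m := m) (e.open_source.mem_nhds hp)
  have hX : ∀ k, SmoothFieldOn
      (fun q => χ q • pull e (fun _ => EuclideanSpace.single k (1 : ℝ)) q) Set.univ := fun k =>
    smoothFieldOn_bump_smul e.open_source hχ hs (smoothFieldOn_pull he fun _ _ => contDiffAt_const)
  have h2 := (contMDiffOn_univ.1 (W.vol_smooth _ hX)) (e.symm x)
  have h3 := he.contDiffAt_comp_symm hp h2
  rw [e.right_inv hx] at h3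
  refine h3.congr_of_eventuallyEq ?_
  have h4 := IsSmoothChart.tendsto_symm hp
  rw [e.right_inv hx] at h4
  filter_upwards [h4.eventually h1] with y hy
  simp only [Function.comp_apply, hy, one_smul]
  rw [density]
  rfl

lemma contDiffAt_logDensity (he : IsSmoothChart e) {x : Model m} (hx : x ∈ e.target) :
    ContDiffAt ℝ ∞ (W.logDensity e) x :=
  (W.contDiffAt_density he hx).log (W.density_ne_zero he hx)

/-- The sign of the density plays no role, since `Real.log` is the logarithm of the absolute value.
-/
lemma fderiv_density (he : IsSmoothChart e) {x : Model m} (hx : x ∈ e.target) (v : Model m) :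
    fderiv ℝ (W.density e) x v = W.density e x * fderiv ℝ (W.logDensity e) x v := by
  have h : fderiv ℝ (W.logDensity e) x = (W.density e x)⁻¹ • fderiv ℝ (W.density e) x :=
    fderiv.log ((W.contDiffAt_density he hx).differentiableAt (by simp)) (W.density_ne_zero he hx)
  rw [h, _root_.smul_apply, smul_eq_mul, mul_inv_cancel_left₀ (W.density_ne_zero he hx)]

/-- The divergence of an adapted frame under a connection with given Christoffel symbols. -/
lemma sum_coframe_apply (he : IsSmoothChart e) {U : Set M} (hU : IsOpen U)
    {ξ : Fin m → ∀ p : M, TangentSpace (𝓡 m) p →ₗ[ℝ] ℝ}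
    {f : Fin m → ∀ p : M, TangentSpace (𝓡 m) p} (hf : W.IsAdaptedCoframe U ξ f) {p : M}
    (hpU : p ∈ U) (hp : p ∈ e.source) (A : Model m →L[ℝ] Model m) (v : Model m) :
    ∑ k, ξ k p (chartDInv e p (fderiv ℝ (push e (f k)) (e p) v + A (push e (f k) (e p)))) =
      ∑ k, A (EuclideanSpace.single k 1) k - fderiv ℝ (W.logDensity e) (e p) v := by
  have hx := e.map_source hp
  let N : Model m → Matrix (Fin m) (Fin m) ℝ := fun x => Matrix.of fun j k => push e (f k) x j
  have hdual : ∀ q ∈ U, (Matrix.of fun j k => ξ j q (f k q)) = (1 : Matrix (Fin m) (Fin m) ℝ) := by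
    intro q hq
    ext j k
    rw [Matrix.of_apply, hf.dual q hq, Matrix.one_apply]
  -- The volume form takes the value 1 on an adapted frame. Differentiating this identity relates
  -- the derivatives of the frame to those of the density.
  have hdet : ∀ᶠ y in 𝓝 (e p), W.density e y * (N y).det = 1 := by
    filter_upwards [e.open_target.mem_nhds hx, (IsSmoothChart.tendsto_symm hp).eventually
      (hU.mem_nhds hpU)] with y hy hyU
    have h1 := W.vol_eq he (e.map_target hy) (fun k => f k (e.symm y))
    rw [hf.vol _ hyU, hdual _ hyU, Matrix.det_one, e.right_inv hy] at h1
    exact h1.symm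
  -- Cramer's rule: evaluating ξ^k on a vector amounts to evaluating the volume form on the frame
  -- with its k-th member replaced by that vector.
  have hξ : ∀ (k : Fin m) (w : Model m), ξ k p (chartDInv e p w) =
      W.density e (e p) * ((N (e p)).updateCol k w).det := by
    intro k w
    have h1 := hf.vol p hpU (Function.update (fun k => f k p) k (chartDInv e p w))
    have h2 := W.vol_eq he hp (Function.update (fun k => f k p) k (chartDInv e p w))
    have h3 : (Matrix.of fun j l => ξ j p (Function.update (fun k => f k p) k (chartDInv e p w) l))
        = (1 : Matrix (Fin m) (Fin m) ℝ).updateCol k (fun j => ξ j p (chartDInv e p w)) := by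
      ext j l
      rw [← hdual p hpU]
      by_cases hl : l = k
      · subst hl
        simp
      · simp [hl]
    have h4 : (Matrix.of fun j l => chartD e p
        (Function.update (fun k => f k p) k (chartDInv e p w) l) j) =
        (N (e p)).updateCol k w := by
      ext j l
      by_cases hl : l = k
      · subst hl
        simp [he.chartD_chartDInv hp]
      · simp [hl, N, IsSmoothChart.push_apply hp]
    rw [h3, det_one_updateCol] at h1
    rw [← h1, h2, h4]
  have hd : ∀ k, DifferentiableAt ℝ (push e (f k)) (e p) := fun k =>
    (he.contDiffAt_push hp ((smoothFieldOn_iff hU).1 (hf.smooth k) p hpU)).differentiableAt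
      (by simp)
  obtain ⟨L, hL, hLv⟩ := hasFDerivAt_det (u := N) (x := e p)
    (u' := fun j k => (EuclideanSpace.proj (𝕜 := ℝ) j).comp (fderiv ℝ (push e (f k)) (e p)))
    (fun j k => (EuclideanSpace.proj (𝕜 := ℝ) j).hasFDerivAt.comp (e p) (hd k).hasFDerivAt)
  have hprod := ((W.contDiffAt_density he hx).differentiableAt (by simp)).hasFDerivAt.mul hL
  have hzero : fderiv ℝ (fun y => W.density e y * (N y).det) (e p) = 0 := by
    have : (fun y => W.density e y * (N y).det) =ᶠ[𝓝 (e p)] fun _ => 1 := hdet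
    rw [this.fderiv_eq, fderiv_const_apply]
  have h5 : W.density e (e p) * L v + (N (e p)).det * fderiv ℝ (W.density e) (e p) v = 0 := by
    have := congrArg (fun T : Model m →L[ℝ] ℝ => T v) (hprod.fderiv.symm.trans hzero)
    simpa using this
  have h6 : W.density e (e p) * (N (e p)).det = 1 := hdet.self_of_nhds
  let A' : Matrix (Fin m) (Fin m) ℝ := Matrix.of fun j k => A (EuclideanSpace.single k 1) j
  have hA : ∀ w : Model m, (A w).ofLp = A'.mulVec w.ofLp := by
    intro w
    funext j
    conv_lhs => rw [← sum_smul_single w]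
    simp [A', Matrix.mulVec, dotProduct, mul_comm]
  have h7 := sum_det_updateCol (N (e p)) A'
  simp_rw [hξ, ← Finset.mul_sum]
  have h8 : ∀ k, ((N (e p)).updateCol k
      (fderiv ℝ (push e (f k)) (e p) v + A (push e (f k) (e p))).ofLp).det =
      ((N (e p)).updateCol k fun j => (EuclideanSpace.proj (𝕜 := ℝ) j).comp
        (fderiv ℝ (push e (f k)) (e p)) v).det +
      ((N (e p)).updateCol k (A'.mulVec fun j => N (e p) j k)).det := by
    intro k
    rw [WithLp.ofLp_add, Matrix.det_updateCol_add, hA]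
    rfl
  simp_rw [h8, Finset.sum_add_distrib, ← hLv, h7]
  rw [W.fderiv_density he hx] at h5
  have h9 : A'.trace = ∑ k, A (EuclideanSpace.single k 1) k := rfl
  rw [← h9]
  linear_combination h5 + (A'.trace - fderiv ℝ (W.logDensity e) (e p) v) * h6

/-- The coordinate frame of a web chart, with one vector rescaled by the density, is adapted. -/
lemma isAdaptedCoframe_of_webChart (he : W.IsWebChart e) (k₀ : Fin m) :
    W.IsAdaptedCoframe e.source
      (fun j q => (if j = k₀ then W.density e (e q) else 1) •
        ((EuclideanSpace.proj (𝕜 := ℝ) j).comp (chartD e q)).toLinearMap)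
      (fun k => pull e fun x => (if k = k₀ then (W.density e x)⁻¹ else 1) •
        EuclideanSpace.single k 1) := by
  have he' := he.toIsSmoothChart
  refine ⟨fun k => smoothFieldOn_pull he' fun x hx => ?_, fun p hp j k => ?_, fun p hp i => ?_,
    fun p hp v => ?_⟩
  · have h : ContDiffAt ℝ ∞ (fun x => if k = k₀ then (W.density e x)⁻¹ else 1) x := by
      split_ifs
      · exact (W.contDiffAt_density he' hx).inv (W.density_ne_zero he' hx)
      · exact contDiffAt_const
    exact h.smul contDiffAt_const
  · have hne := W.density_ne_zero he' (e.map_source hp)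
    change (if j = k₀ then W.density e (e p) else 1) • (chartD e p (pull e _ p)) j = _
    rw [pull, he'.chartD_chartDInv hp]
    by_cases hjk : j = k
    · subst hjk
      by_cases hj : j = k₀ <;> simp [hj, hne]
    · split_ifs <;> simp [hjk]
  · ext v
    simp only [Submodule.mem_iInf, he.mem_tangent_iff p hp]
    refine forall₂_congr fun k _ => ?_
    rw [LinearMap.mem_ker]
    have hne : (if k = k₀ then W.density e (e p) else 1) ≠ 0 := by
      split_ifs
      · exact W.density_ne_zero he' (e.map_source hp)
      · exact one_ne_zero
    exact (smul_eq_zero_iff_right hne).symm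
  · rw [W.vol_eq he' hp]
    have h := Matrix.det_mul_column (fun j => if j = k₀ then W.density e (e p) else 1)
      (Matrix.of fun j k => chartD e p (v k) j)
    rw [Finset.prod_ite_eq' Finset.univ k₀ (fun _ => W.density e (e p)),
      if_pos (Finset.mem_univ _)] at h
    exact h.symm

end DivFreeWeb

end Density

end WebGeometry

end

noncomputable section

namespace WebGeometry

/-! ### A symmetric block-preserving bilinear map with prescribed trace. -/

section BlockSymmetric

variable {m n : ℕ} (c : Fin n → ℕ) (hc : ∑ i, c i = m)

/-- The symmetric bilinear map `(a, b) ↦ ∑_i (φ(P_i a) P_i b + φ(P_i b) P_i a) / (c_i + 1)`. -/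
def blockSym (φ : Model m →L[ℝ] ℝ) : Model m →L[ℝ] Model m →L[ℝ] Model m :=
  ∑ i, ((c i : ℝ) + 1)⁻¹ • ((φ.comp (blockProj c hc i)).smulRight (blockProj c hc i) +
    ((φ.comp (blockProj c hc i)).smulRight (blockProj c hc i)).flip)

lemma blockSym_apply (φ : Model m →L[ℝ] ℝ) (a b : Model m) :
    blockSym c hc φ a b = ∑ i, ((c i : ℝ) + 1)⁻¹ • (φ (blockProj c hc i a) • blockProj c hc i b +
      φ (blockProj c hc i b) • blockProj c hc i a) := by
  simp [blockSym]

lemma blockSym_comm (φ : Model m →L[ℝ] ℝ) (a b : Model m) :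
    blockSym c hc φ a b = blockSym c hc φ b a := by
  simp only [blockSym_apply]
  exact Finset.sum_congr rfl fun i _ => congrArg _ (add_comm _ _)

/-- In the component k only the summand of the block containing k survives, and it involves b only
through components in that block, which vanish. -/
lemma blockSym_apply_eq_zero (φ : Model m →L[ℝ] ℝ) (a b : Model m) (i : Fin n)
    (hb : ∀ k, blockIndex c hc k ≠ i → b k = 0) (k : Fin m) (hk : blockIndex c hc k ≠ i) :
    blockSym c hc φ a b k = 0 := by
  simp only [blockSym_apply, WithLp.ofLp_sum, Finset.sum_apply, WithLp.ofLp_smul, Pi.smul_apply,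
    WithLp.ofLp_add, Pi.add_apply, blockProj_apply, smul_eq_mul]
  refine Finset.sum_eq_zero fun j _ => ?_
  by_cases hj : blockIndex c hc k = j
  · have h0 : blockProj c hc j b = 0 := by
      ext l
      rw [blockProj_apply]
      split_ifs with hl
      · exact hb l (by rw [hl, ← hj]; exact hk)
      · rfl
    rw [h0, hb k hk]
    simp
  · simp [hj]

/-- On block i the first term is φ(P_i a) times the identity, of trace c_i φ(P_i a); the second has
rank at most one and trace φ(P_i a). The factor 1/(c_i + 1) turns their sum into φ(P_i a), and the
blocks add up to φ(a). -/
lemma sum_blockSym_single (φ : Model m →L[ℝ] ℝ) (a : Model m) :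
    ∑ k, blockSym c hc φ a (EuclideanSpace.single k 1) k = φ a := by
  have h1 : ∀ k, blockSym c hc φ a (EuclideanSpace.single k 1) k =
      ∑ i, ((c i : ℝ) + 1)⁻¹ * ((if blockIndex c hc k = i then φ (blockProj c hc i a) else 0) +
        φ ((blockProj c hc i a k) • blockProj c hc i (EuclideanSpace.single k 1))) := by
    intro k
    simp only [blockSym_apply, WithLp.ofLp_sum, Finset.sum_apply, WithLp.ofLp_smul, Pi.smul_apply,
      WithLp.ofLp_add, Pi.add_apply, smul_eq_mul, map_smul]
    refine Finset.sum_congr rfl fun i _ => ?_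
    rw [blockProj_apply c hc i (EuclideanSpace.single k 1)]
    congr 1
    rw [mul_comm (φ _) (blockProj c hc i a k)]
    congr 1
    split_ifs <;> simp
  have hcard : ∀ i, ∑ k : Fin m, (if blockIndex c hc k = i then φ (blockProj c hc i a) else 0) =
      c i * φ (blockProj c hc i a) := by
    intro i
    have h := sum_blockEmb c hc i fun _ => φ (blockProj c hc i a)
    rw [← h]
    simp
  have hsum : ∀ i, ∑ k : Fin m, φ ((blockProj c hc i a k) •
      blockProj c hc i (EuclideanSpace.single k 1)) = φ (blockProj c hc i a) := by
    intro i
    rw [← map_sum]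
    simp_rw [← map_smul]
    rw [← map_sum, sum_smul_single, blockProj_blockProj, if_pos rfl]
  simp_rw [h1]
  rw [Finset.sum_comm]
  simp_rw [← Finset.mul_sum, Finset.sum_add_distrib, hcard, hsum]
  have h2 : ∀ i, ((c i : ℝ) + 1)⁻¹ * (c i * φ (blockProj c hc i a) + φ (blockProj c hc i a)) =
      φ (blockProj c hc i a) := by
    intro i
    have : (c i : ℝ) + 1 ≠ 0 := by positivity
    field_simp
  simp_rw [h2]
  rw [← map_sum, sum_blockProj]

end BlockSymmetric

/-! ### Affine connections defined by Christoffel symbols in a chart. -/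

section ChartConnection

variable {m : ℕ} {M : Type*} [TopologicalSpace M] [ChartedSpace (Model m) M]

/-- The affine connection on the domain of a chart with given Christoffel symbols. -/
def chartConn (e : OpenPartialHomeomorph M (Model m))
    (B : Model m → Model m →L[ℝ] Model m →L[ℝ] Model m)
    (σ : ∀ p : M, TangentSpace (𝓡 m) p) (p : M) :
    TangentSpace (𝓡 m) p →L[ℝ] TangentSpace (𝓡 m) p :=
  (chartDInv e p).comp
    ((fderiv ℝ (push e σ) (e p) + (B (e p)).flip (push e σ (e p))).comp (chartD e p))

variable {e : OpenPartialHomeomorph M (Model m)}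
  {B : Model m → Model m →L[ℝ] Model m →L[ℝ] Model m}

lemma chartConn_apply (σ : ∀ p : M, TangentSpace (𝓡 m) p) (p : M) (v : TangentSpace (𝓡 m) p) :
    chartConn e B σ p v = chartDInv e p (fderiv ℝ (push e σ) (e p) (chartD e p v) +
      B (e p) (chartD e p v) (push e σ (e p))) :=
  rfl

lemma chartD_chartConn (he : IsSmoothChart e) {p : M} (hp : p ∈ e.source)
    (σ : ∀ p : M, TangentSpace (𝓡 m) p) (v : TangentSpace (𝓡 m) p) :
    chartD e p (chartConn e B σ p v) = fderiv ℝ (push e σ) (e p) (chartD e p v) +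
      B (e p) (chartD e p v) (push e σ (e p)) := by
  rw [chartConn_apply, he.chartD_chartDInv hp]

variable [IsManifold (𝓡 m) ∞ M]

lemma isCovariantDerivativeOn_chartConn (he : IsSmoothChart e) :
    IsCovariantDerivativeOn (I := 𝓡 m) (Model m) (V := (TangentSpace (𝓡 m) : M → Type _))
      (chartConn e B) e.source where
  add {σ σ' p} hσ hσ' hp := by
    have h : push e (σ + σ') = push e σ + push e σ' := by
      funext x
      exact map_add _ _ _
    ext1 v
    apply he.chartD_injective hp
    rw [_root_.add_apply, map_add, chartD_chartConn he hp, chartD_chartConn he hp,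
      chartD_chartConn he hp, h,
      fderiv_add (he.differentiableAt_push hp hσ) (he.differentiableAt_push hp hσ'),
      _root_.add_apply, Pi.add_apply, map_add]
    abel
  leibniz {σ g p} hσ hg hp := by
    have h : push e (g • σ) = (g ∘ e.symm) • push e σ := by
      funext x
      exact (chartD e (e.symm x)).map_smul (g (e.symm x)) (σ (e.symm x))
    ext1 v
    apply he.chartD_injective hp
    have h2 : (g ∘ e.symm) (e p) = g p := by simp [e.left_inv hp]
    rw [_root_.add_apply, _root_.smul_apply, map_add, map_smul, ContinuousLinearMap.smulRight_apply,
      map_smul, chartD_chartConn he hp,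
      chartD_chartConn he hp, h, fderiv_smul (he.mdifferentiableAt_comp_symm hp hg)
        (he.differentiableAt_push hp hσ), he.mvfderiv_eq hp hg, Pi.smul_apply', h2,
      _root_.add_apply, _root_.smul_apply, ContinuousLinearMap.smulRight_apply, map_smul,
      IsSmoothChart.push_apply hp, smul_add]
    abel

/-- Symmetric Christoffel symbols cancel in the difference, leaving the coordinate expression of the
bracket. -/
lemma chartConn_torsion (he : IsSmoothChart e) {p : M} (hp : p ∈ e.source)
    (hB : ∀ a b, B (e p) a b = B (e p) b a) {X Y : ∀ p : M, TangentSpace (𝓡 m) p}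
    (hX : MDifferentiableAt (𝓡 m) (𝓡 m).tangent
      (fun p => (⟨p, X p⟩ : TangentBundle (𝓡 m) M)) p)
    (hY : MDifferentiableAt (𝓡 m) (𝓡 m).tangent
      (fun p => (⟨p, Y p⟩ : TangentBundle (𝓡 m) M)) p) :
    chartConn e B Y p (X p) - chartConn e B X p (Y p) = VectorField.mlieBracket (𝓡 m) X Y p := by
  apply he.chartD_injective hp
  rw [map_sub, chartD_chartConn he hp, chartD_chartConn he hp, he.mlieBracket_eq hp hX hY,
    IsSmoothChart.push_apply hp, IsSmoothChart.push_apply hp, hB (chartD e p (Y p))]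
  abel

lemma contMDiffAt_chartConn (he : IsSmoothChart e) {p : M} (hp : p ∈ e.source)
    (hB : ∀ a b : Model m → Model m, ContDiffAt ℝ ∞ a (e p) → ContDiffAt ℝ ∞ b (e p) →
      ContDiffAt ℝ ∞ (fun x => B x (a x) (b x)) (e p))
    {X Y : ∀ p : M, TangentSpace (𝓡 m) p}
    (hX : ContMDiffAt (𝓡 m) (𝓡 m).tangent ∞ (fun p => (⟨p, X p⟩ : TangentBundle (𝓡 m) M)) p)
    (hY : ContMDiffAt (𝓡 m) (𝓡 m).tangent ∞ (fun p => (⟨p, Y p⟩ : TangentBundle (𝓡 m) M)) p) :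
    ContMDiffAt (𝓡 m) (𝓡 m).tangent ∞
      (fun p => (⟨p, chartConn e B Y p (X p)⟩ : TangentBundle (𝓡 m) M)) p := by
  have hX' := he.contDiffAt_push hp hX
  have hY' := he.contDiffAt_push hp hY
  have h := he.contMDiffAt_pull hp
    (V := fun x => fderiv ℝ (push e Y) x (push e X x) + B x (push e X x) (push e Y x))
    (((hY'.fderiv_right (m := ∞) (by simp)).clm_apply hX').add (hB _ _ hX' hY'))
  refine h.congr_of_eventuallyEq ?_
  filter_upwards [e.open_source.mem_nhds hp] with q hq
  rw [chartConn_apply, pull, ← IsSmoothChart.push_apply hq]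

/-- A family of endomorphisms of the tangent spaces is smooth if it preserves smoothness of
vector fields. -/
lemma contMDiffAt_hom_of_apply {φ : ∀ q : M, TangentSpace (𝓡 m) q →L[ℝ] TangentSpace (𝓡 m) q}
    {p : M} (h : ∀ Z : ∀ q : M, TangentSpace (𝓡 m) q, ContMDiffAt (𝓡 m) (𝓡 m).tangent ∞
        (fun q => (⟨q, Z q⟩ : TangentBundle (𝓡 m) M)) p →
      ContMDiffAt (𝓡 m) (𝓡 m).tangent ∞ (fun q => (⟨q, φ q (Z q)⟩ : TangentBundle (𝓡 m) M)) p) :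
    ContMDiffAt (𝓡 m) ((𝓡 m).prod 𝓘(ℝ, Model m →L[ℝ] Model m)) ∞
      (fun q => (⟨q, φ q⟩ : Bundle.TotalSpace (Model m →L[ℝ] Model m)
        fun x : M => TangentSpace (𝓡 m) x →L[ℝ] TangentSpace (𝓡 m) x)) p := by
  rw [contMDiffAt_hom_bundle]
  refine ⟨contMDiffAt_id, ?_⟩
  let t := trivializationAt (Model m) (TangentSpace (𝓡 m) : M → Type _) p
  have hpt : p ∈ t.baseSet := FiberBundle.mem_baseSet_trivializationAt' p
  let L : M → Model m →L[ℝ] Model m := fun q =>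
    (t.continuousLinearMapAt ℝ q).comp ((φ q).comp (t.symmL ℝ q))
  change ContMDiffAt (𝓡 m) 𝓘(ℝ, Model m →L[ℝ] Model m) ∞ L p
  -- A linear map is assembled from its columns. Each column is the value on a field that is
  -- constant in the trivialization, hence smooth, so the hypothesis applies to it.
  have hL : L = fun q => ∑ k, (EuclideanSpace.proj (𝕜 := ℝ) k : Model m →L[ℝ] ℝ).smulRight
      (L q (EuclideanSpace.single k 1)) := by
    funext q
    ext1 w
    conv_lhs => rw [← sum_smul_single w]
    simp only [map_sum, map_smul, _root_.sum_apply, ContinuousLinearMap.smulRight_apply]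
    rfl
  rw [hL]
  refine contMDiffAt_finsetSum fun k _ => ?_
  have hZ : ContMDiffAt (𝓡 m) (𝓡 m).tangent ∞ (fun q =>
      (⟨q, t.symmL ℝ q (EuclideanSpace.single k 1)⟩ : TangentBundle (𝓡 m) M)) p := by
    have h1 : ContMDiffOn (𝓡 m) (𝓡 m).tangent ∞ (fun q =>
        (⟨q, t.symmL ℝ q (EuclideanSpace.single k 1)⟩ : TangentBundle (𝓡 m) M)) t.baseSet := by
      rw [t.contMDiffOn_section_baseSet_iff]
      refine (contMDiffOn_const (c := EuclideanSpace.single k (1 : ℝ))).congr fun y hy => ?_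
      rw [t.symmL_apply hy, t.mk_symm hy]
      exact congrArg Prod.snd (t.apply_symm_apply (t.mem_target.2 hy))
    exact h1.contMDiffAt (t.open_baseSet.mem_nhds hpt)
  have h2 := h _ hZ
  have h3 := (Bundle.contMDiffAt_totalSpace.1 h2).2
  have h4 : ContMDiffAt (𝓡 m) 𝓘(ℝ, Model m) ∞ (fun q => L q (EuclideanSpace.single k 1)) p := by
    refine h3.congr_of_eventuallyEq ?_
    filter_upwards [t.open_baseSet.mem_nhds hpt] with q hq
    change t.linearMapAt ℝ q _ = _
    rw [t.coe_linearMapAt_of_mem hq]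
    rfl
  exact (ContinuousLinearMap.smulRightL ℝ (Model m) (Model m)
    (EuclideanSpace.proj (𝕜 := ℝ) k)).contMDiff.contMDiffAt.comp p h4

end ChartConnection

end WebGeometry

end

noncomputable section

namespace WebGeometry

/-! ### Existence of web connections. -/

section Existence

variable {m n : ℕ} {c : Fin n → ℕ} {M : Type*} [TopologicalSpace M] [ChartedSpace (Model m) M]
  [IsManifold (𝓡 m) ∞ M]

lemma fderiv_coord_eq_zero {E : Type*} [NormedAddCommGroup E] [NormedSpace ℝ E] {u : E → Model m}
    {x : E} (hu : DifferentiableAt ℝ u x) {k : Fin m} (h : ∀ᶠ y in 𝓝 x, u y k = 0) (v : E) :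
    fderiv ℝ u x v k = 0 := by
  have h1 : HasFDerivAt (fun y => u y k)
      ((EuclideanSpace.proj (𝕜 := ℝ) k).comp (fderiv ℝ u x)) x :=
    (EuclideanSpace.proj (𝕜 := ℝ) k).hasFDerivAt.comp x hu.hasFDerivAt
  have h2 : (fun y => u y k) =ᶠ[𝓝 x] fun _ => 0 := h
  have h3 := h1.fderiv.symm.trans (h2.fderiv_eq.trans (fderiv_const_apply _))
  exact congrArg (fun T : E →L[ℝ] ℝ => T v) h3

namespace DivFreeWeb

variable (W : DivFreeWeb m M c) {e : OpenPartialHomeomorph M (Model m)}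

/-- Christoffel symbols of a torsionless connection in a web chart which preserves the web and the
volume form. -/
def christoffel (e : OpenPartialHomeomorph M (Model m)) (x : Model m) :
    Model m →L[ℝ] Model m →L[ℝ] Model m :=
  blockSym c W.sum_codim (fderiv ℝ (W.logDensity e) x)

/-- By duality a frame vector is killed by every covector of another block, so it is tangent to the
foliations of all blocks but its own. -/
lemma IsAdaptedCoframe.chartD_eq_zero {W : DivFreeWeb m M c} (he : W.IsWebChart e) {U : Set M}
    {ξ : Fin m → ∀ p : M, TangentSpace (𝓡 m) p →ₗ[ℝ] ℝ}
    {f : Fin m → ∀ p : M, TangentSpace (𝓡 m) p} (hf : W.IsAdaptedCoframe U ξ f) {p : M}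
    (hpU : p ∈ U) (hp : p ∈ e.source) (k l : Fin m) (hkl : W.idx l ≠ W.idx k) :
    chartD e p (f k p) l = 0 := by
  have h : f k p ∈ (W.fol (W.idx l)).tangent p := by
    rw [hf.tangent p hpU, Submodule.mem_iInf]
    intro j
    rw [Submodule.mem_iInf]
    intro hj
    rw [W.mem_block] at hj
    rw [LinearMap.mem_ker, hf.dual p hpU, if_neg]
    rintro rfl
    exact hkl hj.symm
  rw [he.mem_tangent_iff p hp] at h
  exact h l (W.mem_block.2 rfl)

lemma IsAdaptedCoframe.coframe_eq_zero {W : DivFreeWeb m M c} (he : W.IsWebChart e) {U : Set M}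
    {ξ : Fin m → ∀ p : M, TangentSpace (𝓡 m) p →ₗ[ℝ] ℝ}
    {f : Fin m → ∀ p : M, TangentSpace (𝓡 m) p} (hf : W.IsAdaptedCoframe U ξ f) {p : M}
    (hpU : p ∈ U) (hp : p ∈ e.source) (j : Fin m) (w : TangentSpace (𝓡 m) p)
    (hw : ∀ l, W.idx l = W.idx j → chartD e p w l = 0) : ξ j p w = 0 := by
  have h : w ∈ (W.fol (W.idx j)).tangent p := by
    rw [he.mem_tangent_iff p hp]
    exact fun l hl => hw l (W.mem_block.1 hl)
  rw [hf.tangent p hpU, Submodule.mem_iInf] at h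
  have := h j
  rw [Submodule.mem_iInf] at this
  exact this (W.mem_block.2 rfl)

/-- Near p the frame field has components in its own block only. Coordinate differentiation and the
symbols `christoffel` both preserve this, and a coframe member of another block kills such vectors.
-/
lemma chartConn_offdiag (he : W.IsWebChart e) {U : Set M} (hU : IsOpen U)
    {ξ : Fin m → ∀ p : M, TangentSpace (𝓡 m) p →ₗ[ℝ] ℝ}
    {f : Fin m → ∀ p : M, TangentSpace (𝓡 m) p} (hf : W.IsAdaptedCoframe U ξ f) {p : M}
    (hpU : p ∈ U) (hp : p ∈ e.source) {j k : Fin m} (hjk : W.idx j ≠ W.idx k)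
    (v : TangentSpace (𝓡 m) p) : ξ j p (chartConn e (W.christoffel e) (f k) p v) = 0 := by
  have he' := he.toIsSmoothChart
  refine hf.coframe_eq_zero he hpU hp j _ fun l hl => ?_
  rw [chartD_chartConn he' hp, PiLp.add_apply]
  have hd := he'.contDiffAt_push hp ((smoothFieldOn_iff hU).1 (hf.smooth k) p hpU)
  have hlk : W.idx l ≠ W.idx k := hl.trans_ne hjk
  rw [fderiv_coord_eq_zero (hd.differentiableAt (by simp)), zero_add]
  · refine blockSym_apply_eq_zero c W.sum_codim _ _ _ (W.idx k) (fun l' hl' => ?_) l hlk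
    rw [IsSmoothChart.push_apply hp]
    exact hf.chartD_eq_zero he hpU hp k l' hl'
  · filter_upwards [e.open_target.mem_nhds (e.map_source hp),
      (IsSmoothChart.tendsto_symm hp).eventually (hU.mem_nhds hpU)] with y hy hyU
    exact hf.chartD_eq_zero he hyU (e.map_target hy) k l hlk

variable [T2Space M]

lemma chartConn_trace (he : W.IsWebChart e) {U : Set M} (hU : IsOpen U)
    {ξ : Fin m → ∀ p : M, TangentSpace (𝓡 m) p →ₗ[ℝ] ℝ}
    {f : Fin m → ∀ p : M, TangentSpace (𝓡 m) p} (hf : W.IsAdaptedCoframe U ξ f) {p : M}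
    (hpU : p ∈ U) (hp : p ∈ e.source) (v : TangentSpace (𝓡 m) p) :
    ∑ k, ξ k p (chartConn e (W.christoffel e) (f k) p v) = 0 := by
  have h := W.sum_coframe_apply he.toIsSmoothChart hU hf hpU hp
    (W.christoffel e (e p) (chartD e p v)) (chartD e p v)
  simp_rw [chartConn_apply]
  rw [h, christoffel, sum_blockSym_single, sub_self]

lemma contDiffAt_christoffel_apply (he : IsSmoothChart e) {x : Model m} (hx : x ∈ e.target)
    {a b : Model m → Model m} (ha : ContDiffAt ℝ ∞ a x) (hb : ContDiffAt ℝ ∞ b x) :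
    ContDiffAt ℝ ∞ (fun x => W.christoffel e x (a x) (b x)) x := by
  simp only [christoffel, blockSym_apply]
  have hφ : ContDiffAt ℝ ∞ (fderiv ℝ (W.logDensity e)) x :=
    (W.contDiffAt_logDensity he hx).fderiv_right (by simp)
  have hP : ∀ (i : Fin n) {a : Model m → Model m}, ContDiffAt ℝ ∞ a x →
      ContDiffAt ℝ ∞ (fun x => blockProj c W.sum_codim i (a x)) x := fun i a ha =>
    (blockProj c W.sum_codim i).contDiff.contDiffAt.comp x ha
  refine ContDiffAt.sum fun i _ => ?_
  have h1 := ((hφ.clm_apply (hP i ha)).smul (hP i hb)).add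
    ((hφ.clm_apply (hP i hb)).smul (hP i ha))
  exact h1.const_smul (((c i : ℝ) + 1)⁻¹)

/-- All conditions on a web connection are affine, so the chart connections can be averaged with a
partition of unity. -/
theorem exists_isWebConnection [SecondCountableTopology M] : ∃ Θ, W.IsWebConnection Θ := by
  have := Manifold.locallyCompact_of_finiteDimensional (M := M) (𝓡 m)
  choose e he hpe _ using W.exists_webChart
  obtain ⟨ρ, hρ⟩ := SmoothPartitionOfUnity.exists_isSubordinate (𝓡 m) (s := Set.univ) isClosed_univ
    (fun p => (e p).source) (fun p => (e p).open_source)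
    (fun p _ => Set.mem_iUnion.2 ⟨p, hpe p⟩)
  have he' := fun α => (he α).toIsSmoothChart
  let Ψ : M → (∀ p : M, TangentSpace (𝓡 m) p) → ∀ p : M,
      TangentSpace (𝓡 m) p →L[ℝ] TangentSpace (𝓡 m) p :=
    fun α => chartConn (e α) (W.christoffel (e α))
  have hmem : ∀ p, ∀ α ∈ ρ.fintsupport p, p ∈ (e α).source := fun p α hα =>
    hρ α ((ρ.mem_fintsupport_iff p α).1 hα)
  have hmem' : ∀ p, ∀ α ∈ ρ.finsupport p, p ∈ (e α).source := fun p α hα =>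
    hmem p α (ρ.finsupport_subset_fintsupport p hα)
  have hsum : ∀ p, ∑ α ∈ ρ.finsupport p, ρ α p = 1 := fun p => ρ.sum_finsupport p (Set.mem_univ p)
  let Θ : CovariantDerivative (𝓡 m) (Model m) (TangentSpace (𝓡 m) : M → Type _) :=
    { toFun := fun σ p => ∑ α ∈ ρ.finsupport p, ρ α p • Ψ α σ p
      isCovariantDerivativeOnUniv :=
        { add := by
            intro σ σ' p hσ hσ' _
            rw [← Finset.sum_add_distrib]
            refine Finset.sum_congr rfl fun α hα => ?_
            have h : Ψ α (σ + σ') p = Ψ α σ p + Ψ α σ' p :=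
              (isCovariantDerivativeOn_chartConn (he' α)).add hσ hσ' (hmem' p α hα)
            rw [← smul_add, h]
          leibniz := by
            intro σ g p hσ hg _
            have h : ∀ α ∈ ρ.finsupport p, ρ α p • Ψ α (g • σ) p =
                g p • ρ α p • Ψ α σ p + ρ α p • (mvfderiv (𝓡 m) g p).smulRight (σ p) := by
              intro α hα
              have h : Ψ α (g • σ) p =
                  g p • Ψ α σ p + (mvfderiv (𝓡 m) g p).smulRight (σ p) :=
                (isCovariantDerivativeOn_chartConn (he' α)).leibniz hσ hg (hmem' p α hα)
              rw [h, smul_add, smul_comm]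
            rw [Finset.sum_congr rfl h, Finset.sum_add_distrib, ← Finset.smul_sum,
              ← Finset.sum_smul, hsum p, one_smul] } }
  have hΘ : ∀ σ p (v : TangentSpace (𝓡 m) p),
      Θ σ p v = ∑ α ∈ ρ.finsupport p, ρ α p • Ψ α σ p v := by
    intro σ p v
    change (∑ α ∈ ρ.finsupport p, ρ α p • Ψ α σ p) v = _
    rw [_root_.sum_apply]
    rfl
  refine ⟨Θ, ⟨⟨⟨fun {σ} hσ => ?_⟩⟩, ?_, ?_, ?_⟩⟩
  · intro p _
    refine ContMDiffAt.contMDiffWithinAt (contMDiffAt_hom_of_apply fun Z hZ => ?_)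
    have hσ' : ContMDiffAt (𝓡 m) (𝓡 m).tangent ∞
        (fun q => (⟨q, σ q⟩ : TangentBundle (𝓡 m) M)) p :=
      hσ.contMDiffAt Filter.univ_mem
    -- The index set `ρ.finsupport q` varies with q; near p it is contained in the fixed finite set
    -- `ρ.fintsupport p`, over which the sum is visibly smooth, and the additional terms have weight
    -- zero.
    have h1 : ContMDiffAt (𝓡 m) (𝓡 m).tangent ∞ (fun q =>
        (⟨q, ∑ α ∈ ρ.fintsupport p, ρ α q • Ψ α σ q (Z q)⟩ : TangentBundle (𝓡 m) M)) p := by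
      refine ContMDiffAt.sum_section fun α hα => ?_
      exact ((ρ α).contMDiff p).smul_section (contMDiffAt_chartConn (he' α) (hmem p α hα)
        (fun a b ha hb => W.contDiffAt_christoffel_apply (he' α)
          ((e α).map_source (hmem p α hα)) ha hb) hZ hσ')
    refine h1.congr_of_eventuallyEq ?_
    filter_upwards [ρ.eventually_finsupport_subset p] with q hq
    have h2 : Θ σ q (Z q) = ∑ α ∈ ρ.fintsupport p, ρ α q • Ψ α σ q (Z q) := by
      rw [hΘ]
      refine Finset.sum_subset hq fun α _ hα => ?_
      have h0 : ρ α q = 0 := by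
        by_contra hne
        exact hα ((ρ.mem_finsupport q).2 hne)
      rw [h0, zero_smul]
    exact congrArg (Bundle.TotalSpace.mk' (Model m) q) h2
  · rw [CovariantDerivative.torsion_eq_zero_iff]
    intro X Y p hX hY
    rw [hΘ, hΘ, ← Finset.sum_sub_distrib]
    have h : ∀ α ∈ ρ.finsupport p, ρ α p • Ψ α Y p (X p) - ρ α p • Ψ α X p (Y p) =
        ρ α p • VectorField.mlieBracket (𝓡 m) X Y p := by
      intro α hα
      have h : Ψ α Y p (X p) - Ψ α X p (Y p) = VectorField.mlieBracket (𝓡 m) X Y p :=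
        chartConn_torsion (he' α) (hmem' p α hα)
          (fun a b => blockSym_comm c W.sum_codim _ a b) hX hY
      rw [← smul_sub, h]
    rw [Finset.sum_congr rfl h, ← Finset.sum_smul, hsum p, one_smul]
  · intro U ξ f hU hf p hp j k hjk v
    rw [hΘ, map_sum]
    refine Finset.sum_eq_zero fun α hα => ?_
    rw [map_smul, W.chartConn_offdiag (he α) hU hf hp (hmem' p α hα), smul_zero]
    intro h
    exact hjk ⟨W.idx j, W.mem_block.2 rfl, W.mem_block.2 h.symm⟩
  · intro U ξ f hU hf p hp v
    simp_rw [hΘ, map_sum, map_smul]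
    rw [Finset.sum_comm]
    refine Finset.sum_eq_zero fun α hα => ?_
    rw [← Finset.smul_sum, W.chartConn_trace (he α) hU hf hp (hmem' p α hα), smul_zero]

end DivFreeWeb

end Existence

end WebGeometry

end

noncomputable section

namespace WebGeometry

namespace DivFreeWeb

/-! ### Christoffel symbols of an arbitrary web connection. -/

section Christoffel

variable {m n : ℕ} {c : Fin n → ℕ} {M : Type*} [TopologicalSpace M] [ChartedSpace (Model m) M]
  [IsManifold (𝓡 m) ∞ M] {W : DivFreeWeb m M c} {e : OpenPartialHomeomorph M (Model m)}
  {Θ : CovariantDerivative (𝓡 m) (Model m) (TangentSpace (𝓡 m) : M → Type _)}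

/-- An affine connection in a chart. -/
lemma exists_christoffel_of_covariantDerivative
    (Θ : CovariantDerivative (𝓡 m) (Model m) (TangentSpace (𝓡 m) : M → Type _))
    (he : IsSmoothChart e) {p : M} (hp : p ∈ e.source) :
    ∃ Γ : Model m →L[ℝ] Model m →L[ℝ] Model m, ∀ σ : ∀ p : M, TangentSpace (𝓡 m) p,
      MDifferentiableAt (𝓡 m) (𝓡 m).tangent (fun p => (⟨p, σ p⟩ : TangentBundle (𝓡 m) M)) p →
      ∀ v, chartD e p (Θ σ p v) = fderiv ℝ (push e σ) (e p) (chartD e p v) +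
        Γ (chartD e p v) (chartD e p (σ p)) := by
  have : IsManifold (𝓡 m) 1 M := IsManifold.of_le (n := ∞) (by simp)
  have h1 := isCovariantDerivativeOn_chartConn (B := fun _ => 0) he
  have h2 : IsCovariantDerivativeOn (I := 𝓡 m) (Model m)
      (V := (TangentSpace (𝓡 m) : M → Type _)) Θ e.source :=
    Θ.isCovariantDerivativeOn
  -- Two covariant derivatives differ by a tensor. Comparing with the chart connection of zero
  -- symbols and conjugating into coordinates gives Γ; the flip is needed because this tensor takes
  -- the differentiated field first.
  let D := h2.difference h1 p
  let D₀ : Model m →L[ℝ] Model m →L[ℝ] Model m := D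
  let A : Model m →L[ℝ] Model m := chartD e p
  let A' : Model m →L[ℝ] Model m := chartDInv e p
  let D' : Model m →L[ℝ] Model m →L[ℝ] Model m :=
    ((ContinuousLinearMap.compL ℝ (Model m) (Model m) (Model m)).flip A').comp
      ((ContinuousLinearMap.compL ℝ (Model m) (Model m) (Model m) A).comp (D₀.comp A'))
  refine ⟨D'.flip, fun σ hσ v => ?_⟩
  have h3 : D (σ p) = Θ σ p - chartConn e (fun _ => 0) σ p := h2.difference_apply h1 hp hσ
  have h4 : D'.flip (chartD e p v) (chartD e p (σ p)) =
      chartD e p (D (chartDInv e p (chartD e p (σ p))) (chartDInv e p (chartD e p v))) := rfl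
  rw [h4, he.chartDInv_chartD hp, he.chartDInv_chartD hp, h3, _root_.sub_apply, map_sub,
    chartD_chartConn he hp]
  simp

variable [T2Space M]

/-- The Christoffel symbols of a web connection in a web chart. -/
theorem IsWebConnection.exists_christoffel (hm : 0 < m) (hΘ : W.IsWebConnection Θ)
    (he : W.IsWebChart e) {p : M} (hp : p ∈ e.source) :
    ∃ Γ : Model m →L[ℝ] Model m →L[ℝ] Model m,
      (∀ σ : ∀ p : M, TangentSpace (𝓡 m) p,
        MDifferentiableAt (𝓡 m) (𝓡 m).tangent (fun p => (⟨p, σ p⟩ : TangentBundle (𝓡 m) M)) p →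
        ∀ v, chartD e p (Θ σ p v) = fderiv ℝ (push e σ) (e p) (chartD e p v) +
          Γ (chartD e p v) (chartD e p (σ p))) ∧
      (∀ a b, ∀ i, (∀ k, W.idx k ≠ i → b k = 0) → ∀ k, W.idx k ≠ i → Γ a b k = 0) ∧
      ∀ i a, ∑ s, Γ a (EuclideanSpace.single (W.emb i s) 1) (W.emb i s) =
        fderiv ℝ (W.logDensity e) (e p) (W.proj i a) := by
  have he' := he.toIsSmoothChart
  have hx := e.map_source hp
  obtain ⟨Γ, hΓ⟩ := exists_christoffel_of_covariantDerivative Θ he' hp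
  have hconst : ∀ a : Model m, MDifferentiableAt (𝓡 m) (𝓡 m).tangent
      (fun q => (⟨q, pull e (fun _ => a) q⟩ : TangentBundle (𝓡 m) M)) p := fun a =>
    (he'.contMDiffAt_pull hp contDiffAt_const).mdifferentiableAt (by simp)
  have hfd : ∀ a : Model m, fderiv ℝ (push e (pull e fun _ => a)) (e p) = 0 := fun a => by
    rw [(he'.push_pull_eventuallyEq (fun _ => a) hp).fderiv_eq, fderiv_const_apply]
  have hval : ∀ a : Model m, chartD e p (pull e (fun _ => a) p) = a := fun a =>
    he'.chartD_chartDInv hp a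
  -- Vanishing torsion is tested on fields with constant coordinates, whose bracket is zero.
  have hsymm : ∀ a b, Γ a b = Γ b a := by
    intro a b
    have h1 := (CovariantDerivative.torsion_eq_zero_iff Θ).1 hΘ.torsion (hconst a) (hconst b)
    have h2 := congrArg (chartD e p) h1
    rw [map_sub, hΓ _ (hconst a), hΓ _ (hconst b), he'.mlieBracket_eq hp (hconst a) (hconst b),
      hfd, hfd, hval, hval] at h2
    simpa [sub_eq_zero] using h2
  -- Here m ≥ 1 enters: one coordinate vector has to absorb the density for the frame to be adapted.
  let k₀ : Fin m := ⟨0, hm⟩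
  have hframe := W.isAdaptedCoframe_of_webChart he k₀
  set f : Fin m → ∀ p : M, TangentSpace (𝓡 m) p := fun k => pull e fun x =>
    (if k = k₀ then (W.density e x)⁻¹ else 1) • EuclideanSpace.single k 1 with hf
  have hfs : ∀ k, MDifferentiableAt (𝓡 m) (𝓡 m).tangent
      (fun q => (⟨q, f k q⟩ : TangentBundle (𝓡 m) M)) p := fun k =>
    ((smoothFieldOn_iff e.open_source).1 (hframe.smooth k) p hp).mdifferentiableAt (by simp)
  have hdens := W.density_ne_zero he' hx
  have hΓf : ∀ k v, Θ (f k) p v = chartDInv e p (fderiv ℝ (push e (f k)) (e p) (chartD e p v) +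
      Γ (chartD e p v) (push e (f k) (e p))) := by
    intro k v
    apply he'.chartD_injective hp
    rw [hΓ _ (hfs k), he'.chartD_chartDInv hp, IsSmoothChart.push_apply hp]
  -- Differentiating the rescaling factor only contributes along the k-th coordinate, so the j-th
  -- component of the connection form is a nonzero multiple of that of Γ.
  have hoff : ∀ a j k, W.idx j ≠ W.idx k → Γ a (EuclideanSpace.single k 1) j = 0 := by
    intro a j k hjk
    have h1 := hΘ.offdiag _ _ _ e.open_source hframe p hp j k (fun ⟨i, hi, hi'⟩ =>
      hjk ((W.mem_block.1 hi).trans (W.mem_block.1 hi').symm)) (chartDInv e p a)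
    have h2 : (if j = k₀ then W.density e (e p) else 1) ≠ 0 := by
      split_ifs
      · exact hdens
      · exact one_ne_zero
    have h3 : chartD e p (Θ (f k) p (chartDInv e p a)) j = 0 :=
      (smul_eq_zero_iff_right h2).1 h1
    have hd : DifferentiableAt ℝ (push e (f k)) (e p) := he'.differentiableAt_push hp (hfs k)
    have hpush : ∀ᶠ y in 𝓝 (e p), push e (f k) y =
        (if k = k₀ then (W.density e y)⁻¹ else 1) • EuclideanSpace.single k 1 :=
      he'.push_pull_eventuallyEq _ hp
    rw [hΓ _ (hfs k), he'.chartD_chartDInv hp, PiLp.add_apply, fderiv_coord_eq_zero hd,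
      zero_add, ← IsSmoothChart.push_apply hp, hpush.self_of_nhds, map_smul, PiLp.smul_apply] at h3
    · refine (smul_eq_zero_iff_right ?_).1 h3
      split_ifs
      · exact inv_ne_zero hdens
      · exact one_ne_zero
    · filter_upwards [hpush] with y hy
      have hjk' : j ≠ k := fun h => hjk (congrArg _ h)
      rw [hy, PiLp.smul_apply, PiLp.single_apply, if_neg hjk', smul_zero]
  have hblock : ∀ a b, ∀ i, (∀ k, W.idx k ≠ i → b k = 0) → ∀ k, W.idx k ≠ i → Γ a b k = 0 := by
    intro a b i hb k hk
    rw [← sum_smul_single b, map_sum, WithLp.ofLp_sum, Finset.sum_apply]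
    refine Finset.sum_eq_zero fun l _ => ?_
    rw [map_smul, WithLp.ofLp_smul, Pi.smul_apply]
    by_cases hl : W.idx l = i
    · rw [hoff a k l (fun h => hk (h.trans hl)), smul_zero]
    · rw [hb l hl, zero_smul]
  have htr : ∀ a, ∑ k, Γ a (EuclideanSpace.single k 1) k =
      fderiv ℝ (W.logDensity e) (e p) a := by
    intro a
    have h1 := W.sum_coframe_apply he' e.open_source hframe hp hp (Γ a) a
    have h2 := hΘ.trace _ _ _ e.open_source hframe p hp (chartDInv e p a)
    simp_rw [hΓf, he'.chartD_chartDInv hp] at h2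
    rw [h2] at h1
    exact (sub_eq_zero.1 h1.symm)
  have hproj : ∀ i (a : Model m) k, W.idx k ≠ i → W.proj i a k = 0 := fun i a k hk => by
    rw [blockProj_apply, if_neg hk]
  refine ⟨Γ, hΓ, hblock, fun i a => ?_⟩
  -- For j ≠ i the part P_j a does not contribute: by symmetry it may be moved to the second slot,
  -- and then the value lies in block j.
  have h1 : ∀ s, Γ a (EuclideanSpace.single (W.emb i s) 1) (W.emb i s) =
      Γ (W.proj i a) (EuclideanSpace.single (W.emb i s) 1) (W.emb i s) := by
    intro s
    conv_lhs => rw [← sum_blockProj c W.sum_codim a]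
    rw [map_sum, _root_.sum_apply, WithLp.ofLp_sum, Finset.sum_apply]
    refine Finset.sum_eq_single_of_mem i (Finset.mem_univ _) fun j _ hj => ?_
    rw [hsymm]
    refine hblock _ _ j (hproj j a) _ ?_
    exact (blockIndex_blockEmb c W.sum_codim i s).trans_ne hj.symm
  simp_rw [h1]
  rw [sum_blockEmb c W.sum_codim i
    (fun k => Γ (W.proj i a) (EuclideanSpace.single k 1) k), ← htr]
  -- In the full trace of Γ(P_i a) the terms outside block i vanish for the same reason, so the
  -- block trace equals the full one.
  refine Finset.sum_congr rfl fun k _ => ?_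
  split_ifs with hk
  · rfl
  · rw [hsymm, hblock _ _ i (hproj i a) k hk]

end Christoffel

end DivFreeWeb

end WebGeometry

end

noncomputable section

namespace WebGeometry

namespace DivFreeWeb

/-! ### Components of sections of the determinant bundles. -/

section Coefficients

variable {m n : ℕ} {c : Fin n → ℕ} {M : Type*} [TopologicalSpace M] [ChartedSpace (Model m) M]
  [IsManifold (𝓡 m) ∞ M] (W : DivFreeWeb m M c) {e : OpenPartialHomeomorph M (Model m)}

/-- The coordinate vector fields along the `i`-th block of a chart. -/
def coordVec (e : OpenPartialHomeomorph M (Model m)) (i : Fin n) (a : Fin (c i)) (q : M) :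
    TangentSpace (𝓡 m) q :=
  pull e (fun _ => EuclideanSpace.single (W.emb i a) 1) q

/-- The wedge product of the coordinate vector fields along the `i`-th block. -/
def coordMulti (e : OpenPartialHomeomorph M (Model m)) (i : Fin n) (q : M) :
    ⋀[ℝ]^(c i) (TangentSpace (𝓡 m) q) :=
  exteriorPower.ιMulti ℝ (c i) fun a => W.coordVec e i a q

/-- The wedge product of the coordinate differentials along the `i`-th block. -/
def coordForm (e : OpenPartialHomeomorph M (Model m)) (i : Fin n) (q : M) :
    (TangentSpace (𝓡 m) q) [⋀^Fin (c i)]→ₗ[ℝ] ℝ :=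
  (Pi.basisFun ℝ (Fin (c i))).det.compLinearMap (LinearMap.pi fun a =>
    ((EuclideanSpace.proj (𝕜 := ℝ) (W.emb i a)).comp (chartD e q)).toLinearMap)

lemma coordForm_apply (i : Fin n) (q : M) (v : Fin (c i) → TangentSpace (𝓡 m) q) :
    W.coordForm e i q v = (Matrix.of fun a k => chartD e q (v k) (W.emb i a)).det := by
  rw [coordForm, AlternatingMap.compLinearMap_apply, Module.Basis.det_apply]
  rfl

/-- The component of a section with respect to the coordinate multivector field. -/
def coeff (η : W.detSections) (e : OpenPartialHomeomorph M (Model m)) (i : Fin n) (q : M) : ℝ :=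
  exteriorPower.alternatingMapLinearEquiv (W.coordForm e i q) (η.1 q i)

lemma coeff_add (η η' : W.detSections) (i : Fin n) (q : M) :
    W.coeff (η + η') e i q = W.coeff η e i q + W.coeff η' e i q :=
  map_add _ _ _

lemma coeff_smulSection (f : M → ℝ) (hf : ContMDiff (𝓡 m) 𝓘(ℝ, ℝ) ∞ f) (η : W.detSections)
    (i : Fin n) (q : M) :
    W.coeff (W.smulSection f hf η) e i q = f q * W.coeff η e i q :=
  map_smul _ _ _

lemma coeff_wedgeSection (i : Fin n) (Y : Fin (c i) → ∀ p : M, TangentSpace (𝓡 m) p)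
    (hY : ∀ j, SmoothFieldOn (Y j) Set.univ) (hYt : ∀ j p, Y j p ∈ W.complTangent i p) (q : M) :
    W.coeff (W.wedgeSection i Y hY hYt) e i q =
      (Matrix.of fun a k => chartD e q (Y k q) (W.emb i a)).det := by
  rw [← W.coordForm_apply i q fun k => Y k q, coeff, wedgeSection]
  simp only [Pi.single_eq_same]
  exact exteriorPower.alternatingMapLinearEquiv_apply_ιMulti _ _

lemma coeff_wedgeSection_of_ne {i i' : Fin n} (h : i' ≠ i)
    (Y : Fin (c i) → ∀ p : M, TangentSpace (𝓡 m) p)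
    (hY : ∀ j, SmoothFieldOn (Y j) Set.univ) (hYt : ∀ j p, Y j p ∈ W.complTangent i p) (q : M) :
    W.coeff (W.wedgeSection i Y hY hYt) e i' q = 0 := by
  rw [coeff, wedgeSection]
  simp only [Pi.single_eq_of_ne h, map_zero]

lemma chartD_coordVec (he : IsSmoothChart e) (i : Fin n) (a : Fin (c i)) {q : M}
    (hq : q ∈ e.source) :
    chartD e q (W.coordVec e i a q) = EuclideanSpace.single (W.emb i a) 1 :=
  he.chartD_chartDInv hq _

lemma smoothFieldOn_coordVec (he : IsSmoothChart e) (i : Fin n) (a : Fin (c i)) :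
    SmoothFieldOn (W.coordVec e i a) e.source :=
  smoothFieldOn_pull he fun _ _ => contDiffAt_const

lemma smoothFormOn_coordForm (he : IsSmoothChart e) (i : Fin n) :
    SmoothFormOn (W.coordForm e i) e.source := by
  intro X hX q hq
  simp_rw [coordForm_apply, Matrix.det_apply', Matrix.of_apply]
  refine ContMDiffAt.contMDiffWithinAt ?_
  have h : ∀ a k, ContMDiffAt (𝓡 m) 𝓘(ℝ, ℝ) ∞ (fun q => chartD e q (X k q) (W.emb i a)) q := by
    intro a k
    have h1 := he.contMDiffAt_comp hq
      (he.contDiffAt_push hq ((smoothFieldOn_iff e.open_source).1 (hX k) q hq))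
    have h2 := (EuclideanSpace.proj (𝕜 := ℝ) (W.emb i a)).contMDiff.contMDiffAt.comp q h1
    refine h2.congr_of_eventuallyEq ?_
    filter_upwards [e.open_source.mem_nhds hq] with r hr
    change _ = (push e (X k) (e r)) (W.emb i a)
    rw [IsSmoothChart.push_apply hr]
  refine contMDiffAt_finsetSum fun σ _ => ?_
  have h2 : ContMDiffAt (𝓡 m) 𝓘(ℝ, ℝ) ∞
      (fun q => ∏ k, chartD e q (X k q) (W.emb i (σ k))) q :=
    contMDiffAt_finsetProd fun k _ => h (σ k) k
  exact contMDiffAt_const.mul h2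

lemma contMDiffAt_coeff (he : IsSmoothChart e) (η : W.detSections) (i : Fin n) {q : M}
    (hq : q ∈ e.source) : ContMDiffAt (𝓡 m) 𝓘(ℝ, ℝ) ∞ (W.coeff η e i) q :=
  (η.2.2 i e.source _ e.open_source (W.smoothFormOn_coordForm he i)).contMDiffAt
    (e.open_source.mem_nhds hq)

variable {W}

lemma IsWebChart.mem_complTangent_iff (he : W.IsWebChart e) {q : M} (hq : q ∈ e.source)
    {i : Fin n} {v : TangentSpace (𝓡 m) q} :
    v ∈ W.complTangent i q ↔ ∀ k, W.idx k ≠ i → chartD e q v k = 0 := by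
  simp only [complTangent, Submodule.mem_iInf, he.mem_tangent_iff q hq]
  constructor
  · exact fun h k hk => h _ hk k (W.mem_block.2 rfl)
  · intro h j hj k hk
    exact h k (by rw [W.mem_block.1 hk]; exact hj)

lemma IsWebChart.coordVec_mem (he : W.IsWebChart e) {q : M} (hq : q ∈ e.source) (i : Fin n)
    (a : Fin (c i)) : W.coordVec e i a q ∈ W.complTangent i q := by
  rw [he.mem_complTangent_iff hq]
  intro k hk
  rw [W.chartD_coordVec he.toIsSmoothChart i a hq, PiLp.single_apply, if_neg]
  rintro rfl
  exact hk (blockIndex_blockEmb c W.sum_codim i a)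

lemma IsWebChart.coordMulti_mem (he : W.IsWebChart e) {q : M} (hq : q ∈ e.source) (i : Fin n) :
    W.coordMulti e i q ∈ W.detFiber i q :=
  ⟨exteriorPower.ιMulti ℝ (c i) fun a => ⟨W.coordVec e i a q, he.coordVec_mem hq i a⟩,
    exteriorPower.map_apply_ιMulti _ _⟩

lemma IsWebChart.eq_sum_coordVec (he : W.IsWebChart e) {q : M} (hq : q ∈ e.source) {i : Fin n}
    {v : TangentSpace (𝓡 m) q} (hv : v ∈ W.complTangent i q) :
    v = ∑ a, chartD e q v (W.emb i a) • W.coordVec e i a q := by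
  have he' := he.toIsSmoothChart
  rw [he.mem_complTangent_iff hq] at hv
  apply he'.chartD_injective hq
  simp only [map_sum, map_smul, W.chartD_coordVec he' i _ hq]
  rw [sum_blockEmb c W.sum_codim i
    fun k => chartD e q v k • EuclideanSpace.single k (1 : ℝ)]
  conv_lhs => rw [← sum_smul_single (chartD e q v)]
  refine Finset.sum_congr rfl fun k _ => ?_
  split_ifs with hk
  · rfl
  · rw [hv k hk, zero_smul]

/-- The vectors are combinations of the c_i coordinate vectors of the block, so their wedge is a
determinant times the coordinate multivector. -/
lemma IsWebChart.ιMulti_eq (he : W.IsWebChart e) {q : M} (hq : q ∈ e.source) {i : Fin n}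
    {v : Fin (c i) → TangentSpace (𝓡 m) q} (hv : ∀ k, v k ∈ W.complTangent i q) :
    exteriorPower.ιMulti ℝ (c i) v =
      (Matrix.of fun a k => chartD e q (v k) (W.emb i a)).det • W.coordMulti e i q := by
  rw [coordMulti, ← alternatingMap_sum_smul]
  congr 1
  funext k
  exact he.eq_sum_coordVec hq (hv k)

/-- The fibre is the line spanned by the coordinate multivector, and pairing with the coordinate
form extracts the coefficient. Being linear, the identity is checked on wedges of vectors of the
complementary tangent space. -/
lemma IsWebChart.eq_smul_coordMulti (he : W.IsWebChart e) {q : M} (hq : q ∈ e.source) {i : Fin n}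
    {w : ⋀[ℝ]^(c i) (TangentSpace (𝓡 m) q)} (hw : w ∈ W.detFiber i q) :
    w = exteriorPower.alternatingMapLinearEquiv (W.coordForm e i q) w • W.coordMulti e i q := by
  obtain ⟨u, rfl⟩ := hw
  have h : exteriorPower.map (c i) (W.complTangent i q).subtype =
      ((exteriorPower.alternatingMapLinearEquiv (W.coordForm e i q)).smulRight
        (W.coordMulti e i q)).comp (exteriorPower.map (c i) (W.complTangent i q).subtype) := by
    apply exteriorPower.linearMap_ext
    ext1 v
    rw [LinearMap.compAlternatingMap_apply, LinearMap.compAlternatingMap_apply,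
      LinearMap.comp_apply, exteriorPower.map_apply_ιMulti, LinearMap.smulRight_apply,
      exteriorPower.alternatingMapLinearEquiv_apply_ιMulti, coordForm_apply]
    exact he.ιMulti_eq hq fun k => (v k).2
  exact congrArg (fun T : (⋀[ℝ]^(c i) (W.complTangent i q)) →ₗ[ℝ] _ => T u) h

lemma IsWebChart.section_eq (he : W.IsWebChart e) {q : M} (hq : q ∈ e.source) (η : W.detSections)
    (i : Fin n) : η.1 q i = W.coeff η e i q • W.coordMulti e i q :=
  he.eq_smul_coordMulti hq (η.2.1 q i)

variable [T2Space M]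

/-- A multivector field with smooth components in web charts is a smooth section. -/
lemma mem_detSections_of_local {η : ∀ p : M, ∀ i : Fin n, ⋀[ℝ]^(c i) (TangentSpace (𝓡 m) p)}
    (h : ∀ p : M, ∃ e : OpenPartialHomeomorph M (Model m), W.IsWebChart e ∧ p ∈ e.source ∧
      ∀ i, ∃ g : M → ℝ, ContMDiffAt (𝓡 m) 𝓘(ℝ, ℝ) ∞ g p ∧
        ∀ᶠ q in 𝓝 p, η q i = g q • W.coordMulti e i q) : η ∈ W.detSections := by
  refine ⟨fun p i => ?_, fun i U β hU hβ p hp => ?_⟩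
  · obtain ⟨e, he, hp, h⟩ := h p
    obtain ⟨g, -, hg⟩ := h i
    rw [hg.self_of_nhds]
    exact Submodule.smul_mem _ _ (he.coordMulti_mem hp i)
  · obtain ⟨e, he, hpe, h⟩ := h p
    obtain ⟨g, hg, hη⟩ := h i
    obtain ⟨χ, hχ, h1, hs⟩ := exists_bump (m := m) (e.open_source.mem_nhds hpe)
    -- The form β lives on U, which need not lie in the chart, so the coordinate fields are first
    -- extended by a cut-off.
    have h2 := (hβ (fun a q => χ q • W.coordVec e i a q) fun a =>
      (smoothFieldOn_bump_smul e.open_source hχ hs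
        (W.smoothFieldOn_coordVec he.toIsSmoothChart i a)).mono (Set.subset_univ _)).contMDiffAt
      (hU.mem_nhds hp)
    refine ContMDiffAt.contMDiffWithinAt ((hg.mul h2).congr_of_eventuallyEq ?_)
    filter_upwards [h1, hη] with q hq1 hq2
    simp only [hq2, map_smul, hq1, one_smul, smul_eq_mul, coordMulti,
      exteriorPower.alternatingMapLinearEquiv_apply_ιMulti, Pi.mul_apply]

end Coefficients

end DivFreeWeb

end WebGeometry

end

noncomputable section

namespace WebGeometry

namespace DivFreeWeb

/-! ### Connections on the determinant bundles and the connection induced in a chart. -/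

section DetConnection

variable {m n : ℕ} {c : Fin n → ℕ} {M : Type*} [TopologicalSpace M] [ChartedSpace (Model m) M]
  [IsManifold (𝓡 m) ∞ M] (W : DivFreeWeb m M c) {e : OpenPartialHomeomorph M (Model m)}

/-- Covariant derivatives of sections of the determinant bundles along a fixed tangent vector. -/
structure IsPointDerivation (p : M) (v : TangentSpace (𝓡 m) p)
    (A : W.detSections → ∀ i : Fin n, ⋀[ℝ]^(c i) (TangentSpace (𝓡 m) p)) : Prop where
  add : ∀ η η', A (η + η') = A η + A η'
  leibniz : ∀ (f : M → ℝ) (hf : ContMDiff (𝓡 m) 𝓘(ℝ, ℝ) ∞ f) (η : W.detSections),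
    A (W.smulSection f hf η) = (mvfderiv (𝓡 m) f p v) • η.1 p + f p • A η

variable {W}

lemma IsPointDerivation.map_sum {p : M} {v : TangentSpace (𝓡 m) p}
    {A : W.detSections → ∀ i : Fin n, ⋀[ℝ]^(c i) (TangentSpace (𝓡 m) p)}
    (hA : W.IsPointDerivation p v A) {ι : Type*} (s : Finset ι) (η : ι → W.detSections) :
    A (∑ i ∈ s, η i) = ∑ i ∈ s, A (η i) := by
  have h0 : A 0 = 0 := by
    have h := hA.add 0 0
    rw [add_zero] at h
    exact left_eq_add.1 h
  exact _root_.map_sum (⟨⟨A, h0⟩, hA.add⟩ : W.detSections →+ _) η s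

omit [IsManifold (𝓡 m) ∞ M] in
lemma mvfderiv_eq_zero_of_eventually_one {χ : M → ℝ} {p : M} (h : ∀ᶠ q in 𝓝 p, χ q = 1)
    (v : TangentSpace (𝓡 m) p) : mvfderiv (𝓡 m) χ p v = 0 := by
  have h1 : χ =ᶠ[𝓝 p] fun _ => (1 : ℝ) := h
  have h2 : mfderiv (𝓡 m) 𝓘(ℝ, ℝ) χ p v = mfderiv (𝓡 m) 𝓘(ℝ, ℝ) (fun _ : M => (1 : ℝ)) p v := by
    rw [h1.mfderiv_eq]
    rfl
  change mfderiv (𝓡 m) 𝓘(ℝ, ℝ) χ p v = 0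
  rw [h2, mfderiv_const]
  rfl

variable [T2Space M]

/-- A covariant derivative is determined by its values on decomposable sections. -/
theorem IsPointDerivation.eq_of_wedgeSection {p : M} {v : TangentSpace (𝓡 m) p}
    {A B : W.detSections → ∀ i : Fin n, ⋀[ℝ]^(c i) (TangentSpace (𝓡 m) p)}
    (hA : W.IsPointDerivation p v A) (hB : W.IsPointDerivation p v B)
    (h : ∀ (i : Fin n) (Y : Fin (c i) → ∀ p : M, TangentSpace (𝓡 m) p)
      (hY : ∀ j, SmoothFieldOn (Y j) Set.univ) (hYt : ∀ j p, Y j p ∈ W.complTangent i p),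
      A (W.wedgeSection i Y hY hYt) = B (W.wedgeSection i Y hY hYt)) : A = B := by
  funext η
  obtain ⟨e, he, hpe, -⟩ := W.exists_webChart p
  have he' := he.toIsSmoothChart
  obtain ⟨χ, hχ, hχ1, hχs⟩ := exists_bump (m := m) (e.open_source.mem_nhds hpe)
  have hU : {q | χ q = 1} ∩ e.source ∈ 𝓝 p :=
    Filter.inter_mem hχ1 (e.open_source.mem_nhds hpe)
  -- Two cut-offs are needed: χ makes the coordinate fields global, and ψ is supported where χ = 1,
  -- so that ψη is globally a combination of wedges of the fields cut off by χ.
  obtain ⟨ψ, hψ, hψ1, hψs⟩ := exists_bump (m := m) hU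
  have hsrc : ∀ q, χ q ≠ 0 → q ∈ e.source := fun q hq => hχs (subset_tsupport χ hq)
  have hY : ∀ i a, SmoothFieldOn (fun q => χ q • W.coordVec e i a q) Set.univ := fun i a =>
    smoothFieldOn_bump_smul e.open_source hχ hχs (W.smoothFieldOn_coordVec he' i a)
  have hYt : ∀ i a q, χ q • W.coordVec e i a q ∈ W.complTangent i q := by
    intro i a q
    by_cases hq : χ q = 0
    · rw [hq, zero_smul]
      exact Submodule.zero_mem _
    · exact Submodule.smul_mem _ _ (he.coordVec_mem (hsrc q hq) i a)
  let ζ : Fin n → W.detSections := fun i =>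
    W.wedgeSection i (fun a q => χ q • W.coordVec e i a q) (hY i) (hYt i)
  have hg : ∀ i, ContMDiff (𝓡 m) 𝓘(ℝ, ℝ) ∞ (fun q => ψ q * W.coeff η e i q) := fun i =>
    contMDiff_bump_mul hψ (hψs.trans Set.inter_subset_right)
      fun q hq => W.contMDiffAt_coeff he' η i hq
  have hsum : W.smulSection ψ hψ η = ∑ i, W.smulSection _ (hg i) (ζ i) := by
    apply Subtype.ext
    funext q i
    rw [AddSubmonoidClass.coe_finsetSum, Finset.sum_apply, Finset.sum_apply,
      Finset.sum_eq_single_of_mem i (Finset.mem_univ _)]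
    · change ψ q • η.1 q i = (ψ q * W.coeff η e i q) • (ζ i).1 q i
      by_cases hq : ψ q = 0
      · rw [hq, zero_smul, zero_mul, zero_smul]
      · have hq' := hψs (subset_tsupport ψ hq)
        have hζ : (ζ i).1 q i = W.coordMulti e i q := by
          change Pi.single (M := fun i => ⋀[ℝ]^(c i) (TangentSpace (𝓡 m) q)) i _ i = _
          rw [Pi.single_eq_same, coordMulti]
          congr 1
          funext a
          change χ q • _ = _
          rw [show χ q = 1 from hq'.1, one_smul]
        rw [hζ, he.section_eq hq'.2 η i, mul_smul]
    · intro j _ hj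
      change (ψ q * W.coeff η e j q) • (ζ j).1 q i = 0
      change _ • Pi.single (M := fun i => ⋀[ℝ]^(c i) (TangentSpace (𝓡 m) q)) j _ i = _
      rw [Pi.single_eq_of_ne hj.symm, smul_zero]
  -- Since ψ = 1 near p, the Leibniz rule gives the same value on η as on ψη. Expanding the latter
  -- leaves only values on decomposable sections.
  have hloc : ∀ A : W.detSections → ∀ i : Fin n, ⋀[ℝ]^(c i) (TangentSpace (𝓡 m) p),
      W.IsPointDerivation p v A → A η = ∑ i,
        ((mvfderiv (𝓡 m) (fun q => ψ q * W.coeff η e i q) p v) • (ζ i).1 p +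
          (ψ p * W.coeff η e i p) • A (ζ i)) := by
    intro A hA
    have h1 := hA.leibniz ψ hψ η
    rw [mvfderiv_eq_zero_of_eventually_one hψ1, zero_smul, zero_add, hψ1.self_of_nhds, one_smul,
      hsum, hA.map_sum] at h1
    rw [← h1]
    exact Finset.sum_congr rfl fun i _ => hA.leibniz _ (hg i) (ζ i)
  rw [hloc A hA, hloc B hB]
  refine Finset.sum_congr rfl fun i _ => ?_
  rw [h]

variable (W) in
/-- The natural connection on the determinant bundles in a web chart. -/
def chartDet (e : OpenPartialHomeomorph M (Model m)) (η : W.detSections) (p : M) :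
    TangentSpace (𝓡 m) p →ₗ[ℝ] (∀ i : Fin n, ⋀[ℝ]^(c i) (TangentSpace (𝓡 m) p)) :=
  LinearMap.pi fun i => LinearMap.smulRight
    (mvfderiv (𝓡 m) (W.coeff η e i) p + W.coeff η e i p •
      (fderiv ℝ (W.logDensity e) (e p)).comp ((W.proj i).comp (chartD e p))).toLinearMap
    (W.coordMulti e i p)

omit [T2Space M] in
lemma chartDet_apply (η : W.detSections) (p : M) (v : TangentSpace (𝓡 m) p) (i : Fin n) :
    W.chartDet e η p v i = (mvfderiv (𝓡 m) (W.coeff η e i) p v + W.coeff η e i p *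
      fderiv ℝ (W.logDensity e) (e p) (W.proj i (chartD e p v))) • W.coordMulti e i p :=
  rfl

omit [T2Space M] in
lemma mdifferentiableAt_coeff (he : IsSmoothChart e) (η : W.detSections) (i : Fin n) {p : M}
    (hp : p ∈ e.source) : MDifferentiableAt (𝓡 m) 𝓘(ℝ, ℝ) (W.coeff η e i) p :=
  (W.contMDiffAt_coeff he η i hp).mdifferentiableAt (by simp)

omit [T2Space M] in
lemma chartDet_add (he : IsSmoothChart e) {p : M} (hp : p ∈ e.source) (η η' : W.detSections)
    (v : TangentSpace (𝓡 m) p) :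
    W.chartDet e (η + η') p v = W.chartDet e η p v + W.chartDet e η' p v := by
  funext i
  have h : W.coeff (η + η') e i = W.coeff η e i + W.coeff η' e i :=
    funext fun q => W.coeff_add η η' i q
  rw [Pi.add_apply, chartDet_apply, chartDet_apply, chartDet_apply, h,
    mvfderiv_add (mdifferentiableAt_coeff he η i hp) (mdifferentiableAt_coeff he η' i hp),
    ← add_smul, _root_.add_apply, Pi.add_apply]
  congr 1
  ring

omit [T2Space M] in
lemma chartDet_smulSection (he : W.IsWebChart e) {p : M} (hp : p ∈ e.source) (f : M → ℝ)
    (hf : ContMDiff (𝓡 m) 𝓘(ℝ, ℝ) ∞ f) (η : W.detSections) (v : TangentSpace (𝓡 m) p) :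
    W.chartDet e (W.smulSection f hf η) p v =
      (mvfderiv (𝓡 m) f p v) • η.1 p + f p • W.chartDet e η p v := by
  funext i
  have h : W.coeff (W.smulSection f hf η) e i = f * W.coeff η e i :=
    funext fun q => W.coeff_smulSection f hf η i q
  rw [Pi.add_apply, Pi.smul_apply, Pi.smul_apply, chartDet_apply, chartDet_apply, h,
    mvfderiv_mul ((hf p).mdifferentiableAt (by simp))
      (mdifferentiableAt_coeff he.toIsSmoothChart η i hp), he.section_eq hp η i,
    smul_smul, smul_smul, ← add_smul, _root_.add_apply, _root_.smul_apply, _root_.smul_apply,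
    Pi.mul_apply, smul_eq_mul, smul_eq_mul]
  congr 1
  ring

omit [T2Space M] in
lemma isPointDerivation_chartDet (he : W.IsWebChart e) {p : M} (hp : p ∈ e.source)
    (v : TangentSpace (𝓡 m) p) : W.IsPointDerivation p v fun η => W.chartDet e η p v where
  add η η' := chartDet_add he.toIsSmoothChart hp η η' v
  leibniz f hf η := chartDet_smulSection he hp f hf η v

/-- The connection induced on the determinant bundles by a web connection, in a web chart. -/
theorem IsWebConnection.chartDet_wedgeSection (hm : 0 < m)
    {Θ : CovariantDerivative (𝓡 m) (Model m) (TangentSpace (𝓡 m) : M → Type _)}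
    (hΘ : W.IsWebConnection Θ) (he : W.IsWebChart e) {p : M} (hp : p ∈ e.source) (i : Fin n)
    (Y : Fin (c i) → ∀ p : M, TangentSpace (𝓡 m) p)
    (hY : ∀ j, SmoothFieldOn (Y j) Set.univ) (hYt : ∀ j p, Y j p ∈ W.complTangent i p)
    (v : TangentSpace (𝓡 m) p) :
    W.chartDet e (W.wedgeSection i Y hY hYt) p v =
      Pi.single (M := fun i => ⋀[ℝ]^(c i) (TangentSpace (𝓡 m) p)) i
        (∑ k, exteriorPower.ιMulti ℝ (c i)
          (Function.update (fun j => Y j p) k (Θ (Y k) p v))) := by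
  have he' := he.toIsSmoothChart
  obtain ⟨Γ, hΓ, hblock, htr⟩ := hΘ.exists_christoffel hm he hp
  funext i'
  by_cases hi : i' = i
  swap
  · rw [Pi.single_eq_of_ne hi, chartDet_apply]
    have h : W.coeff (W.wedgeSection i Y hY hYt) e i' = fun _ => 0 :=
      funext fun q => W.coeff_wedgeSection_of_ne hi Y hY hYt q
    rw [h, mvfderiv_const]
    simp
  subst hi
  rw [Pi.single_eq_same, chartDet_apply]
  set w := chartD e p v with hw
  let N : Model m → Matrix (Fin (c i')) (Fin (c i')) ℝ := fun x =>
    Matrix.of fun a k => push e (Y k) x (W.emb i' a)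
  have hYd : ∀ k, MDifferentiableAt (𝓡 m) (𝓡 m).tangent
      (fun p => (⟨p, Y k p⟩ : TangentBundle (𝓡 m) M)) p := fun k =>
    (smoothFieldOn_univ_iff.1 (hY k) p).mdifferentiableAt (by simp)
  have hd : ∀ k, DifferentiableAt ℝ (push e (Y k)) (e p) := fun k =>
    he'.differentiableAt_push hp (hYd k)
  obtain ⟨L, hL, hLv⟩ := hasFDerivAt_det (u := N) (x := e p)
    (u' := fun a k => (EuclideanSpace.proj (𝕜 := ℝ) (W.emb i' a)).comp
      (fderiv ℝ (push e (Y k)) (e p)))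
    (fun a k => (EuclideanSpace.proj (𝕜 := ℝ) (W.emb i' a)).hasFDerivAt.comp (e p)
      (hd k).hasFDerivAt)
  -- The component of the wedge is the determinant of the block components of the Y_k, so its
  -- derivative is given by Jacobi's formula.
  have hcomp : W.coeff (W.wedgeSection i' Y hY hYt) e i' ∘ e.symm = fun y => (N y).det :=
    funext fun y => W.coeff_wedgeSection i' Y hY hYt (e.symm y)
  have hderiv : mvfderiv (𝓡 m) (W.coeff (W.wedgeSection i' Y hY hYt) e i') p v = L w := by
    rw [he'.mvfderiv_eq hp (mdifferentiableAt_coeff he' _ i' hp), hcomp, hL.fderiv]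
  have hcoeff : W.coeff (W.wedgeSection i' Y hY hYt) e i' p = (N (e p)).det := by
    rw [← congrFun hcomp (e p), Function.comp_apply, e.left_inv hp]
  have hpush0 : ∀ k l, W.idx l ≠ i' → ∀ᶠ y in 𝓝 (e p), push e (Y k) y l = 0 := by
    intro k l hl
    filter_upwards [e.open_target.mem_nhds (e.map_source hp)] with y hy
    exact (he.mem_complTangent_iff (e.map_target hy)).1 (hYt k _) l hl
  -- Web connections preserve the complementary distribution, which keeps each term of the sum a
  -- multiple of the coordinate multivector.
  have hΘmem : ∀ k, Θ (Y k) p v ∈ W.complTangent i' p := by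
    intro k
    rw [he.mem_complTangent_iff hp]
    intro l hl
    rw [hΓ _ (hYd k), PiLp.add_apply, fderiv_coord_eq_zero (hd k) (hpush0 k l hl), zero_add]
    exact hblock _ _ i' ((he.mem_complTangent_iff hp).1 (hYt k p)) l hl
  let A' : Matrix (Fin (c i')) (Fin (c i')) ℝ := Matrix.of fun a b =>
    Γ w (EuclideanSpace.single (W.emb i' b) 1) (W.emb i' a)
  have hA : ∀ k a, Γ w (chartD e p (Y k p)) (W.emb i' a) = A'.mulVec (fun b => N (e p) b k) a := by
    intro k a
    conv_lhs => rw [he.eq_sum_coordVec hp (hYt k p)]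
    simp only [_root_.map_sum, map_smul, W.chartD_coordVec he' i' _ hp, WithLp.ofLp_sum,
      Finset.sum_apply, WithLp.ofLp_smul, Pi.smul_apply, smul_eq_mul, Matrix.mulVec, dotProduct,
      A', Matrix.of_apply, N, IsSmoothChart.push_apply hp]
    exact Finset.sum_congr rfl fun b _ => mul_comm _ _
  have hterm : ∀ k, exteriorPower.ιMulti ℝ (c i')
      (Function.update (fun j => Y j p) k (Θ (Y k) p v)) =
      (((N (e p)).updateCol k fun a => (EuclideanSpace.proj (𝕜 := ℝ) (W.emb i' a)).comp
        (fderiv ℝ (push e (Y k)) (e p)) w).det +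
      ((N (e p)).updateCol k (A'.mulVec fun b => N (e p) b k)).det) • W.coordMulti e i' p := by
    intro k
    rw [he.ιMulti_eq hp, ← Matrix.det_updateCol_add]
    · congr 2
      ext a l
      by_cases hl : l = k
      · subst hl
        simp only [Matrix.of_apply, Function.update_self, Matrix.updateCol_self, Pi.add_apply]
        rw [hΓ _ (hYd l), PiLp.add_apply, hA]
        rfl
      · simp [hl, N, IsSmoothChart.push_apply hp]
    · intro l
      by_cases hl : l = k
      · subst hl
        rw [Function.update_self]
        exact hΘmem l
      · rw [Function.update_of_ne hl]
        exact hYt l p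
  have htrace : A'.trace = fderiv ℝ (W.logDensity e) (e p) (W.proj i' w) := htr i' w
  -- The derivative parts sum to the derivative of the determinant, and the Γ parts to the block
  -- trace times the determinant.
  simp_rw [hterm, ← Finset.sum_smul, Finset.sum_add_distrib, ← hLv, sum_det_updateCol]
  rw [hderiv, hcoeff, htrace, mul_comm (N (e p)).det]

end DetConnection

end DivFreeWeb

end WebGeometry

end

noncomputable section

namespace WebGeometry

namespace DivFreeWeb

/-! ### The natural connection and its independence of the web connection. -/

section NaturalConnection

variable {m n : ℕ} {c : Fin n → ℕ} {M : Type*} [TopologicalSpace M] [ChartedSpace (Model m) M]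
  [IsManifold (𝓡 m) ∞ M] {W : DivFreeWeb m M c} {e : OpenPartialHomeomorph M (Model m)}

/-- The coordinate expression of the component of a covariant derivative. -/
def derivCoord (W : DivFreeWeb m M c) (e : OpenPartialHomeomorph M (Model m)) (i : Fin n)
    (g : Model m → ℝ) (V : Model m → Model m) (x : Model m) : ℝ :=
  fderiv ℝ g x (V x) + g x * fderiv ℝ (W.logDensity e) x (W.proj i (V x))

lemma chartDet_eq_derivCoord (he : IsSmoothChart e) {p : M} (hp : p ∈ e.source)
    (η : W.detSections) (X : ∀ p : M, TangentSpace (𝓡 m) p) (i : Fin n) :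
    W.chartDet e η p (X p) i =
      W.derivCoord e i (W.coeff η e i ∘ e.symm) (push e X) (e p) • W.coordMulti e i p := by
  rw [chartDet_apply, derivCoord, he.mvfderiv_eq hp (mdifferentiableAt_coeff he η i hp),
    IsSmoothChart.push_apply hp, Function.comp_apply, e.left_inv hp]

variable [T2Space M]

lemma contDiffAt_derivCoord (he : IsSmoothChart e) {x : Model m} (hx : x ∈ e.target) (i : Fin n)
    {g : Model m → ℝ} (hg : ContDiffAt ℝ ∞ g x) {V : Model m → Model m}
    (hV : ContDiffAt ℝ ∞ V x) : ContDiffAt ℝ ∞ (W.derivCoord e i g V) x := by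
  have h1 : ContDiffAt ℝ ∞ (fun y => W.proj i (V y)) x :=
    (W.proj i).contDiff.contDiffAt.comp x hV
  exact ((hg.fderiv_right (m := ∞) (by simp)).clm_apply hV).add
    (hg.mul (((W.contDiffAt_logDensity he hx).fderiv_right (m := ∞) (by simp)).clm_apply h1))

variable [SecondCountableTopology M]

/-- On wedge sections both formulas give the action of any one web connection, and wedge sections
determine a derivation; no transformation law for the density is required. -/
lemma chartDet_eq (hm : 0 < m) {e' : OpenPartialHomeomorph M (Model m)} (he : W.IsWebChart e)
    (he' : W.IsWebChart e') {p : M} (hp : p ∈ e.source) (hp' : p ∈ e'.source)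
    (η : W.detSections) : W.chartDet e η p = W.chartDet e' η p := by
  obtain ⟨Θ, hΘ⟩ := W.exists_isWebConnection
  refine LinearMap.ext fun v => ?_
  have h := (isPointDerivation_chartDet he hp v).eq_of_wedgeSection
    (isPointDerivation_chartDet he' hp' v) fun i Y hY hYt => by
      rw [hΘ.chartDet_wedgeSection hm he hp i Y hY hYt v,
        hΘ.chartDet_wedgeSection hm he' hp' i Y hY hYt v]
  exact congrFun h η

variable (W) in
/-- The natural connection of a divergence-free web on the sum of its determinant bundles. -/
def naturalConnection (hm : 0 < m) : W.DetConnection where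
  toFun η p := W.chartDet (W.exists_webChart p).choose η p
  smooth X hX η := by
    refine mem_detSections_of_local fun p => ?_
    obtain ⟨he, hp, -⟩ := (W.exists_webChart p).choose_spec
    set e := (W.exists_webChart p).choose
    have he' := he.toIsSmoothChart
    refine ⟨e, he, hp, fun i => ⟨fun q =>
      W.derivCoord e i (W.coeff η e i ∘ e.symm) (push e X) (e q), ?_, ?_⟩⟩
    · exact he'.contMDiffAt_comp hp (contDiffAt_derivCoord he' (e.map_source hp) i
        (he'.contDiffAt_comp_symm hp (W.contMDiffAt_coeff he' η i hp))
        (he'.contDiffAt_push hp (smoothFieldOn_univ_iff.1 hX p)))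
    · filter_upwards [e.open_source.mem_nhds hp] with q hq
      obtain ⟨hq1, hq2, -⟩ := (W.exists_webChart q).choose_spec
      rw [chartDet_eq hm hq1 he hq2 hq]
      exact chartDet_eq_derivCoord he' hq η X i
  add η η' p := by
    obtain ⟨he, hp, -⟩ := (W.exists_webChart p).choose_spec
    exact LinearMap.ext fun v => chartDet_add he.toIsSmoothChart hp η η' v
  leibniz f hf η p v := by
    obtain ⟨he, hp, -⟩ := (W.exists_webChart p).choose_spec
    exact chartDet_smulSection he hp f hf η v

lemma naturalConnection_eq (hm : 0 < m) (he : W.IsWebChart e) {p : M} (hp : p ∈ e.source)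
    (η : W.detSections) : (W.naturalConnection hm).toFun η p = W.chartDet e η p := by
  obtain ⟨he', hp', -⟩ := (W.exists_webChart p).choose_spec
  exact chartDet_eq hm he' he hp' hp η

omit [T2Space M] [SecondCountableTopology M] in
lemma DetConnection.isPointDerivation (D : W.DetConnection) (p : M) (v : TangentSpace (𝓡 m) p) :
    W.IsPointDerivation p v fun η => D.toFun η p v where
  add η η' := by rw [D.add]; rfl
  leibniz f hf η := D.leibniz f hf η p v

/-- The chart formula shows that every web connection induces the natural connection; uniqueness
holds because a connection is determined by its values on wedge sections. -/
theorem isInducedBy_iff (hm : 0 < m)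
    {Θ : CovariantDerivative (𝓡 m) (Model m) (TangentSpace (𝓡 m) : M → Type _)}
    (hΘ : W.IsWebConnection Θ) (D : W.DetConnection) :
    D.IsInducedBy Θ ↔ D = W.naturalConnection hm := by
  have hnat : (W.naturalConnection hm).IsInducedBy Θ := by
    intro i Y hY hYt p v
    obtain ⟨e, he, hp, -⟩ := W.exists_webChart p
    rw [naturalConnection_eq hm he hp]
    exact hΘ.chartDet_wedgeSection hm he hp i Y hY hYt v
  constructor
  · intro hD
    apply DetConnection.ext
    funext η p
    refine LinearMap.ext fun v => ?_
    have h := (D.isPointDerivation p v).eq_of_wedgeSection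
      ((W.naturalConnection hm).isPointDerivation p v) fun i Y hY hYt => by
        rw [hD i Y hY hYt p v, hnat i Y hY hYt p v]
    exact congrFun h η
  · rintro rfl
    exact hnat

end NaturalConnection

/-! ### The curvature of the natural connection. -/

section Curvature

variable {m n : ℕ} {c : Fin n → ℕ} {M : Type*} [TopologicalSpace M] [ChartedSpace (Model m) M]
  [IsManifold (𝓡 m) ∞ M] {W : DivFreeWeb m M c} {e : OpenPartialHomeomorph M (Model m)}

lemma alternatingMapLinearEquiv_coordMulti (he : IsSmoothChart e) {q : M} (hq : q ∈ e.source)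
    (i : Fin n) :
    exteriorPower.alternatingMapLinearEquiv (W.coordForm e i q) (W.coordMulti e i q) = 1 := by
  rw [coordMulti, exteriorPower.alternatingMapLinearEquiv_apply_ιMulti, coordForm_apply]
  have h : (Matrix.of fun a k => chartD e q (W.coordVec e i k q) (W.emb i a)) =
      (1 : Matrix (Fin (c i)) (Fin (c i)) ℝ) := by
    ext a k
    rw [Matrix.of_apply, W.chartD_coordVec he i k hq, PiLp.single_apply, Matrix.one_apply]
    simp
  rw [h, Matrix.det_one]

variable [T2Space M]

/-- On a line bundle the curvature of d + α is dα, here with α = df∘P_i. The second derivatives of g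
cancel by symmetry, and the quadratic terms in α because scalars commute. -/
lemma derivCoord_comm (he : IsSmoothChart e) {x : Model m} (hx : x ∈ e.target) (i : Fin n)
    {g : Model m → ℝ} (hg : ContDiffAt ℝ ∞ g x) {V V' : Model m → Model m}
    (hV : ContDiffAt ℝ ∞ V x) (hV' : ContDiffAt ℝ ∞ V' x) :
    W.derivCoord e i (W.derivCoord e i g V') V x - W.derivCoord e i (W.derivCoord e i g V) V' x -
      (fderiv ℝ g x (fderiv ℝ V' x (V x) - fderiv ℝ V x (V' x)) +
        g x * fderiv ℝ (W.logDensity e) x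
          (W.proj i (fderiv ℝ V' x (V x) - fderiv ℝ V x (V' x)))) =
      g x * (fderiv ℝ (fderiv ℝ (W.logDensity e)) x (V x) (W.proj i (V' x)) -
        fderiv ℝ (fderiv ℝ (W.logDensity e)) x (V' x) (W.proj i (V x))) := by
  have hf := W.contDiffAt_logDensity he hx
  have hg' := ((hg.fderiv_right (m := ∞) (by simp)).differentiableAt (by simp)).hasFDerivAt
  have hf' := ((hf.fderiv_right (m := ∞) (by simp)).differentiableAt (by simp)).hasFDerivAt
  have hg0 := (hg.differentiableAt (by simp)).hasFDerivAt
  have hderiv : ∀ {V : Model m → Model m}, ContDiffAt ℝ ∞ V x → ∀ w,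
      fderiv ℝ (W.derivCoord e i g V) x w =
        fderiv ℝ (fderiv ℝ g) x w (V x) + fderiv ℝ g x (fderiv ℝ V x w) +
        (fderiv ℝ g x w * fderiv ℝ (W.logDensity e) x (W.proj i (V x)) +
        g x * (fderiv ℝ (fderiv ℝ (W.logDensity e)) x w (W.proj i (V x)) +
          fderiv ℝ (W.logDensity e) x (W.proj i (fderiv ℝ V x w)))) := by
    intro V hV w
    have hV0 := (hV.differentiableAt (by simp)).hasFDerivAt
    have hPV := (W.proj i).hasFDerivAt.comp x hV0
    have h := ((hg'.clm_apply hV0).add (hg0.mul (hf'.clm_apply hPV))).fderiv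
    have h2 : fderiv ℝ (W.derivCoord e i g V) x = _ := h
    rw [h2]
    simp
    ring
  have hsymm : fderiv ℝ (fderiv ℝ g) x (V x) (V' x) = fderiv ℝ (fderiv ℝ g) x (V' x) (V x) :=
    (hg.isSymmSndFDerivAt
      (by rw [minSmoothness_of_isRCLikeNormedField]; exact ENat.LEInfty.out)).eq _ _
  have h : ∀ g V, W.derivCoord e i g V x =
      fderiv ℝ g x (V x) + g x * fderiv ℝ (W.logDensity e) x (W.proj i (V x)) := fun _ _ => rfl
  rw [h (W.derivCoord e i g V'), h (W.derivCoord e i g V), hderiv hV, hderiv hV', h, h, hsymm]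
  simp only [map_sub]
  ring

variable [SecondCountableTopology M]

/-- The curvature of the natural connection in a web chart. -/
theorem curvature_naturalConnection (hm : 0 < m) (he : W.IsWebChart e) {p : M}
    (hp : p ∈ e.source) {X Y : ∀ p : M, TangentSpace (𝓡 m) p} (hX : SmoothFieldOn X Set.univ)
    (hY : SmoothFieldOn Y Set.univ) (η : W.detSections) (i : Fin n) :
    ((W.naturalConnection hm).toFun ((W.naturalConnection hm).deriv Y hY η) p (X p) -
      (W.naturalConnection hm).toFun ((W.naturalConnection hm).deriv X hX η) p (Y p) -
      (W.naturalConnection hm).toFun η p (VectorField.mlieBracket (𝓡 m) X Y p)) i =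
    (W.coeff η e i p * (fderiv ℝ (fderiv ℝ (W.logDensity e)) (e p) (chartD e p (X p))
        (W.proj i (chartD e p (Y p))) -
      fderiv ℝ (fderiv ℝ (W.logDensity e)) (e p) (chartD e p (Y p))
        (W.proj i (chartD e p (X p))))) • W.coordMulti e i p := by
  have he' := he.toIsSmoothChart
  have hXp := smoothFieldOn_univ_iff.1 hX p
  have hYp := smoothFieldOn_univ_iff.1 hY p
  have hX' := he'.contDiffAt_push hp hXp
  have hY' := he'.contDiffAt_push hp hYp
  have hcoeff : ∀ {Z : ∀ p : M, TangentSpace (𝓡 m) p} (hZ : SmoothFieldOn Z Set.univ),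
      W.coeff ((W.naturalConnection hm).deriv Z hZ η) e i ∘ e.symm =ᶠ[𝓝 (e p)]
        W.derivCoord e i (W.coeff η e i ∘ e.symm) (push e Z) := by
    intro Z hZ
    filter_upwards [e.open_target.mem_nhds (e.map_source hp)] with y hy
    have h1 : ((W.naturalConnection hm).deriv Z hZ η).1 (e.symm y) i =
        W.derivCoord e i (W.coeff η e i ∘ e.symm) (push e Z) y •
          W.coordMulti e i (e.symm y) := by
      have h2 := chartDet_eq_derivCoord he' (e.map_target hy) η Z i
      rw [e.right_inv hy, ← naturalConnection_eq hm he (e.map_target hy)] at h2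
      exact h2
    rw [Function.comp_apply, coeff, h1, map_smul,
      alternatingMapLinearEquiv_coordMulti he' (e.map_target hy), smul_eq_mul, mul_one]
  have hD : ∀ {Z : ∀ p : M, TangentSpace (𝓡 m) p} (hZ : SmoothFieldOn Z Set.univ)
      (V : ∀ p : M, TangentSpace (𝓡 m) p),
      (W.naturalConnection hm).toFun ((W.naturalConnection hm).deriv Z hZ η) p (V p) i =
        W.derivCoord e i (W.derivCoord e i (W.coeff η e i ∘ e.symm) (push e Z)) (push e V) (e p) •
          W.coordMulti e i p := by
    intro Z hZ V
    rw [naturalConnection_eq hm he hp, chartDet_eq_derivCoord he' hp, derivCoord, derivCoord,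
      (hcoeff hZ).fderiv_eq, (hcoeff hZ).self_of_nhds]
  have hg := he'.contDiffAt_comp_symm hp (W.contMDiffAt_coeff he' η i hp)
  have hcomm := derivCoord_comm (W := W) he' (e.map_source hp) i hg hX' hY'
  rw [Pi.sub_apply, Pi.sub_apply, hD hY X, hD hX Y, naturalConnection_eq hm he hp,
    chartDet_apply, he'.mvfderiv_eq hp (mdifferentiableAt_coeff he' η i hp),
    he'.mlieBracket_eq hp (hXp.mdifferentiableAt (by simp)) (hYp.mdifferentiableAt (by simp))]
  simp only [IsSmoothChart.push_apply hp, Function.comp_apply, e.left_inv hp] at hcomm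
  have key : ∀ {V : Type _} [AddCommGroup V] [Module ℝ V] (w : V) (r s t : ℝ),
      r • w - s • w - t • w = (r - s - t) • w := fun w r s t => by rw [sub_smul, sub_smul]
  rw [← hcomm]
  exact key _ _ _ _

lemma naturalConnection_flat_of (hm : 0 < m)
    (h : ∀ p : M, ∃ e : OpenPartialHomeomorph M (Model m), W.IsWebChart e ∧ p ∈ e.source ∧
      ∀ i a b, fderiv ℝ (fderiv ℝ (W.logDensity e)) (e p) a (W.proj i b) =
        fderiv ℝ (fderiv ℝ (W.logDensity e)) (e p) b (W.proj i a)) :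
    (W.naturalConnection hm).Flat := by
  intro X Y hX hY η p
  obtain ⟨e, he, hp, h⟩ := h p
  funext i
  rw [curvature_naturalConnection hm he hp, h, sub_self, mul_zero, zero_smul]
  rfl

/-- The curvature formula is evaluated on cut-off constant coordinate fields and on a section whose
component at p is 1. -/
lemma hessian_of_naturalConnection_flat (hm : 0 < m) (hflat : (W.naturalConnection hm).Flat)
    (he : W.IsWebChart e) {p : M} (hp : p ∈ e.source) (i : Fin n) (a b : Model m) :
    fderiv ℝ (fderiv ℝ (W.logDensity e)) (e p) a (W.proj i b) =
      fderiv ℝ (fderiv ℝ (W.logDensity e)) (e p) b (W.proj i a) := by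
  have he' := he.toIsSmoothChart
  obtain ⟨χ, hχ, hχ1, hχs⟩ := exists_bump (m := m) (e.open_source.mem_nhds hp)
  have hconst : ∀ a : Model m, SmoothFieldOn (fun q => χ q • pull e (fun _ => a) q) Set.univ :=
    fun a => smoothFieldOn_bump_smul e.open_source hχ hχs
      (smoothFieldOn_pull he' fun _ _ => contDiffAt_const)
  have hval : ∀ a : Model m, chartD e p (χ p • pull e (fun _ => a) p) = a := by
    intro a
    rw [hχ1.self_of_nhds, one_smul]
    exact he'.chartD_chartDInv hp a
  have hYt : ∀ k q, χ q • W.coordVec e i k q ∈ W.complTangent i q := by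
    intro k q
    by_cases hq : χ q = 0
    · rw [hq, zero_smul]
      exact Submodule.zero_mem _
    · exact Submodule.smul_mem _ _ (he.coordVec_mem (hχs (subset_tsupport χ hq)) i k)
  let ζ := W.wedgeSection i (fun k q => χ q • W.coordVec e i k q) (fun k => hconst _) hYt
  have hζ : W.coeff ζ e i p = 1 := by
    have h3 : (Matrix.of fun a k => chartD e p (χ p • W.coordVec e i k p) (W.emb i a)) =
        (1 : Matrix (Fin (c i)) (Fin (c i)) ℝ) := by
      ext a k
      have h4 : chartD e p (χ p • W.coordVec e i k p) = EuclideanSpace.single (W.emb i k) 1 :=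
        hval _
      rw [Matrix.of_apply, h4, PiLp.single_apply, Matrix.one_apply]
      simp
    refine (W.coeff_wedgeSection i _ _ hYt p).trans ?_
    rw [h3, Matrix.det_one]
  have h1 := (curvature_naturalConnection hm he hp (hconst a) (hconst b) ζ i).symm.trans
    (congrFun (hflat _ _ (hconst a) (hconst b) ζ p) i)
  simp only [hζ, one_mul, hval] at h1
  have h2 := congrArg (exteriorPower.alternatingMapLinearEquiv (W.coordForm e i p)) h1
  rw [map_smul, alternatingMapLinearEquiv_coordMulti he' hp, smul_eq_mul, mul_one] at h2
  refine sub_eq_zero.1 (h2.trans ?_)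
  exact map_zero _

end Curvature

end DivFreeWeb

end WebGeometry

end

noncomputable section

namespace WebGeometry

/-! ### Leaves, and curves inside them. -/

section Leaves

variable {m : ℕ} {M : Type*} [TopologicalSpace M] [ChartedSpace (Model m) M]
  {e : OpenPartialHomeomorph M (Model m)}

lemma IsSmoothChart.hasDerivAt_comp (he : IsSmoothChart e) {γ : ℝ → M} {t : ℝ}
    (hγ : MDifferentiableAt 𝓘(ℝ, ℝ) (𝓡 m) γ t) (ht : γ t ∈ e.source) :
    HasDerivAt (fun s => e (γ s))
      (chartD e (γ t) (mfderiv 𝓘(ℝ, ℝ) (𝓡 m) γ t (1 : ℝ))) t := by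
  have h1 := ((he.contMDiffAt ht).mdifferentiableAt (by simp)).hasMFDerivAt.comp t hγ.hasMFDerivAt
  have h2 : HasFDerivAt (𝕜 := ℝ) (E := ℝ) (F := Model m) (fun s => e (γ s))
      ((chartD e (γ t)).comp (mfderiv 𝓘(ℝ, ℝ) (𝓡 m) γ t)) t := h1.hasFDerivAt
  exact h2.hasDerivAt

lemma Foliation.Joined.map {N : Type*} [TopologicalSpace N] [ChartedSpace (Model m) N] {c c' : ℕ}
    {F : Foliation m M c} {F' : Foliation m N c'} {U : Set M} {U' : Set N} (hU : IsOpen U)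
    {φ : M → N} (hφ : ContMDiffOn (𝓡 m) (𝓡 m) ∞ φ U) (hmaps : Set.MapsTo φ U U')
    (htan : ∀ q ∈ U, ∀ v ∈ F.tangent q, mfderiv (𝓡 m) (𝓡 m) φ q v ∈ F'.tangent (φ q))
    {p q : M} (h : F.Joined U p q) : F'.Joined U' (φ p) (φ q) := by
  obtain ⟨γ, hγ, h0, h1, ht⟩ := h
  have hφγ : ∀ t, ContMDiffAt (𝓡 m) (𝓡 m) ∞ φ (γ t) := fun t =>
    hφ.contMDiffAt (hU.mem_nhds (ht t).1)
  refine ⟨φ ∘ γ, fun t => (hφγ t).comp t (hγ t), congrArg φ h0, congrArg φ h1, fun t =>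
    ⟨hmaps (ht t).1, ?_⟩⟩
  rw [mfderiv_comp (I' := 𝓡 m) t ((hφγ t).mdifferentiableAt (by simp))
    ((hγ t).mdifferentiableAt (by simp))]
  exact htan _ (ht t).1 _ (ht t).2

lemma Foliation.map_mem_leafIn {N : Type*} [TopologicalSpace N] [ChartedSpace (Model m) N]
    {c c' : ℕ} {F : Foliation m M c} {F' : Foliation m N c'} {U : Set M} {U' : Set N}
    (hU : IsOpen U) {φ : M → N} (hφ : ContMDiffOn (𝓡 m) (𝓡 m) ∞ φ U) (hmaps : Set.MapsTo φ U U')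
    (htan : ∀ q ∈ U, ∀ v ∈ F.tangent q, mfderiv (𝓡 m) (𝓡 m) φ q v ∈ F'.tangent (φ q))
    {p q : M} (h : q ∈ F.leafIn U p) : φ q ∈ F'.leafIn U' (φ p) :=
  Relation.ReflTransGen.lift (r := F.Joined U) (p := F'.Joined U') φ
    (fun _ _ h => Foliation.Joined.map hU hφ hmaps htan h) _ _ h

lemma Foliation.leafIn_subset {r : ℕ} {F : Foliation m M r} {U : Set M} {p : M} (hp : p ∈ U) :
    F.leafIn U p ⊆ U := by
  intro q hq
  induction hq with
  | refl => exact hp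
  | tail _ h _ =>
    obtain ⟨γ, -, -, rfl, ht⟩ := h
    exact (ht 1).1

/-- The coordinates defining a foliation of `ℝ^m` are constant along its leaves. -/
lemma eq_of_mem_leafIn_coordFoliation {r : ℕ} {S : Finset (Fin m)} (hS : S.card = r)
    {U : Set (Model m)} {x y : Model m} (h : y ∈ (coordFoliation S hS).leafIn U x) {k : Fin m}
    (hk : k ∈ S) : y k = x k := by
  induction h with
  | refl => rfl
  | tail _ h ih =>
    rw [← ih]
    obtain ⟨γ, hγ, rfl, rfl, ht⟩ := h
    have h1 : ∀ t, HasDerivAt (fun s => γ s k) 0 t := by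
      intro t
      let L : ℝ →L[ℝ] Model m := mfderiv 𝓘(ℝ, ℝ) (𝓡 m) γ t
      have h1 : HasFDerivAt γ L t :=
        ((hγ t).mdifferentiableAt (by simp)).hasMFDerivAt.hasFDerivAt
      have h2 := h1.hasDerivAt
      have h3 := (EuclideanSpace.proj (𝕜 := ℝ) k).hasFDerivAt.comp_hasDerivAt t h2
      have h4 := (mem_coordSubspace S _).1 (ht t).2 k hk
      rw [← h4]
      exact h3
    exact is_const_of_deriv_eq_zero (fun t => (h1 t).differentiableAt)
      (fun t => (h1 t).deriv) 1 0

/-- Curves tangent to a foliation in any tangent direction. -/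
lemma Foliation.exists_tangent_curve [IsManifold (𝓡 m) ∞ M] {r : ℕ} (F : Foliation m M r)
    {U : Set M} (hU : IsOpen U) {p : M} (hp : p ∈ U) {v : TangentSpace (𝓡 m) p}
    (hv : v ∈ F.tangent p) :
    ∃ (e : OpenPartialHomeomorph M (Model m)) (δ : ℝ), IsSmoothChart e ∧ p ∈ e.source ∧ 0 < δ ∧
      ∀ t : ℝ, e p + (δ * Real.sin t) • chartD e p v ∈ e.target ∧
        e.symm (e p + (δ * Real.sin t) • chartD e p v) ∈ F.leafIn U p := by
  obtain ⟨e, he, hpe, S, -, hS⟩ := F.exists_flat_chart p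
  have he' := isSmoothChart_of_mem_maximalAtlas he
  set w := chartD e p v with hw
  have hwS : ∀ k ∈ S, w k = 0 := (hS p hpe v).1 hv
  have hopen : IsOpen (e.target ∩ e.symm ⁻¹' U) := e.isOpen_inter_preimage_symm hU
  have hmem : e p ∈ e.target ∩ e.symm ⁻¹' U :=
    ⟨e.map_source hpe, by rw [Set.mem_preimage, e.left_inv hpe]; exact hp⟩
  -- Joining curves are defined on all of ℝ and may not leave U. A straight line in the flat chart
  -- is therefore traversed with the bounded parameter δ sin, where δ = ρ / (‖w‖ + 1) keeps it in
  -- the ball; adding 1 covers w = 0.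
  obtain ⟨ρ, hρ, hball⟩ := Metric.isOpen_iff.1 hopen _ hmem
  have hw0 : 0 < ‖w‖ + 1 := by positivity
  have hin : ∀ u : ℝ, |u| ≤ 1 →
      e p + (ρ / (‖w‖ + 1) * u) • w ∈ e.target ∩ e.symm ⁻¹' U := by
    intro u hu
    apply hball
    rw [Metric.mem_ball, dist_eq_norm, add_sub_cancel_left, norm_smul, norm_mul, norm_div,
      Real.norm_of_nonneg hρ.le, Real.norm_of_nonneg hw0.le, Real.norm_eq_abs]
    calc ρ / (‖w‖ + 1) * |u| * ‖w‖ ≤ ρ / (‖w‖ + 1) * 1 * ‖w‖ := by gcongr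
      _ < ρ := by
        rw [mul_one, div_mul_eq_mul_div, div_lt_iff₀ hw0]
        nlinarith
  refine ⟨e, ρ / (‖w‖ + 1), he', hpe, by positivity, fun t =>
    ⟨(hin _ (Real.abs_sin_le_one t)).1, Relation.ReflTransGen.single ?_⟩⟩
  have hsm : ∀ s, ContDiffAt ℝ ∞
      (fun s => e p + (ρ / (‖w‖ + 1) * Real.sin (t * s)) • w) s := by
    intro s
    have h1 : ContDiff ℝ ∞ fun s : ℝ => Real.sin (t * s) :=
      Real.contDiff_sin.comp (contDiff_const.mul contDiff_id)
    exact (contDiff_const.add ((contDiff_const.mul h1).smul contDiff_const)).contDiffAt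
  have hγ : ContMDiff 𝓘(ℝ, ℝ) (𝓡 m) ∞
      (fun s => e.symm (e p + (ρ / (‖w‖ + 1) * Real.sin (t * s)) • w)) := fun s =>
    (he'.contMDiffAt_symm (hin _ (Real.abs_sin_le_one _)).1).comp s (hsm s).contMDiffAt
  refine ⟨_, hγ, by simp [e.left_inv hpe], by simp [hw], fun s =>
    ⟨(hin _ (Real.abs_sin_le_one _)).2, ?_⟩⟩
  have hsrc := e.map_target (hin _ (Real.abs_sin_le_one (t * s))).1
  rw [hS _ hsrc]
  intro k hk
  have h1 := he'.hasDerivAt_comp ((hγ s).mdifferentiableAt (by simp)) hsrc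
  have h2 := (EuclideanSpace.proj (𝕜 := ℝ) k).hasFDerivAt.comp_hasDerivAt s h1
  refine h2.unique ?_
  have h3 : (fun s => EuclideanSpace.proj (𝕜 := ℝ) k
      (e (e.symm (e p + (ρ / (‖w‖ + 1) * Real.sin (t * s)) • w)))) = fun _ => e p k := by
    funext s
    rw [e.right_inv (hin _ (Real.abs_sin_le_one _)).1]
    simp [hwS k hk]
  exact (hasDerivAt_const s (e p k)).congr_of_eventuallyEq (Filter.Eventually.of_forall
    (congrFun h3))

end Leaves

/-! ### From leaves back to tangent spaces. -/

section FoliationCharts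

variable {m : ℕ} {M : Type*} [TopologicalSpace M] [ChartedSpace (Model m) M]
  [IsManifold (𝓡 m) ∞ M]

/-- A map carrying the leaves of a foliation into level sets of coordinates maps tangent vectors
to vectors with vanishing coordinates. -/
lemma chartD_eq_zero_of_leafIn {r r' : ℕ} {F : Foliation m M r} {S : Finset (Fin m)}
    {hS : S.card = r'} {φ : OpenPartialHomeomorph M (Model m)} (hφ : IsSmoothChart φ) {q : M}
    (hq : q ∈ φ.source)
    (h : φ '' F.leafIn φ.source q ⊆ (coordFoliation S hS).leafIn φ.target (φ q))
    {v : TangentSpace (𝓡 m) q} (hv : v ∈ F.tangent q) {k : Fin m} (hk : k ∈ S) :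
    chartD φ q v k = 0 := by
  obtain ⟨e, δ, he, hqe, hδ, ht⟩ := F.exists_tangent_curve φ.open_source hq hv
  have h1 : HasDerivAt (fun t : ℝ => e q + (δ * Real.sin t) • chartD e q v)
      (δ • chartD e q v) 0 := by
    have h2 := (((Real.hasDerivAt_sin 0).const_mul δ).smul_const (chartD e q v)).const_add (e q)
    simpa using h2
  have h2 : e q + (δ * Real.sin 0) • chartD e q v = e q := by simp
  have h3 : MDifferentiableAt (𝓡 m) 𝓘(ℝ, Model m) φ q :=
    (hφ.contMDiffAt hq).mdifferentiableAt (by simp)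
  have h4 : HasFDerivAt (φ ∘ e.symm) (fderiv ℝ (φ ∘ e.symm) (e q))
      (e q + (δ * Real.sin 0) • chartD e q v) := by
    rw [h2]
    exact (he.mdifferentiableAt_comp_symm hqe h3).hasFDerivAt
  have h5 := (EuclideanSpace.proj (𝕜 := ℝ) k).hasFDerivAt.comp_hasDerivAt 0
    (h4.comp_hasDerivAt 0 h1)
  -- The curve stays in the leaf, so its image has constant k-th coordinate. Its velocity at 0 is δ
  -- v, with δ ≠ 0.
  have h6 : (EuclideanSpace.proj (𝕜 := ℝ) k ∘ (φ ∘ e.symm) ∘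
      fun t : ℝ => e q + (δ * Real.sin t) • chartD e q v) = fun _ => φ q k := by
    funext t
    exact eq_of_mem_leafIn_coordFoliation hS (h ⟨_, (ht t).2, rfl⟩) hk
  have h7 := h5.unique (by rw [h6]; exact hasDerivAt_const 0 (φ q k))
  have h8 : chartD φ q v = fderiv ℝ (φ ∘ e.symm) (e q) (chartD e q v) := he.mvfderiv_eq hqe h3 v
  rw [map_smul, map_smul, smul_eq_mul] at h7
  rw [h8]
  exact (mul_eq_zero.1 h7).resolve_left hδ.ne'

omit [IsManifold (𝓡 m) ∞ M] in
lemma finrank_comap_coordSubspace {φ : OpenPartialHomeomorph M (Model m)} (hφ : IsSmoothChart φ)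
    {q : M} (hq : q ∈ φ.source) (S : Finset (Fin m)) :
    S.card + Module.finrank ℝ ((coordSubspace S).comap (chartD φ q).toLinearMap) = m := by
  let L : TangentSpace (𝓡 m) q ≃ₗ[ℝ] Model m := (hφ.derivEquiv hq).toLinearEquiv
  have h1 := (coordSubspace S).finrank_quotient_add_finrank
  have h2 : Module.finrank ℝ (Model m) = m := finrank_euclideanSpace_fin (𝕜 := ℝ)
  have h3 : (coordSubspace S).comap (chartD φ q).toLinearMap = (coordSubspace S).map
      (L.symm : Model m →ₗ[ℝ] TangentSpace (𝓡 m) q) :=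
    (Submodule.map_equiv_eq_comap_symm L.symm (coordSubspace S)).symm
  rw [finrank_quotient_coordSubspace, h2, ← LinearEquiv.finrank_map_eq L.symm] at h1
  rw [h3]
  exact h1

/-- A dimension count: the hypothesis is an inclusion of a subspace of codimension r into one of
codimension `S.card`, which is an equality when the codimensions agree. -/
lemma Foliation.mem_tangent_iff_of_imp {r : ℕ} {F : Foliation m M r} {S : Finset (Fin m)}
    {φ : OpenPartialHomeomorph M (Model m)} (hφ : IsSmoothChart φ) {q : M} (hq : q ∈ φ.source)
    (h : ∀ v ∈ F.tangent q, ∀ k ∈ S, chartD φ q v k = 0) :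
    S.card ≤ r ∧ (S.card = r → ∀ v, v ∈ F.tangent q ↔ ∀ k ∈ S, chartD φ q v k = 0) := by
  have : FiniteDimensional ℝ (TangentSpace (𝓡 m) q) :=
    inferInstanceAs (FiniteDimensional ℝ (Model m))
  have hm : Module.finrank ℝ (TangentSpace (𝓡 m) q) = m := finrank_euclideanSpace_fin (𝕜 := ℝ)
  have hle : F.tangent q ≤ (coordSubspace S).comap (chartD φ q).toLinearMap := fun v hv =>
    (mem_coordSubspace _ _).2 fun k hk => h v hv k hk
  have h1 := (F.tangent q).finrank_quotient_add_finrank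
  rw [Foliation.finrank_quotient_tangent, hm] at h1
  have h2 := finrank_comap_coordSubspace hφ hq S
  have h3 := Submodule.finrank_mono hle
  refine ⟨by omega, fun hS v => ?_⟩
  rw [Submodule.eq_of_le_of_finrank_eq hle (by omega)]
  exact mem_coordSubspace _ _

end FoliationCharts

namespace DivFreeWeb

/-! ### Local triviality implies flatness. -/

section Flatness

variable {m n : ℕ} {c : Fin n → ℕ} {M : Type*} [TopologicalSpace M] [ChartedSpace (Model m) M]
  [IsManifold (𝓡 m) ∞ M] {W : DivFreeWeb m M c}

/-- The tangent spaces of a web which is carried leafwise to the standard web. -/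
lemma mem_tangent_iff_of_leafIn {φ : OpenPartialHomeomorph M (Model m)} (hφ : IsSmoothChart φ)
    (σ : Equiv.Perm (Fin n))
    (h : ∀ i, ∀ q ∈ φ.source, φ '' ((W.fol i).leafIn φ.source q) =
      ((standardWeb c W.sum_codim).fol (σ i)).leafIn φ.target (φ q)) {q : M} (hq : q ∈ φ.source) :
    (∀ i, c (σ i) = c i) ∧ ∀ i (v : TangentSpace (𝓡 m) q), v ∈ (W.fol i).tangent q ↔
      ∀ k ∈ block c (σ i), chartD φ q v k = 0 := by
  have htan := fun i => Foliation.mem_tangent_iff_of_imp hφ hq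
    (fun v hv k hk => chartD_eq_zero_of_leafIn (F := W.fol i)
      (hS := card_block c W.sum_codim (σ i)) hφ hq (h i q hq).le hv hk)
  simp only [card_block c W.sum_codim] at htan
  -- The inequalities c(σ i) ≤ c(i) have equal sums on both sides, because σ is a permutation; hence
  -- all are equalities.
  have hceq : ∀ i, c (σ i) = c i := by
    have h1 : ∑ i, c (σ i) = ∑ i, c i := Equiv.sum_comp σ c
    have h2 := (Finset.sum_eq_sum_iff_of_le fun i _ => (htan i).1).1 h1
    exact fun i => h2 i (Finset.mem_univ i)
  exact ⟨hceq, fun i => (htan i).2 (hceq i)⟩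

/-- The equivalence becomes a web chart after its coordinates are relabelled to undo the permutation
of the foliations. Relabelling multiplies the standard volume by a constant determinant. -/
lemma exists_webChart_of_locallyEquivalentAt {p : M}
    (h : LocallyEquivalentAt W p (standardWeb c W.sum_codim) 0) :
    ∃ e : OpenPartialHomeomorph M (Model m), W.IsWebChart e ∧ p ∈ e.source ∧
      ∃ d : ℝ, ∀ x ∈ e.target, W.density e x = d := by
  obtain ⟨φ, hφ1, hφ2, hp, -, ⟨σ, hσ⟩, hvol⟩ := h
  have hφ : IsSmoothChart φ := ⟨hφ1, hφ2⟩
  have htan := fun q (hq : q ∈ φ.source) => mem_tangent_iff_of_leafIn hφ σ hσ hq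
  have hcσ := (htan p hp).1
  let E : ∀ i, {x // x ∈ block (m := m) c i} ≃ {x // x ∈ block (m := m) c (σ i)} := fun i =>
    Finset.equivOfCardEq
      ((card_block c W.sum_codim i).trans ((hcσ i).symm.trans (card_block c W.sum_codim (σ i)).symm))
  let τ : Fin m → Fin m := fun k => E (W.idx k) ⟨k, mem_block_blockIndex c W.sum_codim k⟩
  have hτ : ∀ i k (hk : k ∈ block c i), τ k = E i ⟨k, hk⟩ := by
    intro i k hk
    have := W.mem_block.1 hk
    subst this
    rfl
  obtain ⟨e, he, hpe, hsub, -, hD⟩ := W.exists_webChart_of_functions φ.open_source hp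
    (fun _ => φ) (fun _ => hφ.contMDiffOn) τ (fun q hq i v => by
      rw [(htan q hq).2 i v]
      constructor
      · intro hv k hk
        rw [hτ i k hk]
        exact hv _ (E i ⟨k, hk⟩).2
      · intro hv s hs
        have := hv ((E i).symm ⟨s, hs⟩) ((E i).symm ⟨s, hs⟩).2
        rw [hτ i _ ((E i).symm ⟨s, hs⟩).2] at this
        simp only [Subtype.coe_eta, Equiv.apply_symm_apply] at this
        exact this)
  have hcoord : ∀ q ∈ e.source, ∀ (v : TangentSpace (𝓡 m) q) k,
      chartD e q v k = chartD φ q v (τ k) := hD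
  refine ⟨e, he, hpe, (Matrix.of fun j k : Fin m => if τ j = k then (1 : ℝ) else 0).det⁻¹,
    fun x hx => ?_⟩
  have hq := e.map_target hx
  have hqφ := hsub hq
  let v : Fin m → TangentSpace (𝓡 m) (e.symm x) := fun k =>
    chartDInv φ (e.symm x) (EuclideanSpace.single k 1)
  have hv : ∀ k, chartD φ (e.symm x) (v k) = EuclideanSpace.single k 1 := fun k =>
    hφ.chartD_chartDInv hqφ _
  have h1 : W.vol (e.symm x) v = 1 := by
    rw [hvol _ hqφ]
    have h2 : (fun j => mfderiv (𝓡 m) (𝓡 m) φ (e.symm x) (v j)) =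
      (EuclideanSpace.basisFun (Fin m) ℝ).toBasis := by
      funext j
      refine (hv j).trans ?_
      simp
    change (EuclideanSpace.basisFun (Fin m) ℝ).toBasis.det _ = 1
    rw [h2]
    exact (EuclideanSpace.basisFun (Fin m) ℝ).toBasis.det_self
  rw [W.vol_eq he.toIsSmoothChart hq, e.right_inv hx] at h1
  have h3 : (Matrix.of fun j k => chartD e (e.symm x) (v k) j) =
      Matrix.of fun j k : Fin m => if τ j = k then (1 : ℝ) else 0 := by
    ext j k
    rw [Matrix.of_apply, hcoord _ hq, hv, PiLp.single_apply, Matrix.of_apply]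
  rw [h3] at h1
  exact eq_inv_of_mul_eq_one_left h1

theorem flat_of_locallyTrivial [T2Space M] [SecondCountableTopology M] (hm : 0 < m) (h : W.LocallyTrivial) :
    (W.naturalConnection hm).Flat := by
  refine naturalConnection_flat_of hm fun p => ?_
  obtain ⟨e, he, hp, d, hd⟩ := exists_webChart_of_locallyEquivalentAt (h p)
  refine ⟨e, he, hp, fun i a b => ?_⟩
  have h1 : ∀ x ∈ e.target, fderiv ℝ (W.logDensity e) x = 0 := by
    intro x hx
    have h2 : W.logDensity e =ᶠ[𝓝 x] fun _ => Real.log d := by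
      filter_upwards [e.open_target.mem_nhds hx] with y hy
      rw [logDensity, hd y hy]
    rw [h2.fderiv_eq, fderiv_const_apply]
  have h2 : fderiv ℝ (W.logDensity e) =ᶠ[𝓝 (e p)] fun _ => 0 := by
    filter_upwards [e.open_target.mem_nhds (e.map_source hp)] with y hy using h1 y hy
  rw [h2.fderiv_eq, fderiv_const_apply]
  rfl

end Flatness

end DivFreeWeb

end WebGeometry

end

noncomputable section

namespace WebGeometry

/-! ### Smooth primitives in a coordinate direction. -/

section Primitive

variable {m : ℕ}

/-- Parametric integrals of smooth functions are smooth. -/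
lemma contDiff_integral_unitInterval {E : Type*} [NormedAddCommGroup E] [NormedSpace ℝ E]
    [FiniteDimensional ℝ E] {F : E × ℝ → ℝ} (hF : ContDiff ℝ ∞ F) :
    ContDiff ℝ ∞ fun x => ∫ s in (0 : ℝ)..1, F (x, s) := by
  -- The integral is the value at 0 of the convolution of the indicator of (-1, 0] with F(x, ·)ψ.
  -- The cut-off provides compact support and equals 1 on [0, 1].
  let ψ : ContDiffBump (0 : ℝ) := ⟨1, 2, one_pos, one_lt_two⟩
  let f : ℝ → ℝ := Set.indicator (Set.Ioc (-1) 0) fun _ => 1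
  have h1 : ContDiffOn ℝ ∞ (fun x => MeasureTheory.convolution f
      (fun u => F (x, u) * ψ u) (ContinuousLinearMap.mul ℝ ℝ) MeasureTheory.volume (0 : ℝ))
      Set.univ := by
    refine MeasureTheory.contDiffOn_convolution_right_with_param_comp (n := ⊤) (ContinuousLinearMap.mul ℝ ℝ)
      (v := fun _ => 0) contDiffOn_const (k := Metric.closedBall 0 2)
      (g := fun x u => F (x, u) * ψ u) isOpen_univ
      (isCompact_closedBall 0 2) (fun x u _ hu => ?_) ?_ ?_
    · have : ψ u = 0 := ψ.zero_of_le_dist (by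
        rw [Metric.mem_closedBall, not_le] at hu
        exact hu.le)
      simp only [this, mul_zero]
    · exact ((MeasureTheory.integrable_indicator_iff measurableSet_Ioc).2
        (by simp)).locallyIntegrable
    · exact (hF.mul (ψ.contDiff.comp contDiff_snd)).contDiffOn
  rw [← contDiffOn_univ]
  refine h1.congr fun x _ => ?_
  have h2 : ∀ t, ContinuousLinearMap.mul ℝ ℝ (f t) (F (x, 0 - t) * ψ (0 - t)) =
      Set.indicator (Set.Ioc (-1) 0) (fun t => F (x, -t) * ψ (-t)) t := by
    intro t
    by_cases ht : t ∈ Set.Ioc (-1 : ℝ) 0 <;> simp [f, ht]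
  have h3 := intervalIntegral.integral_comp_neg (a := -1) (b := 0) fun s => F (x, s) * ψ s
  rw [neg_zero, neg_neg] at h3
  rw [MeasureTheory.convolution]
  simp_rw [h2]
  rw [MeasureTheory.integral_indicator measurableSet_Ioc,
    ← intervalIntegral.integral_of_le (by norm_num), h3]
  refine intervalIntegral.integral_congr fun s hs => ?_
  rw [Set.uIcc_of_le zero_le_one] at hs
  have h4 : ψ s = 1 := ψ.one_of_mem_closedBall (by
    rw [mem_closedBall_zero_iff, Real.norm_eq_abs, abs_of_nonneg hs.1]
    exact hs.2)
  simp only [h4, mul_one]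

/-- A smooth function on `ℝ^m` has a primitive in any coordinate direction. -/
lemma exists_primitive {g : Model m → ℝ} (hg : ContDiff ℝ ∞ g) (k : Fin m) :
    ∃ Y : Model m → ℝ, ContDiff ℝ ∞ Y ∧ Y 0 = 0 ∧
      (∀ x, fderiv ℝ Y x (EuclideanSpace.single k 1) = g x) ∧
      ∀ w : Model m, w k = 0 → (∀ x (t : ℝ), g (x + t • w) = g x) → ∀ x, fderiv ℝ Y x w = 0 := by
  -- `A x s` is x with its k-th coordinate replaced by s, and Y integrates g over s from 0 to x_k.
  -- Rescaling to the unit interval makes Y a parametric integral over a fixed domain.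
  let A : Model m → ℝ → Model m := fun x s => x + (s - x k) • EuclideanSpace.single k 1
  let Y : Model m → ℝ := fun x => x k * ∫ s in (0 : ℝ)..1, g (A x (s * x k))
  have hcoord : ContDiff ℝ ∞ fun x : Model m => x k := (EuclideanSpace.proj (𝕜 := ℝ) k).contDiff
  have hY : ContDiff ℝ ∞ Y := by
    refine hcoord.mul (contDiff_integral_unitInterval
      (F := fun z : Model m × ℝ => g (A z.1 (z.2 * z.1 k))) (hg.comp ?_))
    have h1 : ContDiff ℝ ∞ fun z : Model m × ℝ => z.1 k := hcoord.comp contDiff_fst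
    exact contDiff_fst.add (((contDiff_snd.mul h1).sub h1).smul contDiff_const)
  have hYint : ∀ x, Y x = ∫ s in (0 : ℝ)..(x k), g (A x s) := by
    intro x
    have h := intervalIntegral.mul_integral_comp_mul_right (a := 0) (b := 1)
      (f := fun s => g (A x s)) (c := x k)
    rw [zero_mul, one_mul] at h
    exact h
  have hline : ∀ x w : Model m, HasDerivAt (fun t : ℝ => Y (x + t • w)) (fderiv ℝ Y x w) 0 := by
    intro x w
    have h1 : HasDerivAt (fun t : ℝ => x + t • w) w 0 := by
      simpa using ((hasDerivAt_id (0 : ℝ)).smul_const w).const_add x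
    have h2 : HasFDerivAt Y (fderiv ℝ Y x) (x + (0 : ℝ) • w) := by
      rw [zero_smul, add_zero]
      exact (hY.differentiable (by simp) x).hasFDerivAt
    exact h2.comp_hasDerivAt 0 h1
  refine ⟨Y, hY, by simp [Y], fun x => ?_, fun w hwk hw x => ?_⟩
  · have h1 : ∀ t : ℝ, Y (x + t • EuclideanSpace.single k 1) =
        ∫ s in (0 : ℝ)..(x k + t), g (A x s) := by
      intro t
      have h2 : ∀ s, A (x + t • EuclideanSpace.single k 1) s = A x s := by
        intro s
        simp only [A, PiLp.add_apply, PiLp.smul_apply, PiLp.single_apply, if_true, smul_eq_mul,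
          mul_one]
        module
      rw [hYint]
      simp [h2]
    have hcont : Continuous fun s => g (A x s) := by
      refine hg.continuous.comp ?_
      fun_prop
    have h2 := (hcont.integral_hasStrictDerivAt 0 (x k)).hasDerivAt
    have h3 : HasDerivAt (fun t : ℝ => ∫ s in (0 : ℝ)..(x k + t), g (A x s)) (g (A x (x k))) 0 := by
      exact HasDerivAt.comp_const_add (x k) 0 (by rwa [add_zero])
    have h5 := hline x (EuclideanSpace.single k 1)
    simp_rw [h1] at h5
    rw [h5.unique h3]
    simp [A]
  · have h1 : ∀ t : ℝ, Y (x + t • w) = Y x := by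
      intro t
      rw [hYint, hYint]
      have h2 : ∀ s, A (x + t • w) s = A x s + t • w := by
        intro s
        simp only [A, PiLp.add_apply, PiLp.smul_apply, hwk, smul_zero, add_zero]
        abel
      simp_rw [h2, hw]
      simp [hwk]
    have h5 := hline x w
    simp_rw [h1] at h5
    exact h5.unique (hasDerivAt_const _ _)

end Primitive

/-! ### Separation of variables and the triangular map. -/

section Separation

variable {m n : ℕ} (c : Fin n → ℕ) (hc : ∑ i, c i = m)

lemma norm_blockProj_le (i : Fin n) (x : Model m) : ‖blockProj c hc i x‖ ≤ ‖x‖ := by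
  rw [EuclideanSpace.norm_eq, EuclideanSpace.norm_eq]
  refine Real.sqrt_le_sqrt (Finset.sum_le_sum fun k _ => ?_)
  rw [blockProj_apply]
  split_ifs
  · exact le_rfl
  · rw [norm_zero, zero_pow two_ne_zero]
    exact sq_nonneg _

/-- A function with vanishing mixed second derivatives is a sum of functions of the blocks of
variables. -/
lemma eq_sum_blockProj {f : Model m → ℝ} {r : ℝ} (hr : 0 < r)
    (hf : ∀ x ∈ Metric.ball 0 r, ContDiffAt ℝ ∞ f x)
    (h : ∀ x ∈ Metric.ball 0 r, ∀ i a b, fderiv ℝ (fderiv ℝ f) x a (blockProj c hc i b) =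
      fderiv ℝ (fderiv ℝ f) x b (blockProj c hc i a)) {x : Model m} (hx : x ∈ Metric.ball 0 r) :
    f x - f 0 = ∑ i, (f (blockProj c hc i x) - f 0) := by
  have hP : ∀ {x : Model m} (i : Fin n), x ∈ Metric.ball 0 r →
      blockProj c hc i x ∈ Metric.ball 0 r := by
    intro x i hx
    rw [mem_ball_zero_iff] at hx ⊢
    exact (norm_blockProj_le c hc i x).trans_lt hx
  -- The derivative of f in a direction of block i depends only on P_i x. Along u = x - P_i x its
  -- rate of change is D²f(u, P_i v) = D²f(v, P_i u) = 0.
  have hd : ∀ x ∈ Metric.ball 0 r, ∀ i v, fderiv ℝ f x (blockProj c hc i v) =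
      fderiv ℝ f (blockProj c hc i x) (blockProj c hc i v) := by
    intro x hx i v
    set u := x - blockProj c hc i x with hu
    have hPu : blockProj c hc i u = 0 := by
      rw [hu, map_sub, blockProj_blockProj, if_pos rfl, sub_self]
    have hz : ∀ t ∈ Set.Icc (0 : ℝ) 1, blockProj c hc i x + t • u ∈ Metric.ball 0 r :=
      fun t ht => (convex_ball 0 r).add_smul_sub_mem (hP i hx) hx ht
    have hderiv : ∀ t ∈ Set.Icc (0 : ℝ) 1, HasDerivAt
        (fun t : ℝ => fderiv ℝ f (blockProj c hc i x + t • u) (blockProj c hc i v)) 0 t := by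
      intro t ht
      have h1 : HasDerivAt (fun t : ℝ => blockProj c hc i x + t • u) u t := by
        simpa using ((hasDerivAt_id t).smul_const u).const_add (blockProj c hc i x)
      have h2 : DifferentiableAt ℝ (fderiv ℝ f) (blockProj c hc i x + t • u) :=
        ((hf _ (hz t ht)).fderiv_right (m := ∞) (by simp)).differentiableAt (by simp)
      have h3 : HasDerivAt (fun t : ℝ => fderiv ℝ f (blockProj c hc i x + t • u))
          (fderiv ℝ (fderiv ℝ f) (blockProj c hc i x + t • u) u) t :=
        HasFDerivAt.comp_hasDerivAt t h2.hasFDerivAt h1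
      have h4 := HasFDerivAt.comp_hasDerivAt t
        (ContinuousLinearMap.apply ℝ ℝ (blockProj c hc i v)).hasFDerivAt h3
      rw [ContinuousLinearMap.apply_apply, h _ (hz t ht), hPu, map_zero] at h4
      exact h4
    have h1 := constant_of_has_deriv_right_zero
      (fun t ht => (hderiv t ht).continuousAt.continuousWithinAt)
      (fun t ht => (hderiv t (Set.Ico_subset_Icc_self ht)).hasDerivWithinAt) 1
      (Set.right_mem_Icc.2 zero_le_one)
    simpa [hu] using h1
  have hfd : ∀ x ∈ Metric.ball 0 r, HasFDerivAt
      (fun x => f x - ∑ i, f (blockProj c hc i x)) (0 : Model m →L[ℝ] ℝ) x := by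
    intro x hx
    have h1 : ∀ i, HasFDerivAt (fun x => f (blockProj c hc i x))
        ((fderiv ℝ f (blockProj c hc i x)).comp (blockProj c hc i)) x := by
      intro i
      have h0 : DifferentiableAt ℝ f (blockProj c hc i x) :=
        (hf _ (hP i hx)).differentiableAt (by simp)
      exact HasFDerivAt.comp x h0.hasFDerivAt (blockProj c hc i).hasFDerivAt
    have h2 : HasFDerivAt (fun x => ∑ i, f (blockProj c hc i x))
        (∑ i, (fderiv ℝ f (blockProj c hc i x)).comp (blockProj c hc i)) x :=
      HasFDerivAt.fun_sum fun i _ => h1 i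
    refine (((hf x hx).differentiableAt (by simp)).hasFDerivAt.fun_sub h2).congr_fderiv ?_
    ext1 v
    have h3 : fderiv ℝ f x v = ∑ i, fderiv ℝ f x (blockProj c hc i v) := by
      rw [← _root_.map_sum, sum_blockProj]
    rw [_root_.sub_apply, _root_.sum_apply, h3, ← Finset.sum_sub_distrib]
    exact Finset.sum_eq_zero fun i _ => sub_eq_zero.2 (hd x hx i v)
  have hconst := Metric.isOpen_ball.is_const_of_fderiv_eq_zero (𝕜 := ℝ)
    (convex_ball (0 : Model m) r).isPreconnected
    (fun x hx => (hfd x hx).differentiableAt.differentiableWithinAt)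
    (fun x hx => (hfd x hx).fderiv) hx (Metric.mem_ball_self hr)
  simp only [map_zero] at hconst
  rw [Finset.sum_sub_distrib]
  linarith

/-- A diffeomorphism preserving the blocks of coordinates with prescribed diagonal derivatives. -/
lemma exists_triangular_map {G : Fin m → Model m → ℝ} (hG : ∀ k, ContDiff ℝ ∞ (G k))
    (h : ∀ j k, k < j ∨ blockIndex c hc k ≠ blockIndex c hc j → ∀ x (t : ℝ),
      G j (x + t • EuclideanSpace.single k 1) = G j x) :
    ∃ y : Model m → Model m, ContDiff ℝ ∞ y ∧ y 0 = 0 ∧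
      (∀ x, (Matrix.of fun j k => fderiv ℝ y x (EuclideanSpace.single k 1) j).det =
        ∏ k, G k x) ∧
      ∀ x j k, blockIndex c hc k ≠ blockIndex c hc j →
        fderiv ℝ y x (EuclideanSpace.single k 1) j = 0 := by
  choose Y hY hY0 hYk hYw using fun k => exists_primitive (hG k) k
  let y : Model m → Model m := fun x => WithLp.toLp 2 fun k => Y k x
  have hy : ContDiff ℝ ∞ y := contDiff_euclidean.2 hY
  have hfd : ∀ x w j, fderiv ℝ y x w j = fderiv ℝ (Y j) x w := by
    intro x w j
    have h1 : HasFDerivAt (fun x => y x j)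
        ((EuclideanSpace.proj (𝕜 := ℝ) j).comp (fderiv ℝ y x)) x :=
      (EuclideanSpace.proj (𝕜 := ℝ) j).hasFDerivAt.comp x
        (hy.differentiable (by simp) x).hasFDerivAt
    exact congrArg (fun T : Model m →L[ℝ] ℝ => T w) h1.fderiv.symm
  have hzero : ∀ x j k, k < j ∨ blockIndex c hc k ≠ blockIndex c hc j →
      fderiv ℝ y x (EuclideanSpace.single k 1) j = 0 := by
    intro x j k hjk
    rw [hfd]
    refine hYw j _ ?_ (h j k hjk) x
    rw [PiLp.single_apply, if_neg]
    rintro rfl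
    rcases hjk with hjk | hjk
    · exact lt_irrefl _ hjk
    · exact hjk rfl
  refine ⟨y, hy, ?_, fun x => ?_, fun x j k hjk => hzero x j k (Or.inr hjk)⟩
  · ext k
    exact hY0 k
  -- The j-th component is the primitive of G_j in direction j. It ignores the coordinates k < j, as
  -- G_j does, so the Jacobian matrix is upper triangular with diagonal entries G_j.
  · rw [Matrix.det_of_isUpperTriangular]
    · refine Finset.prod_congr rfl fun k _ => ?_
      rw [Matrix.of_apply, hfd, hYk]
    · intro j k hjk
      exact hzero x j k (Or.inl hjk)

end Separation

end WebGeometry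

end

noncomputable section

namespace WebGeometry

/-! ### Choosing one coordinate in each block. -/

section Pivot

variable {m n : ℕ} (c : Fin n → ℕ) (hc : ∑ i, c i = m)

/-- The index is the first one of its block. -/
def IsFirstInBlock (k : Fin m) : Prop := ∀ l, blockIndex c hc l = blockIndex c hc k → k ≤ l

open Classical in
-- Each nonempty block contributes exactly once, through its first index. Empty blocks, which occur
-- when some c_i = 0, are covered by the hypothesis.
lemma sum_isFirstInBlock {φ : Fin n → ℝ} (h : ∀ i, (∀ k, blockIndex c hc k ≠ i) → φ i = 0) :
    ∑ k : Fin m, (if IsFirstInBlock c hc k then φ (blockIndex c hc k) else 0) = ∑ i, φ i := by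
  rw [← Finset.sum_fiberwise Finset.univ (blockIndex c hc)]
  refine Finset.sum_congr rfl fun i _ => ?_
  set s := Finset.univ.filter fun k => blockIndex c hc k = i with hs
  have hmem : ∀ k, k ∈ s ↔ blockIndex c hc k = i := fun k => by simp [hs]
  rcases s.eq_empty_or_nonempty with hse | hne
  · rw [hse, Finset.sum_empty, h i]
    intro k hk
    have := (hmem k).2 hk
    rw [hse] at this
    exact Finset.notMem_empty _ this
  · have hk := (hmem _).1 (s.min'_mem hne)
    rw [Finset.sum_eq_single_of_mem _ (s.min'_mem hne), hk, if_pos]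
    · intro l hl
      exact s.min'_le l ((hmem l).2 (hl.trans hk))
    · intro l hl hne'
      rw [if_neg]
      intro hfirst
      exact hne' (le_antisymm (hfirst _ (hk.trans ((hmem l).1 hl).symm)) (s.min'_le l hl))

end Pivot

/-! ### Flatness implies local triviality. -/

namespace DivFreeWeb

variable {m n : ℕ} {c : Fin n → ℕ} {M : Type*} [TopologicalSpace M] [ChartedSpace (Model m) M]
  [IsManifold (𝓡 m) ∞ M] {W : DivFreeWeb m M c} {e : OpenPartialHomeomorph M (Model m)}
  [T2Space M]

/-- The logarithm forgets the sign of the density. The quotient of ρ by exp(log |ρ|) has zero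
derivative, hence is constant on the ball, which carries the sign of ρ(0) to all of it. -/
lemma density_eq_mul_exp (he : IsSmoothChart e) {r : ℝ} (hr : 0 < r)
    (hsub : Metric.ball 0 r ⊆ e.target) {x : Model m} (hx : x ∈ Metric.ball 0 r) :
    W.density e x = W.density e 0 * Real.exp (W.logDensity e x - W.logDensity e 0) := by
  have hfd : ∀ x ∈ Metric.ball 0 r, HasFDerivAt
      (fun x => W.density e x * Real.exp (-W.logDensity e x)) (0 : Model m →L[ℝ] ℝ) x := by
    intro x hx
    have h1 := ((W.contDiffAt_density he (hsub hx)).differentiableAt (by simp)).hasFDerivAt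
    have h2 := ((W.contDiffAt_logDensity he (hsub hx)).differentiableAt (by simp)).hasFDerivAt
    refine (h1.mul h2.fun_neg.exp).congr_fderiv ?_
    ext1 v
    have h3 := W.fderiv_density he (hsub hx) v
    simp only [_root_.add_apply, _root_.smul_apply, _root_.neg_apply, smul_eq_mul, h3,
      _root_.zero_apply]
    ring
  have hconst := Metric.isOpen_ball.is_const_of_fderiv_eq_zero (𝕜 := ℝ)
    (convex_ball (0 : Model m) r).isPreconnected
    (fun x hx => (hfd x hx).differentiableAt.differentiableWithinAt)
    (fun x hx => (hfd x hx).fderiv) hx (Metric.mem_ball_self hr)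
  have h1 : Real.exp (W.logDensity e x - W.logDensity e 0) =
      Real.exp (W.logDensity e x) * Real.exp (-W.logDensity e 0) := by
    rw [← Real.exp_add, sub_eq_add_neg]
  have h2 : Real.exp (-W.logDensity e x) * Real.exp (W.logDensity e x) = 1 := by
    rw [← Real.exp_add, neg_add_cancel, Real.exp_zero]
  rw [h1]
  linear_combination Real.exp (W.logDensity e x) * hconst - W.density e x * h2

variable [SecondCountableTopology M]

open Classical in
lemma exists_density_eq_prod (hm : 0 < m) (hflat : (W.naturalConnection hm).Flat)
    (he : W.IsWebChart e) (h0 : (0 : Model m) ∈ e.target) :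
    ∃ (r : ℝ) (G : Fin m → Model m → ℝ), 0 < r ∧ Metric.ball 0 r ⊆ e.target ∧
      (∀ k, ContDiff ℝ ∞ (G k)) ∧
      (∀ j k, k < j ∨ W.idx k ≠ W.idx j → ∀ x (t : ℝ),
        G j (x + t • EuclideanSpace.single k 1) = G j x) ∧
      ∀ x ∈ Metric.ball 0 r, W.density e x = ∏ k, G k x := by
  have he' := he.toIsSmoothChart
  obtain ⟨χ, hχ, hχ1, hχs⟩ := exists_bump (m := m) (e.open_target.mem_nhds h0)
  -- The factors must be smooth on all of ℝ^m in order to be integrated, hence the cut-off; on a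
  -- small ball it equals 1.
  have hf : ContDiff ℝ ∞ fun x => χ x * W.logDensity e x :=
    contMDiff_iff_contDiff.1 (contMDiff_bump_mul hχ hχs fun x hx =>
      (W.contDiffAt_logDensity he' hx).contMDiffAt)
  set f : Model m → ℝ := fun x => χ x * W.logDensity e x with hfdef
  obtain ⟨r, hr, hball⟩ := Metric.mem_nhds_iff.1
    (Filter.inter_mem hχ1 (e.open_target.mem_nhds h0))
  have hsub : Metric.ball 0 r ⊆ e.target := hball.trans Set.inter_subset_right
  have hfeq : ∀ x ∈ Metric.ball 0 r, f x = W.logDensity e x := by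
    intro x hx
    have h1 : χ x = 1 := (hball hx).1
    rw [hfdef]
    simp only [h1, one_mul]
  have hP : ∀ {x : Model m} (i : Fin n), x ∈ Metric.ball 0 r →
      W.proj i x ∈ Metric.ball 0 r := by
    intro x i hx
    rw [mem_ball_zero_iff] at hx ⊢
    exact (norm_blockProj_le c W.sum_codim i x).trans_lt hx
  have hball0 := Metric.mem_ball_self (x := (0 : Model m)) hr
  let k₀ : Fin m := ⟨0, hm⟩
  -- The factor of a block is placed on its first coordinate, which makes the triangular
  -- independence condition hold; the constant ρ(0), sign included, goes to coordinate 0.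
  refine ⟨r, fun k x => (if k = k₀ then W.density e 0 else 1) *
    Real.exp (if IsFirstInBlock c W.sum_codim k then f (W.proj (W.idx k) x) - f 0 else 0),
    hr, hsub, fun k => ?_, fun j k hjk x t => ?_, fun x hx => ?_⟩
  · refine contDiff_const.mul (ContDiff.exp ?_)
    split_ifs
    · exact (hf.comp (W.proj _).contDiff).sub contDiff_const
    · exact contDiff_const
  · by_cases hj : IsFirstInBlock c W.sum_codim j
    · have hne : W.idx k ≠ W.idx j := by
        rcases hjk with hlt | hne
        · exact fun h => absurd (hj k h) (not_le.2 hlt)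
        · exact hne
      simp only [map_add, map_smul, blockProj_single, if_neg hne, smul_zero, add_zero]
    · simp only [if_neg hj]
  · rw [Finset.prod_mul_distrib, Finset.prod_ite_eq' Finset.univ k₀ (fun _ => W.density e 0),
      if_pos (Finset.mem_univ _), ← Real.exp_sum, density_eq_mul_exp he' hr hsub hx]
    congr 2
    rw [sum_isFirstInBlock c W.sum_codim (φ := fun i => f (W.proj i x) - f 0)]
    · rw [eq_sum_blockProj c W.sum_codim hr
        (fun x hx => W.contDiffAt_logDensity he' (hsub hx)) ?_ hx]
      · refine Finset.sum_congr rfl fun i _ => ?_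
        rw [hfeq _ (hP i hx), hfeq _ hball0]
      · intro x hx i a b
        have h1 := hessian_of_naturalConnection_flat hm hflat he (e.map_target (hsub hx)) i a b
        rwa [e.right_inv (hsub hx)] at h1
    · intro i hi
      have h1 : W.proj i x = 0 := by
        ext k
        rw [blockProj_apply, if_neg (hi k)]
        rfl
      simp only [h1, sub_self]

/-- The web chart is composed with the triangular map y. Its Jacobian determinant is the density,
which is nonzero, so the composite is a chart near p and pulls the standard volume form back to that
of the web. -/
lemma exists_unimodular_webChart (hm : 0 < m) (hflat : (W.naturalConnection hm).Flat) (p : M) :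
    ∃ φ : OpenPartialHomeomorph M (Model m), W.IsWebChart φ ∧ p ∈ φ.source ∧ φ p = 0 ∧
      ∀ q ∈ φ.source, ∀ v : Fin m → TangentSpace (𝓡 m) q,
        W.vol q v = (Matrix.of fun j k => chartD φ q (v k) j).det := by
  obtain ⟨e, he, hp, hp0⟩ := W.exists_webChart p
  have he' := he.toIsSmoothChart
  obtain ⟨r, G, hr, hsub, hG, hGk, hdens⟩ := exists_density_eq_prod hm hflat he
    (hp0 ▸ e.map_source hp)
  obtain ⟨y, hy, hy0, hdet, hblock⟩ := exists_triangular_map c W.sum_codim hG hGk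
  let U : Set M := e.source ∩ e ⁻¹' Metric.ball 0 r
  have hU : IsOpen U := e.isOpen_inter_preimage Metric.isOpen_ball
  have hpU : p ∈ U := ⟨hp, by rw [Set.mem_preimage, hp0]; exact Metric.mem_ball_self hr⟩
  have hF : ContMDiffOn (𝓡 m) (𝓡 m) ∞ (fun q => y (e q)) U := fun q hq =>
    (he'.contMDiffAt_comp hq.1 hy.contDiffAt).contMDiffWithinAt
  have hD : ∀ q ∈ U, ∀ v : TangentSpace (𝓡 m) q,
      mvfderiv (𝓡 m) (fun q => y (e q)) q v = fderiv ℝ y (e q) (chartD e q v) := by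
    intro q hq v
    have h1 : MDifferentiableAt (𝓡 m) 𝓘(ℝ, Model m) (fun q => y (e q)) q :=
      (he'.contMDiffAt_comp hq.1 hy.contDiffAt).mdifferentiableAt (by simp)
    rw [he'.mvfderiv_eq hq.1 h1]
    have h2 : (fun q => y (e q)) ∘ e.symm =ᶠ[𝓝 (e q)] y := by
      filter_upwards [e.open_target.mem_nhds (e.map_source hq.1)] with z hz
      rw [Function.comp_apply, e.right_inv hz]
    rw [h2.fderiv_eq]
  let J : Model m → Matrix (Fin m) (Fin m) ℝ := fun x =>
    Matrix.of fun j k => fderiv ℝ y x (EuclideanSpace.single k 1) j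
  have hJ : ∀ x w j, fderiv ℝ y x w j = (J x).mulVec w j := by
    intro x w j
    conv_lhs => rw [← sum_smul_single w]
    simp [J, Matrix.mulVec, dotProduct, mul_comm]
  have hJdet : ∀ q ∈ U, (J (e q)).det = W.density e (e q) := fun q hq => by
    rw [hdens _ hq.2, ← hdet]
  obtain ⟨φ, hφ, hpφ, hφU, hφF⟩ := exists_smoothChart hU hpU hF fun v hv => by
    rw [hD p hpU] at hv
    have h1 : (J (e p)).mulVec (chartD e p v) = 0 := by
      funext j
      rw [← hJ, hv]
      rfl
    have h2 : (chartD e p v).ofLp = 0 := by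
      by_contra hne
      refine W.density_ne_zero he' (e.map_source hp) ?_
      rw [← hJdet p hpU]
      exact Matrix.exists_mulVec_eq_zero_iff.1 ⟨_, hne, h1⟩
    apply he'.chartD_injective hp
    rw [map_zero]
    exact WithLp.ofLp_injective 2 h2
  have hDφ : ∀ q ∈ φ.source, ∀ v : TangentSpace (𝓡 m) q,
      chartD φ q v = fderiv ℝ y (e q) (chartD e q v) := by
    intro q hq v
    rw [← hD q (hφU hq)]
    have h1 : φ =ᶠ[𝓝 q] fun q => y (e q) := by
      filter_upwards [φ.open_source.mem_nhds hq] with z hz using hφF hz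
    change mfderiv (𝓡 m) (𝓡 m) φ q v = mfderiv (𝓡 m) (𝓡 m) (fun q => y (e q)) q v
    rw [h1.mfderiv_eq]
    rfl
  refine ⟨φ, ⟨hφ, fun q hq i => ?_⟩, hpφ, ?_, fun q hq v => ?_⟩
  -- Since the Jacobian matrix of y is block diagonal, one inclusion is immediate; equality of
  -- codimensions gives the other.
  · have himp : ∀ v ∈ (W.fol i).tangent q, ∀ k ∈ block c i, chartD φ q v k = 0 := by
      intro v hv j hj
      rw [he.mem_tangent_iff q (hφU hq).1] at hv
      rw [hDφ q hq, hJ, Matrix.mulVec, dotProduct]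
      refine Finset.sum_eq_zero fun k _ => ?_
      by_cases hk : W.idx k = i
      · rw [hv k (W.mem_block.2 hk), mul_zero]
      · have h1 : J (e q) j k = 0 :=
          hblock _ j k fun h => hk (h.trans (W.mem_block.1 hj))
        rw [h1, zero_mul]
    exact (Foliation.mem_tangent_iff_of_imp hφ hq himp).2 (card_block c W.sum_codim i)
  · rw [hφF hpφ]
    simp only [hp0, hy0]
  · rw [W.vol_eq he' (hφU hq).1, ← hJdet q (hφU hq), ← Matrix.det_mul]
    congr 1
    ext j k
    rw [Matrix.of_apply, hDφ q hq, hJ]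
    rfl

/-- A unimodular web chart is the required equivalence, with trivial permutation: the chart and its
inverse both preserve tangency, so each carries leaves into leaves. -/
theorem locallyTrivial_of_flat (hm : 0 < m) (hflat : (W.naturalConnection hm).Flat) :
    W.LocallyTrivial := by
  intro p
  obtain ⟨φ, hφ, hp, hp0, hvol⟩ := exists_unimodular_webChart hm hflat p
  have hφ' := hφ.toIsSmoothChart
  refine ⟨φ, hφ'.contMDiffOn, hφ'.contMDiffOn_symm, hp, hp0, ⟨Equiv.refl _, fun i q hq => ?_⟩,
    fun q hq v => ?_⟩
  · have htan : ∀ q ∈ φ.source, ∀ v ∈ (W.fol i).tangent q, mfderiv (𝓡 m) (𝓡 m) φ q v ∈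
        ((standardWeb c W.sum_codim).fol i).tangent (φ q) := fun q hq v hv =>
      (mem_coordSubspace _ _).2 ((hφ.mem_tangent_iff q hq i v).1 hv)
    have htan' : ∀ x ∈ φ.target, ∀ v ∈ ((standardWeb c W.sum_codim).fol i).tangent x,
        mfderiv (𝓡 m) (𝓡 m) φ.symm x v ∈ (W.fol i).tangent (φ.symm x) := by
      intro x hx v hv
      rw [← hφ'.chartDInv_eq_mfderiv_symm hx, hφ.mem_tangent_iff _ (φ.map_target hx)]
      intro k hk
      have h1 : chartD φ (φ.symm x) (chartDInv φ (φ.symm x) (v : Model m)) = (v : Model m) :=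
        hφ'.chartD_chartDInv (φ.map_target hx) _
      have h2 := (mem_coordSubspace _ _).1 hv k hk
      exact (congrArg (fun w : Model m => w k) h1).trans h2
    refine Set.Subset.antisymm ?_ fun x hx => ?_
    · rintro _ ⟨q', hq', rfl⟩
      exact Foliation.map_mem_leafIn φ.open_source hφ'.contMDiffOn φ.mapsTo htan hq'
    · have h1 := Foliation.map_mem_leafIn φ.open_target hφ'.contMDiffOn_symm φ.symm.mapsTo htan' hx
      rw [φ.left_inv hq] at h1
      exact ⟨φ.symm x, h1, φ.right_inv (Foliation.leafIn_subset (φ.map_source hq) hx)⟩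
  · rw [hvol q hq]
    have hdet : ∀ u : Fin m → Model m, (EuclideanSpace.basisFun (Fin m) ℝ).toBasis.det u =
        (Matrix.of fun j k => u k j).det := fun u => by
      rw [Module.Basis.det_apply]
      rfl
    exact (hdet fun j => chartD φ q (v j)).symm

end DivFreeWeb

end WebGeometry

end

theorem mainTheorem6 {m n : ℕ} (hm : 0 < m) {c : Fin n → ℕ} {M : Type*} [TopologicalSpace M]
    [T2Space M] [SecondCountableTopology M] [ChartedSpace (WebGeometry.Model m) M]
    [IsManifold (𝓡 m) ∞ M] (W : WebGeometry.DivFreeWeb m M c) :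
    (∃ Θ, W.IsWebConnection Θ) ∧
    ∃ D : W.DetConnection,
      (∀ Θ, W.IsWebConnection Θ → ∀ D' : W.DetConnection, D'.IsInducedBy Θ ↔ D' = D) ∧
      (W.LocallyTrivial ↔ D.Flat) := by
  refine ⟨W.exists_isWebConnection, W.naturalConnection hm, fun Θ hΘ D' =>
    WebGeometry.DivFreeWeb.isInducedBy_iff hm hΘ D',
    WebGeometry.DivFreeWeb.flat_of_locallyTrivial hm,
    WebGeometry.DivFreeWeb.locallyTrivial_of_flat hm⟩
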